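/- Let $n\ge 1$, $\rho_*>0$, $\mathcal I=(0,\pi)\times\mathbb S^{n-1}$ and $\mathcal M=(0,\rho_*)\times\mathcal I$, with coordinates $\rho,t$ on the first two factors, and let $\mathring\gamma$ be the round metric of $\mathbb S^{n-1}$. For a coordinate system $\varphi=(x^A)$ on $\mathbb S^{n-1}$, indices $a,b$ refer to $(t,x^A)$ and $\alpha,\beta$ to $(\rho,t,x^A)$. Write $u=\mathcal O(h)$ if $u$ is smooth and $|\partial_\rho^k\partial_{a_1}\cdots\partial_{a_m}u|\lesssim\rho^{-k}h$ for all $k,m\ge0$, and $u=\mathcal O_0(h)$ if $u$ is smooth and $|\partial_{\alpha_1}\cdots\partial_{\alpha_m}u|\lesssim\rho^{-m}h$ for all $m\ge 0$. A smooth Lorentzian metric $g$ on $\mathcal M$ is a *borderline FG-aAdS segment* if $$g=\rho^{-2}\left[\,d\rho^2+\mathring{\mathfrak g}+\rho^2\bar{\mathfrak g}+\rho^3\mathfrak r\,\right],\qquad \mathring{\mathfrak g}=-dt^2+\mathring\gamma,\qquad \bar{\mathfrak g}=-\tfrac12(dt^2+\mathring\gamma),$$ where $\mathfrak r$ has no $\rho$-components,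 if there is a finite family $\Xi$ of coordinate systems covering $\mathbb S^{n-1}$ (fixed from now on; all $\mathcal O$ and $\mathcal O_0$ refer to every $\varphi\in\Xi$) in which the components of $d\rho^2+\mathring{\mathfrak g}$, of its inverse, of $\bar{\mathfrak g}$ and of $\mathfrak r$ are $\mathcal O(1)$, and if there is a smooth symmetric covariant 2-tensor field $\mathfrak b$ on $\mathcal I$ with $$g_{ab}=\rho^{-2}\mathring{\mathfrak g}_{ab}+\bar{\mathfrak g}_{ab}+\rho\,\mathfrak b_{ab}+\mathcal O(\rho^2).$$ The *borderline pseudoconvexity property* holds with parameters $K>0$ and $\zeta\in C^\infty(\mathcal M)$ if $\zeta=\mathcal O(1)$ and $$\left(-\tfrac32\mathfrak b-\zeta\,\mathring{\mathfrak g}\right)(X,X)\ge K\left[(X^t)^2+\mathring{\mathfrak g}_{AB}X^AX^B\right]\quad\text{for all } X=X^t\partial_t+X^A\partial_A .$$ Let $$\hat f=\frac{\rho(1-\frac14\rho^2)}{\sin t},\qquad \hat S=\hat f^{\,n-3}\,\mathrm{grad}\,\hat f,\qquad \hat w_\zeta=\hat f+\hat f\rho^3\zeta,\qquad \hat\pi_\zeta=-\left(\nabla\hat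 S+\hat f^{\,n-3}\hat w_\zeta\, g\right),$$ where $\mathrm{grad}$ and $\nabla$ are the gradient and the Levi-Civita connection of $g$. Let $(\hat E_1,\dots,\hat E_{n-1})$ be an orthonormal frame of the level sets of $(\rho,t)$, let $\hat N=|\nabla^\alpha\hat f\nabla_\alpha\hat f|^{-1/2}\,\mathrm{grad}\,\hat f$, and let $\hat V=|g(\check V,\check V)|^{-1/2}\check V$, where $$\check V=Z-\sum_X g(Z,\hat E_X)\hat E_X,\qquad Z=(1-\tfrac34\rho^2)\partial_t+(\cos t)\hat f\,\partial_\rho .$$ **Theorem.** Let $(\mathcal M,g)$ be a borderline FG-aAdS segment. There are $\rho_0,f_0>0$, depending only on $g$ and $\Xi$, such that on the region $\{\rho<\rho_0,\ \hat f<f_0\}$ the level sets of $(\rho,t)$ are spacelike, $\mathrm{grad}\,\hat f$ is spacelike and nonzero, and $\check V$ is timelike (so the frames $(\hat N,\hat V,\hat E_X)$ are well defined), and such that the following holds. If the borderline pseudoconvexity property holds with parameters $K,\zeta$, then there are functions $e_1=\mathcal O_0(\hat f^{\,n-1}\rho^3)$ and $e_2=\mathcal O_0(\hat f^{\,n})$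 on this region such that, at each of its points, for every such frame and every 1-form $\theta$, $$\hat\pi_\zeta^{\alpha\beta}\theta_\alpha\theta_\beta\ \ge\ \left[K\hat f^{\,n-2}\rho^3+e_1\right]\left(|\theta(\hat V)|^2+\sum_{X=1}^{n-1}|\theta(\hat E_X)|^2\right)-\left[(n-1)\hat f^{\,n-2}+e_2\right]|\theta(\hat N)|^2 .$$ -/

import Mathlib

open Set
open scoped Manifold ContDiff Matrix

noncomputable section

namespace BorderlineAdS

/-! ### The manifolds

Throughout, the dimension `n` of the conformal boundary is `n = d + 1`, so that the cross-section is
`S = 𝕊^{n-1} = 𝕊^d` and the spacetime has dimension `n + 1 = d + 2`. -/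

/-- The number `n = d + 1`, as an integer (for use in exponents such as `n - 3`). -/
def bdim (d : ℕ) : ℤ := (d : ℤ) + 1

/-- The boundary cross-section: the unit sphere `𝕊^{n-1}` in `ℝ^n`. -/
abbrev Sph (d : ℕ) : Type := Metric.sphere (0 : EuclideanSpace ℝ (Fin (d + 1))) 1

/-- The model with corners of `ℝ_ρ × ℝ_t × 𝕊^d`. -/
abbrev modelM (d : ℕ) :
    ModelWithCorners ℝ (ℝ × ℝ × EuclideanSpace ℝ (Fin d))
      (ModelProd ℝ (ModelProd ℝ (EuclideanSpace ℝ (Fin d)))) :=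
  𝓘(ℝ, ℝ).prod (𝓘(ℝ, ℝ).prod (𝓡 d))

/-- The model with corners of `ℝ_t × 𝕊^d`. -/
abbrev modelI (d : ℕ) :
    ModelWithCorners ℝ (ℝ × EuclideanSpace ℝ (Fin d)) (ModelProd ℝ (EuclideanSpace ℝ (Fin d))) :=
  𝓘(ℝ, ℝ).prod (𝓡 d)

/-- The spacetime manifold `M = (0, ρ_*) × (0, π) × 𝕊^d`, an open subset of `ℝ × ℝ × 𝕊^d`. -/
def spacetime (d : ℕ) (ρs : ℝ) : Set (ℝ × ℝ × Sph d) :=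
  {p | 0 < p.1 ∧ p.1 < ρs ∧ 0 < p.2.1 ∧ p.2.1 < Real.pi}

/-- Covariant 2-tensor fields on `ℝ × ℝ × 𝕊^d` (only their restriction to `M` will matter). -/
abbrev TensorM (d : ℕ) : Type :=
  (p : ℝ × ℝ × Sph d) →
    TangentSpace (modelM d) p →L[ℝ] TangentSpace (modelM d) p →L[ℝ] ℝ

/-- Covariant 2-tensor fields on `ℝ × 𝕊^d` (only their restriction to `I = (0, π) × 𝕊^d` will
matter). -/
abbrev TensorI (d : ℕ) : Type :=
  (q : ℝ × Sph d) →
    TangentSpace (modelI d) q →L[ℝ] TangentSpace (modelI d) q →L[ℝ] ℝ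

/-! ### Coordinates

A coordinate system `φ = (x^1, …, x^d)` on the sphere is a member of the maximal smooth atlas. The
transported coordinates `(ρ, t, x^1, …, x^d)` on `M` are indexed by `Fin (d + 2)`: index `0` is `ρ`,
index `1` is `t`, and index `A + 2` is `x^A`. An index of the form `a.succ` is a coordinate of `I`. -/

/-- Local coordinate systems on the sphere. -/
abbrev Coord (d : ℕ) : Type := OpenPartialHomeomorph (Sph d) (EuclideanSpace ℝ (Fin d))

/-- The smooth coordinate systems on the sphere. -/
def smoothCoords (d : ℕ) : Set (Coord d) := IsManifold.maximalAtlas (𝓡 d) ∞ (Sph d)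

/-- The `x`-part of the coordinates of a point. -/
def xPart {d : ℕ} (z : Fin (d + 2) → ℝ) : EuclideanSpace ℝ (Fin d) :=
  WithLp.toLp 2 (fun A : Fin d => z A.succ.succ)

/-- The open set of coordinates `(ρ, t, x)` of the points of `M` covered by `φ`. -/
def coordDomain {d : ℕ} (ρs : ℝ) (φ : Coord d) : Set (Fin (d + 2) → ℝ) :=
  {z | 0 < z 0 ∧ z 0 < ρs ∧ 0 < z 1 ∧ z 1 < Real.pi ∧ xPart z ∈ φ.target}

/-- The point of `M` with coordinates `(ρ, t, x)`. -/
def pointM {d : ℕ} (φ : Coord d) (z : Fin (d + 2) → ℝ) : ℝ × ℝ × Sph d :=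
  (z 0, z 1, φ.symm (xPart z))

/-- The projection to `I` of the point of `M` with coordinates `(ρ, t, x)`. -/
def pointI {d : ℕ} (φ : Coord d) (z : Fin (d + 2) → ℝ) : ℝ × Sph d :=
  (z 1, φ.symm (xPart z))

/-- The projection to `𝕊^d ⊆ ℝ^{d+1}` of the point of `M` with coordinates `(ρ, t, x)`. -/
def pointS {d : ℕ} (φ : Coord d) (z : Fin (d + 2) → ℝ) : EuclideanSpace ℝ (Fin (d + 1)) :=
  (φ.symm (xPart z) : Sph d)

/-- The coordinate vector field `∂_α` on `M`. -/
def coordVecM {d : ℕ} (φ : Coord d) (z : Fin (d + 2) → ℝ) (α : Fin (d + 2)) :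
    TangentSpace (modelM d) (pointM φ z) :=
  mfderiv 𝓘(ℝ, Fin (d + 2) → ℝ) (modelM d) (pointM φ) z (Pi.single α (1 : ℝ) : Fin (d + 2) → ℝ)

/-- The projection to `I` of the coordinate vector field `∂_α` (zero for `α = ρ`). -/
def coordVecI {d : ℕ} (φ : Coord d) (z : Fin (d + 2) → ℝ) (α : Fin (d + 2)) :
    TangentSpace (modelI d) (pointI φ z) :=
  mfderiv 𝓘(ℝ, Fin (d + 2) → ℝ) (modelI d) (pointI φ) z (Pi.single α (1 : ℝ) : Fin (d + 2) → ℝ)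

/-- The coordinate components of a 2-tensor field on `M`. -/
def compM {d : ℕ} (h : TensorM d) (φ : Coord d) (z : Fin (d + 2) → ℝ) :
    Matrix (Fin (d + 2)) (Fin (d + 2)) ℝ :=
  fun α β => h (pointM φ z) (coordVecM φ z α) (coordVecM φ z β)

/-- The coordinate components of (the pullback to `M` of) a 2-tensor field on `I`. -/
def compI {d : ℕ} (h : TensorI d) (φ : Coord d) (z : Fin (d + 2) → ℝ) :
    Matrix (Fin (d + 2)) (Fin (d + 2)) ℝ :=
  fun α β => h (pointI φ z) (coordVecI φ z α) (coordVecI φ z β)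

/-- The partial derivative `∂_α u`. -/
def pd {d : ℕ} (α : Fin (d + 2)) (u : (Fin (d + 2) → ℝ) → ℝ) : (Fin (d + 2) → ℝ) → ℝ :=
  fun z => fderiv ℝ u z (Pi.single α 1)

/-- The iterated partial derivative `∂_{α₁} ⋯ ∂_{α_m} u`. -/
def pdList {d : ℕ} (l : List (Fin (d + 2))) (u : (Fin (d + 2) → ℝ) → ℝ) :
    (Fin (d + 2) → ℝ) → ℝ :=
  l.foldr pd u

/-! ### Error terms -/

/-- `u = 𝒪_φ(h)` on the coordinate region `D`: `u` is smooth and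
`|∂_ρ^k ∂_{a₁} ⋯ ∂_{a_m} u| ≲ ρ^{-k} h` for all `k, m`, the `a_i` being coordinates other than
`ρ`. -/
def IsBigO {d : ℕ} (D : Set (Fin (d + 2) → ℝ)) (u h : (Fin (d + 2) → ℝ) → ℝ) : Prop :=
  ContDiffOn ℝ ∞ u D ∧
    ∀ (k : ℕ) (l : List (Fin (d + 1))), ∃ C : ℝ, ∀ z ∈ D,
      |pdList (List.replicate k 0) (pdList (l.map Fin.succ) u) z| ≤ C * ((z 0 ^ k)⁻¹ * h z)

/-- `u = 𝒪₀(h)` on the coordinate region `D`: `u` is smooth and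
`|∂_{α₁} ⋯ ∂_{α_m} u| ≲ ρ^{-m} h` for all `m`, the `α_i` being any coordinates. -/
def IsBigO0 {d : ℕ} (D : Set (Fin (d + 2) → ℝ)) (u h : (Fin (d + 2) → ℝ) → ℝ) : Prop :=
  ContDiffOn ℝ ∞ u D ∧
    ∀ l : List (Fin (d + 2)), ∃ C : ℝ, ∀ z ∈ D,
      |pdList l u z| ≤ C * ((z 0 ^ l.length)⁻¹ * h z)

/-! ### Borderline FG-aAdS segments -/

/-- The components of `dρ²`. -/
def dρ2 (d : ℕ) : Matrix (Fin (d + 2)) (Fin (d + 2)) ℝ := Matrix.single 0 0 1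

/-- The components of `dt²`. -/
def dt2 (d : ℕ) : Matrix (Fin (d + 2)) (Fin (d + 2)) ℝ := Matrix.single 1 1 1

/-- The components of the round metric of the unit sphere. -/
def roundM {d : ℕ} (φ : Coord d) (z : Fin (d + 2) → ℝ) : Matrix (Fin (d + 2)) (Fin (d + 2)) ℝ :=
  fun α β => inner ℝ (fderiv ℝ (pointS φ) z (Pi.single α 1)) (fderiv ℝ (pointS φ) z (Pi.single β 1))

/-- The components of the boundary metric `-dt² + γ̊`. -/
def gm {d : ℕ} (φ : Coord d) (z : Fin (d + 2) → ℝ) : Matrix (Fin (d + 2)) (Fin (d + 2)) ℝ :=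
  -dt2 d + roundM φ z

/-- The components of the leading coefficient `dρ² - dt² + γ̊`. -/
def ggm {d : ℕ} (φ : Coord d) (z : Fin (d + 2) → ℝ) : Matrix (Fin (d + 2)) (Fin (d + 2)) ℝ :=
  dρ2 d + gm φ z

/-- The components of the second coefficient `-½ (dt² + γ̊)`. -/
def ggs {d : ℕ} (φ : Coord d) (z : Fin (d + 2) → ℝ) : Matrix (Fin (d + 2)) (Fin (d + 2)) ℝ :=
  (-(1 / 2) : ℝ) • (dt2 d + roundM φ z)

/-- The components of the remainder `r` in `g = ρ⁻² (ggm + ρ² ggs + ρ³ r)`. -/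
def ggr {d : ℕ} (g : TensorM d) (φ : Coord d) (z : Fin (d + 2) → ℝ) :
    Matrix (Fin (d + 2)) (Fin (d + 2)) ℝ :=
  (z 0 ^ 3)⁻¹ • (z 0 ^ 2 • compM g φ z - ggm φ z - z 0 ^ 2 • ggs φ z)

/-- `g` is a smooth Lorentzian metric (signature `(-, +, …, +)`) on `M`. -/
structure IsLorentzMetric {d : ℕ} (ρs : ℝ) (g : TensorM d) : Prop where
  symm : ∀ p ∈ spacetime d ρs, ∀ v w, g p v w = g p w v
  signature : ∀ p ∈ spacetime d ρs,
    ∃ b : Module.Basis (Fin (d + 2)) ℝ (TangentSpace (modelM d) p),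
      ∀ i j, g p (b i) (b j) = if i = j then (if i = 0 then -1 else 1) else 0
  smooth : ∀ φ ∈ smoothCoords d, ∀ α β,
    ContDiffOn ℝ ∞ (fun z => compM g φ z α β) (coordDomain ρs φ)

/-- `(M, g)`, with `M = (0, ρ_*) × (0, π) × 𝕊^d`, is a borderline FG-aAdS segment with boundary data
`-dt² + γ̊` and `-½ (dt² + γ̊)`, third-order coefficient `gb`, and bounded family of coordinates
`Ξ`. -/
structure IsBorderlineSegment {d : ℕ} (ρs : ℝ) (g : TensorM d) (gb : TensorI d)
    (Ξ : Set (Coord d)) : Prop where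
  ρs_pos : 0 < ρs
  lorentz : IsLorentzMetric ρs g
  /- `Ξ` is a finite family of coordinate systems covering the sphere. -/
  finite : Ξ.Finite
  smoothCoord : Ξ ⊆ smoothCoords d
  cover : ⋃ φ ∈ Ξ, φ.source = univ
  /- The components of the coefficients are bounded with all derivatives. -/
  ggm_bdd : ∀ φ ∈ Ξ, ∀ α β, IsBigO (coordDomain ρs φ) (fun z => ggm φ z α β) (fun _ => 1)
  ggm_inv_bdd : ∀ φ ∈ Ξ, ∀ α β,
    IsBigO (coordDomain ρs φ) (fun z => (ggm φ z)⁻¹ α β) (fun _ => 1)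
  ggs_bdd : ∀ φ ∈ Ξ, ∀ α β, IsBigO (coordDomain ρs φ) (fun z => ggs φ z α β) (fun _ => 1)
  ggr_bdd : ∀ φ ∈ Ξ, ∀ α β, IsBigO (coordDomain ρs φ) (fun z => ggr g φ z α β) (fun _ => 1)
  /- Fefferman-Graham gauge: the remainder is tangent to the level sets of `ρ`. -/
  fefferman_graham : ∀ φ ∈ Ξ, ∀ z ∈ coordDomain ρs φ, ∀ α,
    ggr g φ z 0 α = 0 ∧ ggr g φ z α 0 = 0
  /- The third-order coefficient is a smooth symmetric tensor field on `I`. -/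
  gb_symm : ∀ q : ℝ × Sph d, 0 < q.1 → q.1 < Real.pi → ∀ v w, gb q v w = gb q w v
  gb_smooth : ∀ φ ∈ smoothCoords d, ∀ α β,
    ContDiffOn ℝ ∞ (fun z => compI gb φ z α β) (coordDomain ρs φ)
  /- The refined expansion `g_ab = ρ⁻² gm_ab + gs_ab + ρ gb_ab + 𝒪(ρ²)`. -/
  expansion : ∀ φ ∈ Ξ, ∀ a b : Fin (d + 1),
    IsBigO (coordDomain ρs φ)
      (fun z => compM g φ z a.succ b.succ - (z 0 ^ 2)⁻¹ * gm φ z a.succ b.succ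
        - ggs φ z a.succ b.succ - z 0 * compI gb φ z a.succ b.succ)
      (fun z => z 0 ^ 2)

/-- The borderline pseudoconvexity property, with parameters `K` and `ζ`: one has `K > 0`, `ζ` is
smooth on `M` and `𝒪(1)`, and
`(-(3/2) gb - ζ gm)(X, X) ≥ K ((X^t)² + gm_AB X^A X^B)` for all `X = X^t ∂_t + X^A ∂_A`. -/
structure BorderlinePseudoconvex {d : ℕ} (ρs : ℝ) (gb : TensorI d) (Ξ : Set (Coord d))
    (K : ℝ) (ζ : ℝ × ℝ × Sph d → ℝ) : Prop where
  K_pos : 0 < K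
  smooth : ContMDiffOn (modelM d) 𝓘(ℝ, ℝ) ∞ ζ (spacetime d ρs)
  bdd : ∀ φ ∈ Ξ, IsBigO (coordDomain ρs φ) (fun z => ζ (pointM φ z)) (fun _ => 1)
  positive : ∀ φ ∈ Ξ, ∀ z ∈ coordDomain ρs φ, ∀ X : Fin (d + 2) → ℝ, X 0 = 0 →
    K * (X 1 ^ 2 + ∑ A : Fin d, ∑ B : Fin d,
        gm φ z A.succ.succ B.succ.succ * X A.succ.succ * X B.succ.succ) ≤
      ∑ α, ∑ β, (-(3 / 2) * compI gb φ z α β - ζ (pointM φ z) * gm φ z α β) * X α * X β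

/-! ### Covariant derivatives in coordinates

Here `G` stands for the coordinate components of a metric. -/

/-- `G(v, w)` at `z`. -/
def innerAt {d : ℕ} (G : (Fin (d + 2) → ℝ) → Matrix (Fin (d + 2)) (Fin (d + 2)) ℝ)
    (z v w : Fin (d + 2) → ℝ) : ℝ :=
  ∑ α, ∑ β, G z α β * v α * w β

/-- The Christoffel symbols `Γ^γ_{αβ}`. -/
def christoffel {d : ℕ} (G : (Fin (d + 2) → ℝ) → Matrix (Fin (d + 2)) (Fin (d + 2)) ℝ)
    (γ α β : Fin (d + 2)) (z : Fin (d + 2) → ℝ) : ℝ :=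
  (1 / 2) * ∑ δ, (G z)⁻¹ γ δ *
    (pd α (fun y => G y δ β) z + pd β (fun y => G y δ α) z - pd δ (fun y => G y α β) z)

/-- The gradient `(grad u)^β = g^{αβ} ∂_α u`. -/
def grad {d : ℕ} (G : (Fin (d + 2) → ℝ) → Matrix (Fin (d + 2)) (Fin (d + 2)) ℝ)
    (u : (Fin (d + 2) → ℝ) → ℝ) (z : Fin (d + 2) → ℝ) : Fin (d + 2) → ℝ :=
  fun β => ∑ α, (G z)⁻¹ α β * pd α u z

/-- The covariant derivative `∇_α Y_β = ∂_α Y_β - Γ^γ_{αβ} Y_γ` of a vector field `Y`, where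
`Y_β = g_{βγ} Y^γ`. -/
def covDeriv {d : ℕ} (G : (Fin (d + 2) → ℝ) → Matrix (Fin (d + 2)) (Fin (d + 2)) ℝ)
    (Y : (Fin (d + 2) → ℝ) → Fin (d + 2) → ℝ) (z : Fin (d + 2) → ℝ) :
    Matrix (Fin (d + 2)) (Fin (d + 2)) ℝ :=
  fun α β => pd α (fun y => ∑ γ, G y β γ * Y y γ) z
    - ∑ γ, christoffel G γ α β z * ∑ δ, G z γ δ * Y z δ

/-! ### The foliation, the adapted frames, and the deformation tensor -/

/-- The function `f̂ = ρ (1 - ρ²/4) / sin t` on `M`. -/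
def fhat {d : ℕ} (p : ℝ × ℝ × Sph d) : ℝ := (Real.sin p.2.1)⁻¹ * (p.1 * (1 - p.1 ^ 2 / 4))

/-- `f̂` in coordinates. -/
def fhatC {d : ℕ} (φ : Coord d) (z : Fin (d + 2) → ℝ) : ℝ := fhat (pointM φ z)

/-- The vector field `Ŝ = f̂^{n-3} grad f̂` in coordinates. -/
def Shat {d : ℕ} (g : TensorM d) (φ : Coord d) (z : Fin (d + 2) → ℝ) : Fin (d + 2) → ℝ :=
  fun β => fhatC φ z ^ (bdim d - 3) * grad (compM g φ) (fhatC φ) z β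

/-- `ŵ_ζ = f̂ + f̂ ρ³ ζ` in coordinates. -/
def what {d : ℕ} (ζ : ℝ × ℝ × Sph d → ℝ) (φ : Coord d) (z : Fin (d + 2) → ℝ) : ℝ :=
  fhatC φ z + fhatC φ z * z 0 ^ 3 * ζ (pointM φ z)

/-- The modified deformation tensor `π̂_ζ = -(∇Ŝ + f̂^{n-3} ŵ_ζ g)`, with lower indices. -/
def deform {d : ℕ} (g : TensorM d) (ζ : ℝ × ℝ × Sph d → ℝ) (φ : Coord d)
    (z : Fin (d + 2) → ℝ) : Matrix (Fin (d + 2)) (Fin (d + 2)) ℝ :=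
  -(covDeriv (compM g φ) (Shat g φ) z
    + (fhatC φ z ^ (bdim d - 3) * what ζ φ z) • compM g φ z)

/-- `π̂_ζ^{αβ} θ_α θ_β`, with the indices of `π̂_ζ` raised by `g`. -/
def deformUp {d : ℕ} (g : TensorM d) (ζ : ℝ × ℝ × Sph d → ℝ) (φ : Coord d)
    (z θ : Fin (d + 2) → ℝ) : ℝ :=
  ∑ α, ∑ β, (∑ μ, ∑ ν, (compM g φ z)⁻¹ α μ * (compM g φ z)⁻¹ β ν * deform g ζ φ z μ ν)
    * θ α * θ β

/-- `v` is horizontal, i.e. tangent to the level set of `(ρ, t)`. -/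
def IsHorizontal {d : ℕ} (v : Fin (d + 2) → ℝ) : Prop := v 0 = 0 ∧ v 1 = 0

/-- `(Ê_1, …, Ê_{n-1})` is a `g`-orthonormal frame of the level set of `(ρ, t)` at `z`. -/
def IsHorizontalFrame {d : ℕ} (g : TensorM d) (φ : Coord d) (z : Fin (d + 2) → ℝ)
    (E : Fin d → Fin (d + 2) → ℝ) : Prop :=
  (∀ X, IsHorizontal (E X)) ∧
    ∀ X Y, innerAt (compM g φ) z (E X) (E Y) = if X = Y then 1 else 0

/-- The unit normal `N̂ = |∇f̂·∇f̂|^{-1/2} grad f̂`. -/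
def Nhat {d : ℕ} (g : TensorM d) (φ : Coord d) (z : Fin (d + 2) → ℝ) : Fin (d + 2) → ℝ :=
  let W := grad (compM g φ) (fhatC φ) z
  (Real.sqrt |innerAt (compM g φ) z W W|)⁻¹ • W

/-- The vector `(1 - ¾ρ²) ∂_t + (cos t) f̂ ∂_ρ`. -/
def Vpre {d : ℕ} (φ : Coord d) (z : Fin (d + 2) → ℝ) : Fin (d + 2) → ℝ :=
  (1 - 3 / 4 * z 0 ^ 2) • Pi.single 1 1 + (Real.cos (z 1) * fhatC φ z) • Pi.single 0 1

/-- The vector `V̌`: the previous one minus its projection onto the level set of `(ρ, t)`. -/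
def Vcheck {d : ℕ} (g : TensorM d) (φ : Coord d) (z : Fin (d + 2) → ℝ)
    (E : Fin d → Fin (d + 2) → ℝ) : Fin (d + 2) → ℝ :=
  Vpre φ z - ∑ X, innerAt (compM g φ) z (Vpre φ z) (E X) • E X

/-- The unit vector `V̂ = |g(V̌, V̌)|^{-1/2} V̌`. -/
def Vhat {d : ℕ} (g : TensorM d) (φ : Coord d) (z : Fin (d + 2) → ℝ)
    (E : Fin d → Fin (d + 2) → ℝ) : Fin (d + 2) → ℝ :=
  (Real.sqrt |innerAt (compM g φ) z (Vcheck g φ z E) (Vcheck g φ z E)|)⁻¹ • Vcheck g φ z E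

/-- `θ(v)` for a covector `θ` and a vector `v` given by components. -/
def pair {d : ℕ} (θ v : Fin (d + 2) → ℝ) : ℝ := ∑ α, θ α * v α

/-- The coordinates of the points of `M` covered by `φ` with `ρ < ρ₀` and `f̂ < f₀`. -/
def nearBoundary {d : ℕ} (ρs : ℝ) (φ : Coord d) (ρ₀ f₀ : ℝ) : Set (Fin (d + 2) → ℝ) :=
  {z | z ∈ coordDomain ρs φ ∧ z 0 < ρ₀ ∧ fhatC φ z < f₀}

end BorderlineAdS

end

/-! The estimate becomes transparent for the reciprocal `u = 1 / f̂ = sin t / (ρ (1 - ρ²/4))`. Since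
`df̂ = -f̂² du`, one has `Ŝ = -f̂^(n-1) grad u` and `f̂^(n-3) f̂ = f̂^(n-1) u`, so that `π̂_ζ =
f̂^(n-1) Q - (n-1) f̂^n du ⊗ du`, with `Q = ∇²u - u (1 + ρ³ ζ) g` (`IsBorderlineSegment.deform_eq`).

The second term sees only `N̂`: because `|grad f̂|² = f̂² + O(f̂⁴)`, it contributes `-(n-1) f̂^(n-2)
θ(N̂)²` up to `O(f̂^n)` (`NearPoint.normal_le`).

On exact anti-de Sitter space, linear functions on the hyperboloid satisfy `∇²u = u g`. The present
`u` and `g` differ from this model only by the third-order remainder `ρ³ r` and by terms of higher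
order in `ρ`, so the negative powers of `ρ` in `Q` cancel. What is left (`NearPoint.deformBounds`)
is `Q_ρρ = O(sin t)`, `Q_ρa = O(ρ)` and `Q_ab = sin t (-(3/2) b - ζ g̊)_ab + O(ρ)`, where `g̊` is
the boundary metric. The coefficient `-3/2` comes from `½ ∂_ρ u ∂_ρ (ρ³ r)`. Here `∂_ρ r` must be
bounded, although `r = O(1)` only allows `ρ⁻¹`; the expansion `r = b + O(ρ)`, with `b` independent
of `ρ`, closes this gap (`IsBorderlineSegment.abs_pd_zero_ggr_le`).

Finally the vector dual to `θ` is expanded in the frame (`NearPoint.frame_estimate`). Unit vectors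
along `V̂`, `Ê_X` have tangential size about `ρ` and `ρ`-component `O(ρ f̂)`; for `N̂` the
`ρ`-component is `O(ρ)` and the others are `O(ρ f̂)`. Pseudoconvexity yields `K ρ² sin t`, which is
`K ρ³ / f̂` to leading order since `f̂ sin t = ρ (1 - ρ²/4)`. All other tangential terms are
`O(ρ³)`, one factor `f̂` smaller, and mixed terms are absorbed by Young's inequality. The constants
are uniform, so `e₁` and `e₂` can be constant multiples of `f̂^(n-1) ρ³` and `f̂^n`. -/

noncomputable section

namespace BorderlineAdS

section

variable {d : ℕ}

/-! ### Coordinate geometry of the sphere -/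

/-- `xPart` as a continuous linear map. -/
def xPartL (d : ℕ) : (Fin (d + 2) → ℝ) →L[ℝ] EuclideanSpace ℝ (Fin d) :=
  LinearMap.toContinuousLinearMap
    { toFun := xPart
      map_add' := fun _ _ => rfl
      map_smul' := fun _ _ => rfl }

@[simp] lemma xPartL_apply (z : Fin (d + 2) → ℝ) : xPartL d z = xPart z := rfl

lemma xPart_single_zero (r : ℝ) : xPart (d := d) (Pi.single 0 r) = 0 := by
  ext A; simp [xPart, Fin.succ_ne_zero]

lemma xPart_single_one (r : ℝ) : xPart (d := d) (Pi.single 1 r) = 0 := by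
  ext A
  have : A.succ.succ ≠ (1 : Fin (d + 2)) := by
    rw [← Fin.succ_zero_eq_one]; exact fun h => Fin.succ_ne_zero _ (Fin.succ_injective _ h)
  simp [xPart, this]

lemma xPart_add_of_eq_zero {z a : Fin (d + 2) → ℝ} (ha : xPart a = 0) :
    xPart (z + a) = xPart z := by
  have := (xPartL d).map_add z a
  simpa [ha] using this

lemma isOpen_coordDomain (ρs : ℝ) (φ : Coord d) : IsOpen (coordDomain ρs φ) := by
  have h0 : Continuous fun z : Fin (d + 2) → ℝ => z 0 := continuous_apply 0
  have h1 : Continuous fun z : Fin (d + 2) → ℝ => z 1 := continuous_apply 1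
  exact (isOpen_lt continuous_const h0).inter ((isOpen_lt h0 continuous_const).inter
    ((isOpen_lt continuous_const h1).inter ((isOpen_lt h1 continuous_const).inter
      (φ.open_target.preimage (xPartL d).continuous))))

lemma pointS_add_of_eq_zero (φ : Coord d) {a : Fin (d + 2) → ℝ} (ha : xPart a = 0)
    (z : Fin (d + 2) → ℝ) : pointS φ (z + a) = pointS φ z := by
  simp [pointS, xPart_add_of_eq_zero ha]

lemma fderiv_pointS_add (φ : Coord d) {a : Fin (d + 2) → ℝ} (ha : xPart a = 0)
    (z : Fin (d + 2) → ℝ) : fderiv ℝ (pointS φ) (z + a) = fderiv ℝ (pointS φ) z := by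
  have h := fderiv_comp_add_right (𝕜 := ℝ) (f := pointS φ) (x := z) a
  rw [← h]
  exact congrArg (fun f => fderiv ℝ f z) (funext fun y => pointS_add_of_eq_zero φ ha y)

/-- A function which is constant in the coordinate `α` has vanishing partial derivative. -/
lemma pd_eq_zero_of_const {α : Fin (d + 2)} {u : (Fin (d + 2) → ℝ) → ℝ} {z : Fin (d + 2) → ℝ}
    (h : ∀ r : ℝ, u (z + Pi.single α r) = u z) : pd α u z = 0 := by
  unfold pd
  by_cases hu : DifferentiableAt ℝ u z
  · have h1 := hu.hasFDerivAt.hasLineDerivAt (Pi.single α (1 : ℝ))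
    have h2 : HasLineDerivAt ℝ u 0 z (Pi.single α (1 : ℝ)) := by
      unfold HasLineDerivAt
      have : (fun t : ℝ => u (z + t • Pi.single α (1 : ℝ))) = fun _ => u z := by
        funext t
        rw [← Pi.single_smul, smul_eq_mul, mul_one, h]
      rw [this]
      exact hasDerivAt_const _ _
    exact h1.unique h2
  -- `fderiv` is zero by convention where `u` is not differentiable, so no regularity is required.
  · rw [fderiv_zero_of_not_differentiableAt hu]; rfl

lemma roundM_add_of_eq_zero (φ : Coord d) {a : Fin (d + 2) → ℝ} (ha : xPart a = 0)
    (z : Fin (d + 2) → ℝ) : roundM φ (z + a) = roundM φ z := by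
  ext α β
  simp only [roundM, fderiv_pointS_add φ ha]

lemma pd_zero_roundM (φ : Coord d) (z : Fin (d + 2) → ℝ) (α β : Fin (d + 2)) :
    pd 0 (fun y => roundM φ y α β) z = 0 :=
  pd_eq_zero_of_const fun r => by rw [roundM_add_of_eq_zero φ (xPart_single_zero r)]

lemma pd_one_roundM (φ : Coord d) (z : Fin (d + 2) → ℝ) (α β : Fin (d + 2)) :
    pd 1 (fun y => roundM φ y α β) z = 0 :=
  pd_eq_zero_of_const fun r => by rw [roundM_add_of_eq_zero φ (xPart_single_one r)]

lemma mdifferentiable_coord {φ : Coord d} (hφ : φ ∈ smoothCoords d) :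
    φ.MDifferentiable (𝓡 d) (𝓡 d) :=
  ⟨(contMDiffOn_of_mem_maximalAtlas hφ).mdifferentiableOn (by simp),
    (contMDiffOn_symm_of_mem_maximalAtlas hφ).mdifferentiableOn (by simp)⟩

lemma mdifferentiableAt_symm_xPart {φ : Coord d} (hφ : φ ∈ smoothCoords d)
    {z : Fin (d + 2) → ℝ} (hz : xPart z ∈ φ.target) :
    MDifferentiableAt 𝓘(ℝ, Fin (d + 2) → ℝ) (𝓡 d) (fun y => φ.symm (xPart y)) z := by
  have h2 : MDifferentiableAt 𝓘(ℝ, Fin (d + 2) → ℝ) (𝓡 d) (xPartL d) z :=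
    (xPartL d).differentiableAt.mdifferentiableAt
  exact ((mdifferentiable_coord hφ).mdifferentiableAt_symm hz).comp z h2

/-- The coordinate differential of the embedding of the sphere. -/
lemma fderiv_pointS_apply_eq_zero {φ : Coord d} (hφ : φ ∈ smoothCoords d)
    {z : Fin (d + 2) → ℝ} (hz : xPart z ∈ φ.target) {X : Fin (d + 2) → ℝ}
    (hX : fderiv ℝ (pointS φ) z X = 0) : xPart X = 0 := by
  have : Fact (Module.finrank ℝ (EuclideanSpace ℝ (Fin (d + 1))) = d + 1) :=
    ⟨finrank_euclideanSpace_fin⟩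
  have hd := mdifferentiable_coord hφ
  replace hz : xPartL d z ∈ φ.target := hz
  have h1 := hd.mdifferentiableAt_symm hz
  have h2 : MDifferentiableAt 𝓘(ℝ, Fin (d + 2) → ℝ) (𝓡 d) (xPartL d) z :=
    (xPartL d).differentiableAt.mdifferentiableAt
  have h3 : MDifferentiableAt (𝓡 d) 𝓘(ℝ, EuclideanSpace ℝ (Fin (d + 1)))
      ((↑) : Sph d → EuclideanSpace ℝ (Fin (d + 1))) (φ.symm (xPartL d z)) :=
    (contMDiff_coe_sphere (m := 1)).mdifferentiableAt one_ne_zero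
  -- The differential factors through `xPart`, the inverse chart and the inclusion of the sphere.
  -- The last two are injective, so the kernel is that of `xPart`.
  have h4 := h3.hasMFDerivAt.comp z (h1.hasMFDerivAt.comp z h2.hasMFDerivAt)
  have h5 := DFunLike.congr_fun h4.mfderiv X
  rw [mfderiv_eq_fderiv] at h5
  have h6 := injective_mvfderiv_subtypeVal_sphere (φ.symm (xPartL d z))
    ((h5.symm.trans hX).trans (map_zero _).symm)
  have h7 := (hd.symm.mfderiv_injective hz) (h6.trans (map_zero _).symm)
  rw [mfderiv_eq_fderiv, ContinuousLinearMap.fderiv] at h7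
  exact h7

lemma fderiv_pointS_single {φ : Coord d} (z : Fin (d + 2) → ℝ) {a : Fin (d + 2)}
    (ha : ∀ r : ℝ, xPart (Pi.single a r : Fin (d + 2) → ℝ) = 0) :
    fderiv ℝ (pointS φ) z (Pi.single a 1) = 0 := by
  by_cases hu : DifferentiableAt ℝ (pointS φ) z
  · have h1 := hu.hasFDerivAt.hasLineDerivAt (Pi.single a (1 : ℝ))
    have h2 : HasLineDerivAt ℝ (pointS φ) 0 z (Pi.single a (1 : ℝ)) := by
      unfold HasLineDerivAt
      have : (fun t : ℝ => pointS φ (z + t • Pi.single a (1 : ℝ))) = fun _ => pointS φ z := by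
        funext t
        rw [← Pi.single_smul, smul_eq_mul, mul_one, pointS_add_of_eq_zero φ (ha t)]
      rw [this]
      exact hasDerivAt_const _ _
    exact h1.unique h2
  · rw [fderiv_zero_of_not_differentiableAt hu]; rfl

lemma pointI_add (φ : Coord d) (r : ℝ) (z : Fin (d + 2) → ℝ) :
    pointI φ (z + Pi.single 0 r) = pointI φ z := by
  simp [pointI, xPart_add_of_eq_zero (xPart_single_zero r)]

lemma mdifferentiableAt_pointI {φ : Coord d} (hφ : φ ∈ smoothCoords d)
    {z : Fin (d + 2) → ℝ} (hz : xPart z ∈ φ.target) :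
    MDifferentiableAt 𝓘(ℝ, Fin (d + 2) → ℝ) (modelI d) (pointI φ) z := by
  have h2 : MDifferentiableAt 𝓘(ℝ, Fin (d + 2) → ℝ) 𝓘(ℝ, ℝ)
      (fun y : Fin (d + 2) → ℝ => y 1) z :=
    (differentiableAt_apply (𝕜 := ℝ) (1 : Fin (d + 2)) z).mdifferentiableAt
  exact h2.prodMk (mdifferentiableAt_symm_xPart hφ hz)

/-- The projection to `I` is unchanged by translation in `ρ`, and by the chain rule so are the
projected coordinate vectors. The resulting `ρ`-independence of `b` later upgrades the bound on `∂_ρ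
r`. -/
lemma compI_add {φ : Coord d} (hφ : φ ∈ smoothCoords d) (h : TensorI d)
    {z : Fin (d + 2) → ℝ} (hz : xPart z ∈ φ.target) (r : ℝ) :
    compI h φ (z + Pi.single 0 r) = compI h φ z := by
  set a : Fin (d + 2) → ℝ := Pi.single 0 r with ha
  have hfun : pointI φ ∘ (fun y => y + a) = pointI φ := funext fun y => pointI_add φ r y
  have hz' : xPart (z + a) ∈ φ.target := by
    rwa [xPart_add_of_eq_zero (xPart_single_zero r)]
  have h2 : HasFDerivAt (fun y : Fin (d + 2) → ℝ => y + a) (ContinuousLinearMap.id ℝ _) z :=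
    (hasFDerivAt_id z).add_const a
  have h3 := mfderiv_comp z (mdifferentiableAt_pointI hφ hz') h2.differentiableAt.mdifferentiableAt
  rw [mfderiv_eq_fderiv, h2.fderiv, hfun] at h3
  have hv : ∀ α, coordVecI φ (z + a) α = coordVecI φ z α := fun α => by
    unfold coordVecI
    rw [h3]
    rfl
  funext α β
  unfold compI
  rw [hv, hv, pointI_add]

lemma pd_zero_compI {φ : Coord d} (hφ : φ ∈ smoothCoords d) (h : TensorI d)
    {z : Fin (d + 2) → ℝ} (hz : xPart z ∈ φ.target) (α β : Fin (d + 2)) :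
    pd 0 (fun y => compI h φ y α β) z = 0 :=
  pd_eq_zero_of_const fun r => by rw [compI_add hφ h hz]


end

section

variable {d : ℕ}

/-! ### The rescaled metric at a point -/

/-- The bilinear form with matrix `M`. -/
abbrev bil (M : Matrix (Fin (d + 2)) (Fin (d + 2)) ℝ) :
    (Fin (d + 2) → ℝ) →ₗ[ℝ] (Fin (d + 2) → ℝ) →ₗ[ℝ] ℝ :=
  Matrix.toLinearMap₂' ℝ M

lemma bil_eq_sum (M : Matrix (Fin (d + 2)) (Fin (d + 2)) ℝ) (X Y : Fin (d + 2) → ℝ) :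
    bil M X Y = ∑ α, ∑ β, M α β * X α * Y β := by
  rw [Matrix.toLinearMap₂'_apply]
  refine Finset.sum_congr rfl fun α _ => Finset.sum_congr rfl fun β _ => ?_
  simp only [smul_eq_mul]; ring

lemma innerAt_eq_bil (G : (Fin (d + 2) → ℝ) → Matrix (Fin (d + 2)) (Fin (d + 2)) ℝ)
    (z X Y : Fin (d + 2) → ℝ) : innerAt G z X Y = bil (G z) X Y :=
  (bil_eq_sum _ _ _).symm

lemma bil_single (M : Matrix (Fin (d + 2)) (Fin (d + 2)) ℝ) (α β : Fin (d + 2)) :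
    bil M (Pi.single α 1) (Pi.single β 1) = M α β := by
  rw [bil_eq_sum]; simp [Pi.single_apply]

lemma bil_comm {M : Matrix (Fin (d + 2)) (Fin (d + 2)) ℝ} (hM : ∀ α β, M α β = M β α)
    (X Y : Fin (d + 2) → ℝ) : bil M X Y = bil M Y X := by
  rw [bil_eq_sum, bil_eq_sum, Finset.sum_comm]
  refine Finset.sum_congr rfl fun α _ => Finset.sum_congr rfl fun β _ => ?_
  rw [hM]; ring

lemma bil_eq_dotProduct (M : Matrix (Fin (d + 2)) (Fin (d + 2)) ℝ) (X Y : Fin (d + 2) → ℝ) :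
    bil M X Y = X ⬝ᵥ M *ᵥ Y := by
  exact Matrix.toLinearMap₂'_apply' M X Y

lemma abs_bil_le {M : Matrix (Fin (d + 2)) (Fin (d + 2)) ℝ} {b x y : ℝ} {X Y : Fin (d + 2) → ℝ}
    (hb : 0 ≤ b) (hx : 0 ≤ x) (hM : ∀ α β, |M α β| ≤ b)
    (hX : ∀ α, |X α| ≤ x) (hY : ∀ α, |Y α| ≤ y) :
    |bil M X Y| ≤ (d + 2 : ℝ) ^ 2 * (b * x * y) := by
  rw [bil_eq_sum]
  refine (Finset.abs_sum_le_sum_abs _ _).trans ?_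
  have : ∀ α ∈ Finset.univ, |∑ β, M α β * X α * Y β| ≤ (d + 2 : ℝ) * (b * x * y) := by
    intro α _
    refine (Finset.abs_sum_le_sum_abs _ _).trans ?_
    refine (Finset.sum_le_sum (g := fun _ => b * x * y) fun β _ => ?_).trans ?_
    · rw [abs_mul, abs_mul]
      have := hM α β
      have := hX α
      have := hY β
      gcongr
    · simp
  refine (Finset.sum_le_sum this).trans ?_
  simp [sq, mul_assoc]

section point

variable {F : Type*} [NormedAddCommGroup F] [InnerProductSpace ℝ F]

/-- The Gram matrix of a linear map. -/
def gramM (L : (Fin (d + 2) → ℝ) →ₗ[ℝ] F) : Matrix (Fin (d + 2)) (Fin (d + 2)) ℝ :=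
  fun α β => inner ℝ (L (Pi.single α 1)) (L (Pi.single β 1))

lemma bil_gramM (L : (Fin (d + 2) → ℝ) →ₗ[ℝ] F) (X Y : Fin (d + 2) → ℝ) :
    bil (gramM L) X Y = inner ℝ (L X) (L Y) := by
  have h : bil (gramM L) = ((innerₗ F).compl₁₂ L L) := by
    refine (Pi.basisFun ℝ (Fin (d + 2))).ext fun α => (Pi.basisFun ℝ (Fin (d + 2))).ext fun β => ?_
    rw [Pi.basisFun_apply, Pi.basisFun_apply, bil_single]
    rfl
  rw [h]; rfl

lemma bil_dρ2 (X Y : Fin (d + 2) → ℝ) : bil (dρ2 d) X Y = X 0 * Y 0 := by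
  rw [bil_eq_sum, dρ2]
  simp [Matrix.single_apply, ite_and]

lemma bil_dt2 (X Y : Fin (d + 2) → ℝ) : bil (dt2 d) X Y = X 1 * Y 1 := by
  rw [bil_eq_sum, dt2]
  simp [Matrix.single_apply, ite_and]

/-- The Euclidean norm `((X^ρ)² + (X^t)² + |L X|²)^{1/2}`. -/
def nrm (L : (Fin (d + 2) → ℝ) →ₗ[ℝ] F) (X : Fin (d + 2) → ℝ) : ℝ :=
  Real.sqrt (X 0 ^ 2 + X 1 ^ 2 + ‖L X‖ ^ 2)

lemma nrm_nonneg (L : (Fin (d + 2) → ℝ) →ₗ[ℝ] F) (X : Fin (d + 2) → ℝ) : 0 ≤ nrm L X :=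
  Real.sqrt_nonneg _

lemma nrm_sq (L : (Fin (d + 2) → ℝ) →ₗ[ℝ] F) (X : Fin (d + 2) → ℝ) :
    nrm L X ^ 2 = X 0 ^ 2 + X 1 ^ 2 + ‖L X‖ ^ 2 :=
  Real.sq_sqrt (by positivity)

/-- The matrix of `dρ² - (1 + ρ²/2) dt² + (1 - ρ²/2) γ + ρ³ r`. -/
def rescaled (ρ : ℝ) (Γ R : Matrix (Fin (d + 2)) (Fin (d + 2)) ℝ) :
    Matrix (Fin (d + 2)) (Fin (d + 2)) ℝ :=
  dρ2 d - (1 + ρ ^ 2 / 2) • dt2 d + (1 - ρ ^ 2 / 2) • Γ + ρ ^ 3 • R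

/-- The pointwise properties of the round metric `L^* ⟨·,·⟩` and of the remainder `R` at a point
close to the boundary. -/
structure NearPoint (B ρ : ℝ) (L : (Fin (d + 2) → ℝ) →ₗ[ℝ] F)
    (R : Matrix (Fin (d + 2)) (Fin (d + 2)) ℝ) : Prop where
  one_le : 1 ≤ B
  ρ_pos : 0 < ρ
  ρ_small : 4 * B * ρ ≤ 1
  map_zero : L (Pi.single 0 1) = 0
  map_one : L (Pi.single 1 1) = 0
  symm : ∀ α β, R α β = R β α
  zero : ∀ α, R 0 α = 0
  bdd : ∀ X Y, |bil R X Y| ≤ B * nrm L X * nrm L Y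
  coord : ∀ X α, |X α| ≤ B * nrm L X

/-- Reversal of the sign of the `t`-component. -/
def flip (X : Fin (d + 2) → ℝ) : Fin (d + 2) → ℝ := X - (2 * X 1) • Pi.single 1 1

variable {B ρ : ℝ} {L : (Fin (d + 2) → ℝ) →ₗ[ℝ] F} {R : Matrix (Fin (d + 2)) (Fin (d + 2)) ℝ}

lemma bil_rescaled (X Y : Fin (d + 2) → ℝ) : bil (rescaled ρ (gramM L) R) X Y =
    X 0 * Y 0 - (1 + ρ ^ 2 / 2) * (X 1 * Y 1) + (1 - ρ ^ 2 / 2) * inner ℝ (L X) (L Y)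
      + ρ ^ 3 * bil R X Y := by
  simp only [bil, rescaled, map_add, map_sub, map_smul, LinearMap.add_apply, LinearMap.sub_apply,
    LinearMap.smul_apply, smul_eq_mul]
  rw [← bil_gramM, ← bil_dρ2, ← bil_dt2]

lemma one_ne_zero' : (1 : Fin (d + 2)) ≠ 0 := by simp

/-! ### Time reflection, coercivity and duality for the rescaled metric. -/

namespace NearPoint

lemma ρ_le (h : NearPoint B ρ L R) : ρ ≤ 1 / 4 := by
  have := h.ρ_small; have := h.one_le; have := h.ρ_pos; nlinarith

lemma bil_zero (h : NearPoint B ρ L R) (X : Fin (d + 2) → ℝ) : bil R (Pi.single 0 1) X = 0 := by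
  rw [bil_eq_sum]
  refine Finset.sum_eq_zero fun α _ => Finset.sum_eq_zero fun β _ => ?_
  rcases eq_or_ne α 0 with rfl | hα
  · simp [h.zero]
  · simp [hα]

lemma bil_comm (h : NearPoint B ρ L R) (X Y : Fin (d + 2) → ℝ) :
    bil (rescaled ρ (gramM L) R) X Y = bil (rescaled ρ (gramM L) R) Y X := by
  rw [bil_rescaled, bil_rescaled, BorderlineAdS.bil_comm h.symm X Y, real_inner_comm]; ring

lemma flip_zero (X : Fin (d + 2) → ℝ) : flip X 0 = X 0 := by
  simp [flip]

lemma flip_one (X : Fin (d + 2) → ℝ) : flip X 1 = -X 1 := by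
  simp [flip]; ring

lemma map_flip (h : NearPoint B ρ L R) (X : Fin (d + 2) → ℝ) : L (flip X) = L X := by
  simp [flip, h.map_one]

lemma nrm_flip (h : NearPoint B ρ L R) (X : Fin (d + 2) → ℝ) : nrm L (flip X) = nrm L X := by
  simp only [nrm, flip_zero, flip_one, h.map_flip, neg_sq]

/-- Reflecting one argument in time makes the Lorentzian form positive. The condition `4 B ρ ≤ 1`
keeps the remainder below a quarter of the squared norm, and the corrections `ρ²/2` cost little
more. -/
lemma coercive (h : NearPoint B ρ L R) (X : Fin (d + 2) → ℝ) :
    nrm L X ^ 2 / 2 ≤ bil (rescaled ρ (gramM L) R) X (flip X) := by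
  rw [bil_rescaled, flip_zero, flip_one, h.map_flip, real_inner_self_eq_norm_sq]
  have h1 := neg_abs_le (bil R X (flip X))
  have h2 := h.bdd X (flip X)
  rw [h.nrm_flip] at h2
  have h3 := nrm_sq L X
  have h4 := h.ρ_small
  have h5 := h.ρ_pos
  have h6 := h.ρ_le
  have h7 : ρ ^ 3 * (B * nrm L X * nrm L X) ≤ nrm L X ^ 2 / 4 := by
    have : ρ ^ 3 * B ≤ 1 / 4 := by
      have : ρ ^ 2 ≤ 1 := by nlinarith
      have : 0 ≤ B * ρ := by nlinarith [h.one_le]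
      nlinarith
    nlinarith [sq_nonneg (nrm L X)]
  have h8 : -(ρ ^ 3 * (B * nrm L X * nrm L X)) ≤ ρ ^ 3 * bil R X (flip X) := by
    have : 0 ≤ ρ ^ 3 := by positivity
    nlinarith
  have h9 : ρ ^ 2 ≤ 1 / 16 := by nlinarith
  nlinarith [sq_nonneg (X 0), sq_nonneg (X 1), sq_nonneg ‖L X‖]

/-- On vectors without `t`-component the rescaled metric is positive definite. -/
lemma coercive_of_eq_zero (h : NearPoint B ρ L R) {X : Fin (d + 2) → ℝ} (hX : X 1 = 0) :
    nrm L X ^ 2 / 2 ≤ bil (rescaled ρ (gramM L) R) X X := by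
  have h1 : flip X = X := by simp [flip, hX]
  simpa [h1] using h.coercive X

lemma eq_zero_of_nrm (h : NearPoint B ρ L R) {X : Fin (d + 2) → ℝ} (hX : nrm L X = 0) : X = 0 := by
  funext α
  have := h.coord X α
  rw [hX, mul_zero] at this
  exact abs_nonpos_iff.1 this

lemma nrm_pos (h : NearPoint B ρ L R) {X : Fin (d + 2) → ℝ} (hX : X ≠ 0) : 0 < nrm L X :=
  (nrm_nonneg L X).lt_of_ne fun h0 => hX (h.eq_zero_of_nrm h0.symm)

lemma isUnit_det (h : NearPoint B ρ L R) : IsUnit (rescaled ρ (gramM L) R).det := by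
  rw [isUnit_iff_ne_zero]
  intro h0
  obtain ⟨v, hv, hv'⟩ := Matrix.exists_mulVec_eq_zero_iff.2 h0
  have h1 := h.coercive v
  rw [h.bil_comm, bil_eq_dotProduct, hv', dotProduct_zero] at h1
  have := h.nrm_pos hv
  nlinarith

lemma nrm_single_one (h : NearPoint B ρ L R) : nrm L (Pi.single 1 1) = 1 := by
  simp [nrm, h.map_one]

/-- A vector whose dual with respect to the rescaled metric is bounded, is bounded. -/
lemma nrm_le_of_forall (h : NearPoint B ρ L R) {X : Fin (d + 2) → ℝ} {b : ℝ}
    (hX : ∀ Y, bil (rescaled ρ (gramM L) R) X Y ≤ b * nrm L Y) : nrm L X ≤ 2 * b := by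
  have h1 := (h.coercive X).trans (hX _)
  rw [h.nrm_flip] at h1
  rcases (nrm_nonneg L X).eq_or_lt with h0 | h0
  -- If the norm vanishes then `X = 0`, and what remains to be seen is `0 ≤ b`; testing against the
  -- unit vector `∂_t` gives it.
  · have h2 := hX (Pi.single 1 1)
    rw [h.nrm_single_one, h.eq_zero_of_nrm h0.symm] at h2
    rw [LinearMap.map_zero₂, mul_one] at h2
    rw [← h0]; linarith
  · have : nrm L X / 2 ≤ b := by
      by_contra hc
      push Not at hc
      nlinarith
    linarith

/-- The dual vector of `dt` with respect to the rescaled metric. -/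
lemma exists_dual_dt (h : NearPoint B ρ L R) : ∃ w : Fin (d + 2) → ℝ,
    (∀ Y, bil (rescaled ρ (gramM L) R) w Y = Y 1) ∧ w 0 = 0 ∧ nrm L w ≤ 2 ∧
      nrm L (w + (1 + ρ ^ 2 / 2)⁻¹ • Pi.single 1 1) ≤ 2 * (B * ρ ^ 3) := by
  set H := rescaled ρ (gramM L) R with hH
  have hsymm := h.bil_comm
  have hw : ∀ Y, bil H (H⁻¹ *ᵥ Pi.single 1 1) Y = Y 1 := fun Y => by
    rw [hsymm, bil_eq_dotProduct, Matrix.mulVec_mulVec, Matrix.mul_nonsing_inv _ h.isUnit_det,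
      Matrix.one_mulVec, dotProduct_single_one]
  set w := H⁻¹ *ᵥ Pi.single 1 1 with hwdef
  have hY1 : ∀ Y : Fin (d + 2) → ℝ, |Y 1| ≤ nrm L Y := fun Y =>
    abs_le_of_sq_le_sq (by rw [nrm_sq]; nlinarith [sq_nonneg (Y 0), sq_nonneg ‖L Y‖])
      (nrm_nonneg _ _)
  refine ⟨w, hw, ?_, ?_, ?_⟩
  · have h1 := hw (Pi.single 0 1)
    rw [hH, bil_rescaled, h.map_zero, BorderlineAdS.bil_comm h.symm, h.bil_zero] at h1
    simpa using h1
  · simpa using h.nrm_le_of_forall (X := w) (b := 1) fun Y => by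
      rw [hw, one_mul]; exact (le_abs_self _).trans (hY1 Y)
  · refine h.nrm_le_of_forall fun Y => ?_
    set κ := (1 + ρ ^ 2 / 2)⁻¹ with hκ
    have hκ1 : κ * (1 + ρ ^ 2 / 2) = 1 := inv_mul_cancel₀ (by positivity)
    have hκ0 : 0 < κ := by positivity
    have hκ2 : κ ≤ 1 := inv_le_one_of_one_le₀ (by nlinarith [sq_nonneg ρ])
    -- Without the remainder the dual of `dt` would be `-κ ∂_t`, so the difference pairs with `Y`
    -- only through `ρ³ R`.
    have h1 : bil H (w + κ • Pi.single 1 1) Y = κ * ρ ^ 3 * bil R (Pi.single 1 1) Y := by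
      rw [map_add, LinearMap.add_apply, hw, map_smul, LinearMap.smul_apply, hH, bil_rescaled,
        h.map_one]
      simp only [inner_zero_left, smul_eq_mul, Pi.single_eq_same, Pi.single_eq_of_ne one_ne_zero'.symm]
      linear_combination (-Y 1) * hκ1
    rw [← hH, h1]
    have h2 := (le_abs_self _).trans (h.bdd (Pi.single 1 1) Y)
    rw [h.nrm_single_one, mul_one] at h2
    have h3 : 0 ≤ B * nrm L Y := mul_nonneg (by linarith [h.one_le]) (nrm_nonneg _ _)
    have h4 : 0 < ρ ^ 3 := by have := h.ρ_pos; positivity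
    calc κ * ρ ^ 3 * bil R (Pi.single 1 1) Y ≤ κ * ρ ^ 3 * (B * nrm L Y) := by gcongr
      _ ≤ 1 * ρ ^ 3 * (B * nrm L Y) := by gcongr
      _ = _ := by ring

end NearPoint

end point


end

section

variable {d : ℕ}

/-! ### The adapted frame at a point -/

/-- Expansion of a vector in an orthogonal family of maximal cardinality. -/
lemma eq_sum_of_orthogonal {ι : Type*} [Fintype ι] [DecidableEq ι]
    (hι : Fintype.card ι = d + 2) {G : Matrix (Fin (d + 2)) (Fin (d + 2)) ℝ}
    {b : ι → Fin (d + 2) → ℝ} {ε : ι → ℝ} (hε : ∀ i, ε i ≠ 0)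
    (hb : ∀ i j, bil G (b i) (b j) = if i = j then ε i else 0) (v : Fin (d + 2) → ℝ) :
    v = ∑ i, ((ε i)⁻¹ * bil G v (b i)) • b i := by
  have key : ∀ (c : ι → ℝ) (j : ι), bil G (∑ i, c i • b i) (b j) = c j * ε j := by
    intro c j
    rw [map_sum, LinearMap.sum_apply]
    simp only [map_smul, LinearMap.smul_apply, hb, smul_eq_mul, mul_ite, mul_zero]
    rw [Finset.sum_ite_eq' Finset.univ j]
    simp
  -- Pairing with `b j` isolates the `j`-th coefficient because `ε j ≠ 0`; nondegeneracy of `G` is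
  -- not needed.
  have hli : LinearIndependent ℝ b := by
    rw [Fintype.linearIndependent_iff]
    intro c hc j
    have := key c j
    rw [hc, LinearMap.map_zero₂] at this
    exact (mul_eq_zero.1 this.symm).resolve_right (hε j)
  have hspan := hli.span_eq_top_of_card_eq_finrank' (by simp [hι])
  obtain ⟨c, hc⟩ := (Submodule.mem_span_range_iff_exists_fun ℝ).1
    (hspan ▸ Submodule.mem_top : v ∈ Submodule.span ℝ (Set.range b))
  conv_lhs => rw [← hc]
  refine Finset.sum_congr rfl fun i _ => ?_
  rw [← hc, key, mul_comm (c i), inv_mul_cancel_left₀ (hε i)]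

/-- The values `s = sin t`, `c = cos t`, and `f` at a point with small `f`. -/
structure FoliationPoint (ρ s c f : ℝ) : Prop where
  s_pos : 0 < s
  sq_add_sq : s ^ 2 + c ^ 2 = 1
  f_pos : 0 < f
  f_mul : f * s = ρ * (1 - ρ ^ 2 / 4)
  f_le : f ≤ 1 / 8

section point

variable {F : Type*} [NormedAddCommGroup F] [InnerProductSpace ℝ F]
variable {B ρ s c f : ℝ} {L : (Fin (d + 2) → ℝ) →ₗ[ℝ] F}
  {R : Matrix (Fin (d + 2)) (Fin (d + 2)) ℝ}

namespace FoliationPoint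

lemma s_le (k : FoliationPoint ρ s c f) : s ≤ 1 := by
  nlinarith [k.sq_add_sq, sq_nonneg c, k.s_pos]

lemma abs_c_le (k : FoliationPoint ρ s c f) : |c| ≤ 1 :=
  abs_le_of_sq_le_sq (by nlinarith [k.sq_add_sq, sq_nonneg s]) zero_le_one

lemma fs_le (k : FoliationPoint ρ s c f) (hρ : 0 < ρ) : f * s ≤ ρ := by
  rw [k.f_mul]; nlinarith [sq_nonneg ρ]

lemma ρ_le_fs (k : FoliationPoint ρ s c f) (hρ : 0 < ρ) (hρ' : ρ ≤ 1 / 4) : ρ ≤ 2 * (f * s) := by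
  rw [k.f_mul]; nlinarith [sq_nonneg ρ]

lemma ρ_le_f (k : FoliationPoint ρ s c f) (hρ : 0 < ρ) (hρ' : ρ ≤ 1 / 4) : ρ ≤ 2 * f :=
  (k.ρ_le_fs hρ hρ').trans (by nlinarith [k.s_le, k.f_pos])

lemma ρ_sq_le (k : FoliationPoint ρ s c f) (hρ : 0 < ρ) (hρ' : ρ ≤ 1 / 4) :
    ρ ^ 2 ≤ 4 * f ^ 2 := by
  nlinarith [k.ρ_le_f hρ hρ', k.f_pos]

lemma c_sq_le (k : FoliationPoint ρ s c f) : c ^ 2 ≤ 1 := by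
  nlinarith [k.sq_add_sq, sq_nonneg s]

lemma f_sq_le (k : FoliationPoint ρ s c f) : f ^ 2 ≤ 1 / 64 := by
  nlinarith [k.f_pos, k.f_le]

lemma cf_sq_le (k : FoliationPoint ρ s c f) : (c * f) ^ 2 ≤ f ^ 2 := by
  rw [mul_pow]; nlinarith [k.c_sq_le, sq_nonneg f]

end FoliationPoint

/-- The metric components at a point. -/
def pointMetric (ρ : ℝ) (L : (Fin (d + 2) → ℝ) →ₗ[ℝ] F)
    (R : Matrix (Fin (d + 2)) (Fin (d + 2)) ℝ) : Matrix (Fin (d + 2)) (Fin (d + 2)) ℝ :=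
  (ρ ^ 2)⁻¹ • rescaled ρ (gramM L) R

lemma bil_pointMetric (X Y : Fin (d + 2) → ℝ) : bil (pointMetric ρ L R) X Y =
    (ρ ^ 2)⁻¹ * bil (rescaled ρ (gramM L) R) X Y := by
  simp [pointMetric]

lemma bil_rescaled_eq (hρ : 0 < ρ) (X Y : Fin (d + 2) → ℝ) :
    bil (rescaled ρ (gramM L) R) X Y = ρ ^ 2 * bil (pointMetric ρ L R) X Y := by
  rw [bil_pointMetric, mul_inv_cancel_left₀ (by positivity)]

lemma NearPoint.bil_pointMetric_comm (h : NearPoint B ρ L R) (X Y : Fin (d + 2) → ℝ) :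
    bil (pointMetric ρ L R) X Y = bil (pointMetric ρ L R) Y X := by
  rw [bil_pointMetric, bil_pointMetric, h.bil_comm]

lemma NearPoint.horizontal_pos (h : NearPoint B ρ L R) {X : Fin (d + 2) → ℝ} (hX : X 1 = 0)
    (hX0 : X ≠ 0) : 0 < bil (pointMetric ρ L R) X X := by
  have h1 := h.coercive_of_eq_zero hX
  have h2 := h.nrm_pos hX0
  have h3 := h.ρ_pos
  rw [bil_pointMetric]
  have : 0 < bil (rescaled ρ (gramM L) R) X X := by nlinarith
  positivity

/-- `W` is the gradient of `f` at the point. -/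
def IsGrad (ρ s c f : ℝ) (L : (Fin (d + 2) → ℝ) →ₗ[ℝ] F)
    (R : Matrix (Fin (d + 2)) (Fin (d + 2)) ℝ) (W : Fin (d + 2) → ℝ) : Prop :=
  ∀ Y, bil (pointMetric ρ L R) W Y = (1 - 3 / 4 * ρ ^ 2) / s * Y 0 - c * f / s * Y 1

/-- The gradient of a function of `(ρ, t)` in terms of the dual vector of `dt`. -/
lemma NearPoint.eq_of_dual (h : NearPoint B ρ L R) {W w : Fin (d + 2) → ℝ} {a b : ℝ}
    (hW : ∀ Y, bil (pointMetric ρ L R) W Y = a * Y 0 + b * Y 1)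
    (hw : ∀ Y, bil (rescaled ρ (gramM L) R) w Y = Y 1) :
    W = (ρ ^ 2 * a) • Pi.single 0 1 + (ρ ^ 2 * b) • w := by
  have h0 : ∀ Y, bil (rescaled ρ (gramM L) R) (Pi.single 0 1) Y = Y 0 := fun Y => by
    rw [bil_rescaled, h.map_zero, h.bil_zero]
    simp
  have h1 := h.nrm_le_of_forall (X := W - ((ρ ^ 2 * a) • Pi.single 0 1 + (ρ ^ 2 * b) • w))
    (b := 0) fun Y => by
      simp only [map_sub, map_add, map_smul, LinearMap.sub_apply, LinearMap.add_apply,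
        LinearMap.smul_apply, smul_eq_mul]
      rw [bil_rescaled_eq h.ρ_pos W Y, hW, hw, h0]
      exact le_of_eq (by ring)
  rw [mul_zero] at h1
  exact sub_eq_zero.1 (h.eq_zero_of_nrm (le_antisymm h1 (nrm_nonneg _ _)))

/-- The gradient is a combination of `∂_ρ` and the dual vector `w` of `dt`. With `σ = ρ / s`,
comparable to `f`, the coefficients are `ρ σ (1 - ¾ρ²)` and `-ρ σ c f`, so every component other
than the `ρ`-component gains a factor `f`. -/
lemma NearPoint.grad_bounds (h : NearPoint B ρ L R) (k : FoliationPoint ρ s c f)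
    {W : Fin (d + 2) → ℝ} (hW : IsGrad ρ s c f L R W) :
    |W 0| ≤ 2 * (ρ * f) ∧ (∀ α, α ≠ 0 → |W α| ≤ 4 * B * (ρ * f ^ 2)) ∧
      |bil (pointMetric ρ L R) W W - f ^ 2| ≤ 10 * f ^ 4 := by
  obtain ⟨w, hw, hw0, hw2, -⟩ := h.exists_dual_dt
  have hWw := h.eq_of_dual (a := (1 - 3 / 4 * ρ ^ 2) / s) (b := -(c * f / s))
    (fun Y => by rw [hW Y]; ring) hw
  have hs := k.s_pos
  have hρ := h.ρ_pos
  have hρ4 := h.ρ_le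
  have hf := k.f_pos
  set σ := ρ / s with hσ
  have hσ0 : 0 < σ := by positivity
  have hσf : f = σ * (1 - ρ ^ 2 / 4) := by
    rw [hσ, div_mul_eq_mul_div, ← k.f_mul, mul_div_cancel_right₀ _ hs.ne']
  have hρ2 : ρ ^ 2 ≤ 1 / 16 := by nlinarith only [hρ, hρ4]
  have hσ2 : σ ≤ 2 * f := by
    rw [hσf]; nlinarith [mul_le_mul_of_nonneg_left hρ2 hσ0.le]
  have hfσ : f ≤ σ := by rw [hσf]; nlinarith [sq_nonneg ρ, mul_pos hσ0 (pow_pos hρ 2)]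
  have hρσ : ρ ≤ σ := by rw [hσ, le_div_iff₀ hs]; nlinarith [k.s_le]
  have hW0 : W 0 = ρ * σ * (1 - 3 / 4 * ρ ^ 2) := by
    rw [hWw]
    simp only [Pi.add_apply, Pi.smul_apply, Pi.single_eq_same, smul_eq_mul, hw0, hσ]
    ring
  have hWa : ∀ α, α ≠ 0 → W α = -(ρ * σ * c * f) * w α := fun α hα => by
    rw [hWw]
    simp only [Pi.add_apply, Pi.smul_apply, Pi.single_eq_of_ne hα, smul_eq_mul, hσ]
    ring
  have hcf : |ρ * σ * c * f| ≤ 2 * (ρ * f ^ 2) := by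
    rw [abs_mul, abs_mul, abs_of_pos (mul_pos hρ hσ0), abs_of_pos hf]
    calc ρ * σ * |c| * f ≤ ρ * (2 * f) * 1 * f := by gcongr; exact k.abs_c_le
      _ = _ := by ring
  have hw1 : |w 1| ≤ 2 := by
    have h1 : |w 1| ≤ nrm L w := abs_le_of_sq_le_sq
      (by rw [nrm_sq]; nlinarith [sq_nonneg (w 0), sq_nonneg ‖L w‖]) (nrm_nonneg _ _)
    linarith
  refine ⟨?_, fun α hα => ?_, ?_⟩
  · rw [hW0, abs_of_nonneg (mul_nonneg (by positivity) (by linarith))]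
    calc ρ * σ * (1 - 3 / 4 * ρ ^ 2) ≤ ρ * (2 * f) * 1 := by
          gcongr
          · linarith
          · nlinarith [sq_nonneg ρ]
      _ = _ := by ring
  · rw [hWa α hα, abs_mul, abs_neg]
    have h1 : |w α| ≤ 2 * B := (h.coord w α).trans (by nlinarith [h.one_le])
    calc |ρ * σ * c * f| * |w α| ≤ 2 * (ρ * f ^ 2) * (2 * B) := by gcongr
      _ = _ := by ring
  -- The terms of order `σ²` cancel by the difference of squares `(1 - ¾ρ²)² - (1 - ¼ρ²)² = -½ρ² (2
  -- - ρ²)`. The rest is quartic in `f` since `ρ ≤ 2 f`.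
  · have h1 : bil (pointMetric ρ L R) W W - f ^ 2
        = -(σ ^ 2 * ρ ^ 2 * (1 / 2 * (2 - ρ ^ 2))) + σ ^ 2 * c ^ 2 * f ^ 2 * w 1 := by
      rw [hW, hW0, hWa 1 one_ne_zero', hσf, hσ]
      field_simp
      ring
    rw [h1]
    have h2 : σ ^ 2 ≤ 3 / 2 * f ^ 2 := by
      have : σ ≤ 64 / 63 * f := by rw [hσf]; nlinarith
      nlinarith
    have h3 : σ ^ 2 * ρ ^ 2 ≤ 6 * f ^ 4 := by
      have : ρ ^ 2 ≤ (2 * f) ^ 2 := by gcongr; linarith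
      calc σ ^ 2 * ρ ^ 2 ≤ 3 / 2 * f ^ 2 * (2 * f) ^ 2 := by gcongr
        _ = _ := by ring
    have h4 : σ ^ 2 * c ^ 2 * f ^ 2 * |w 1| ≤ 3 * f ^ 4 := by
      have : c ^ 2 ≤ 1 := by nlinarith [k.sq_add_sq, sq_nonneg s]
      calc σ ^ 2 * c ^ 2 * f ^ 2 * |w 1| ≤ 3 / 2 * f ^ 2 * 1 * f ^ 2 * 2 := by gcongr
        _ = _ := by ring
    have h5 : σ ^ 2 * ρ ^ 2 * (1 / 2 * (2 - ρ ^ 2)) ≤ 6 * f ^ 4 := by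
      have : 0 ≤ σ ^ 2 * ρ ^ 2 := by positivity
      nlinarith [sq_nonneg ρ]
    have h6 : 0 ≤ σ ^ 2 * ρ ^ 2 * (1 / 2 * (2 - ρ ^ 2)) :=
      mul_nonneg (by positivity) (by linarith)
    have h7 : |σ ^ 2 * c ^ 2 * f ^ 2 * w 1| ≤ 3 * f ^ 4 := by
      rw [abs_mul, abs_of_nonneg (by positivity : 0 ≤ σ ^ 2 * c ^ 2 * f ^ 2)]; exact h4
    have h8 := abs_le.1 h7
    rw [abs_le]
    have : 0 < f ^ 4 := by positivity
    constructor <;> linarith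

lemma NearPoint.grad_sq_bounds (h : NearPoint B ρ L R) (k : FoliationPoint ρ s c f)
    {W : Fin (d + 2) → ℝ} (hW : IsGrad ρ s c f L R W) :
    f ^ 2 / 4 ≤ bil (pointMetric ρ L R) W W := by
  have h1 := (abs_le.1 (h.grad_bounds k hW).2.2).1
  have h2 : f ^ 2 ≤ 1 / 64 := by nlinarith [k.f_pos, k.f_le]
  nlinarith [sq_nonneg f]

/-- Normalisation divides by a length of at least `f / 2`, which removes one factor `f` from each
gradient bound. -/
lemma NearPoint.normal_bounds (h : NearPoint B ρ L R) (k : FoliationPoint ρ s c f)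
    {W : Fin (d + 2) → ℝ} (hW : IsGrad ρ s c f L R W) {N : Fin (d + 2) → ℝ}
    (hN : N = (Real.sqrt |bil (pointMetric ρ L R) W W|)⁻¹ • W) :
    |N 0| ≤ 4 * ρ ∧ ∀ α, α ≠ 0 → |N α| ≤ 8 * B * (ρ * f) := by
  have hf := k.f_pos
  have h1 := h.grad_sq_bounds k hW
  have h2 : f / 2 ≤ Real.sqrt |bil (pointMetric ρ L R) W W| := by
    apply Real.le_sqrt_of_sq_le
    rw [abs_of_nonneg (le_trans (by positivity) h1)]
    linarith [h1]
  have h3 : (Real.sqrt |bil (pointMetric ρ L R) W W|)⁻¹ ≤ 2 / f := by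
    rw [inv_le_comm₀ (by linarith) (by positivity), inv_div]; exact h2
  have h4 : 0 ≤ (Real.sqrt |bil (pointMetric ρ L R) W W|)⁻¹ := by positivity
  obtain ⟨hW0, hWa, -⟩ := h.grad_bounds k hW
  subst hN
  refine ⟨?_, fun α hα => ?_⟩ <;>
    rw [Pi.smul_apply, smul_eq_mul, abs_mul, abs_of_nonneg h4]
  · calc _ ≤ 2 / f * (2 * (ρ * f)) := by gcongr
      _ = _ := by field_simp; ring
  · calc _ ≤ 2 / f * (4 * B * (ρ * f ^ 2)) := by gcongr; exact hWa α hα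
      _ = _ := by field_simp; ring

/-- The vector `(1 - ¾ρ²) ∂_t + c f ∂_ρ`. -/
def preV (d : ℕ) (ρ c f : ℝ) : Fin (d + 2) → ℝ :=
  (1 - 3 / 4 * ρ ^ 2) • Pi.single 1 1 + (c * f) • Pi.single 0 1

lemma preV_zero : preV d ρ c f 0 = c * f := by
  simp [preV]

lemma preV_one : preV d ρ c f 1 = 1 - 3 / 4 * ρ ^ 2 := by
  simp [preV]

lemma NearPoint.map_preV (h : NearPoint B ρ L R) : L (preV d ρ c f) = 0 := by
  simp [preV, h.map_zero, h.map_one]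

/-- `E` is an orthonormal frame of horizontal vectors at the point. -/
structure IsFrame (ρ : ℝ) (L : (Fin (d + 2) → ℝ) →ₗ[ℝ] F)
    (R : Matrix (Fin (d + 2)) (Fin (d + 2)) ℝ) (E : Fin d → Fin (d + 2) → ℝ) : Prop where
  zero : ∀ X, E X 0 = 0
  one : ∀ X, E X 1 = 0
  orth : ∀ X Y, bil (pointMetric ρ L R) (E X) (E Y) = if X = Y then 1 else 0

/-- The part of `preV` orthogonal to the frame. -/
def checkV (ρ c f : ℝ) (L : (Fin (d + 2) → ℝ) →ₗ[ℝ] F)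
    (R : Matrix (Fin (d + 2)) (Fin (d + 2)) ℝ) (E : Fin d → Fin (d + 2) → ℝ) : Fin (d + 2) → ℝ :=
  preV d ρ c f - ∑ X, bil (pointMetric ρ L R) (preV d ρ c f) (E X) • E X

variable {E : Fin d → Fin (d + 2) → ℝ}

lemma IsFrame.bil_sum_left (e : IsFrame ρ L R E) (y : Fin d → ℝ) (X : Fin d) :
    bil (pointMetric ρ L R) (∑ X, y X • E X) (E X) = y X := by
  rw [map_sum, LinearMap.sum_apply]
  simp [map_smul, e.orth]

lemma IsFrame.bil_sum_sum (e : IsFrame ρ L R E) (y : Fin d → ℝ) :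
    bil (pointMetric ρ L R) (∑ X, y X • E X) (∑ X, y X • E X) = ∑ X, y X ^ 2 := by
  rw [map_sum (bil (pointMetric ρ L R) (∑ X, y X • E X))]
  refine Finset.sum_congr rfl fun X _ => ?_
  rw [map_smul, e.bil_sum_left, smul_eq_mul, sq]

lemma IsFrame.sum_zero (e : IsFrame ρ L R E) (y : Fin d → ℝ) : (∑ X, y X • E X) 0 = 0 := by
  rw [Finset.sum_apply]
  exact Finset.sum_eq_zero fun X _ => by rw [Pi.smul_apply, e.zero, smul_zero]

lemma IsFrame.sum_one (e : IsFrame ρ L R E) (y : Fin d → ℝ) : (∑ X, y X • E X) 1 = 0 := by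
  rw [Finset.sum_apply]
  exact Finset.sum_eq_zero fun X _ => by rw [Pi.smul_apply, e.one, smul_zero]

lemma IsFrame.checkV_zero (e : IsFrame ρ L R E) : checkV ρ c f L R E 0 = c * f := by
  rw [checkV, Pi.sub_apply, e.sum_zero, preV_zero, sub_zero]

lemma IsFrame.checkV_one (e : IsFrame ρ L R E) :
    checkV ρ c f L R E 1 = 1 - 3 / 4 * ρ ^ 2 := by
  rw [checkV, Pi.sub_apply, e.sum_one, preV_one, sub_zero]

lemma IsFrame.bil_checkV (e : IsFrame ρ L R E) (X : Fin d) :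
    bil (pointMetric ρ L R) (checkV ρ c f L R E) (E X) = 0 := by
  rw [checkV, map_sub, LinearMap.sub_apply, e.bil_sum_left, sub_self]

/-- The size of `checkV`. -/
lemma NearPoint.checkV_sq (h : NearPoint B ρ L R) (k : FoliationPoint ρ s c f)
    (e : IsFrame ρ L R E) :
    |-(ρ ^ 2 * bil (pointMetric ρ L R) (checkV ρ c f L R E) (checkV ρ c f L R E))
      - (1 - 3 / 4 * ρ ^ 2) ^ 2| ≤ 5 * f ^ 2 := by
  set G := bil (pointMetric ρ L R) with hG
  set Z := preV d ρ c f with hZ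
  set Y := ∑ X, G Z (E X) • E X with hY
  set z := 1 - 3 / 4 * ρ ^ 2 with hz
  have hρ := h.ρ_pos
  have hρ4 := h.ρ_le
  have hρ2 : ρ ^ 2 ≤ 1 / 16 := by nlinarith only [hρ, hρ4]
  have hY0 : Y 0 = 0 := e.sum_zero _
  have hY1 : Y 1 = 0 := e.sum_one _
  -- `Y` is the orthogonal projection of `Z` to the horizontal space, whence `G(Z - Y, Z - Y) = G(Z,
  -- Z) - G(Y, Y)`.
  have hZY : G Z Y = G Y Y := by
    rw [hY, e.bil_sum_sum, map_sum]
    exact Finset.sum_congr rfl fun X _ => by rw [map_smul, smul_eq_mul, sq]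
  have h1 : G (checkV ρ c f L R E) (checkV ρ c f L R E) = G Z Z - G Y Y := by
    change G (Z - Y) (Z - Y) = _
    have := h.bil_pointMetric_comm Y Z
    simp only [map_sub, LinearMap.sub_apply]
    linear_combination (-1 : ℝ) * this - 2 * hZY
  have hLZ : L Z = 0 := h.map_preV
  have hZ0 : Z 0 = c * f := preV_zero
  have hZ1 : Z 1 = z := preV_one
  have h2 : ρ ^ 2 * G Z Z = (c * f) ^ 2 - (1 + ρ ^ 2 / 2) * z ^ 2 + ρ ^ 3 * bil R Z Z := by
    rw [hG, ← bil_rescaled_eq hρ, bil_rescaled, hLZ, hZ0, hZ1]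
    simp only [inner_zero_left]
    ring
  have hRZ : ∀ X, bil R Z X = z * bil R (Pi.single 1 1) X := fun X => by
    rw [hZ, preV, map_add, LinearMap.add_apply, map_smul, map_smul, LinearMap.smul_apply,
      LinearMap.smul_apply, h.bil_zero]
    simp [hz]
  have hRZ' : ∀ X, bil R X Z = z * bil R (Pi.single 1 1) X := fun X => by
    rw [BorderlineAdS.bil_comm h.symm, hRZ]
  have hz0 : 0 ≤ z := by rw [hz]; linarith
  have hz1 : z ≤ 1 := by rw [hz]; nlinarith [sq_nonneg ρ]
  have hB : ∀ X, |bil R (Pi.single 1 1) X| ≤ B * nrm L X := fun X => by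
    simpa [h.nrm_single_one] using h.bdd (Pi.single 1 1) X
  have h3 : |ρ ^ 3 * bil R Z Z| ≤ ρ ^ 2 / 4 := by
    rw [hRZ, hRZ', abs_mul, abs_mul, abs_mul, abs_of_pos (pow_pos hρ 3), abs_of_nonneg hz0]
    have h4 := hB (Pi.single 1 1)
    rw [h.nrm_single_one, mul_one] at h4
    calc ρ ^ 3 * (z * (z * |bil R (Pi.single 1 1) (Pi.single 1 1)|))
        ≤ ρ ^ 3 * (1 * (1 * B)) := by gcongr
      _ = ρ ^ 2 * (4 * B * ρ) / 4 := by ring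
      _ ≤ ρ ^ 2 * 1 / 4 := by gcongr; exact h.ρ_small
      _ = _ := by ring
  -- `Z` pairs with horizontal vectors only through `ρ³ R`, so `ρ² G(Y, Y)` is at most linear in the
  -- norm of `Y`. Coercivity bounds it below quadratically, and the projection is therefore tiny.
  have h5 : ρ ^ 2 * G Y Y ≤ 2 * (ρ ^ 3 * B) ^ 2 ∧ 0 ≤ ρ ^ 2 * G Y Y := by
    have h6 := h.coercive_of_eq_zero hY1
    have h7 : ρ ^ 2 * G Y Y = ρ ^ 3 * (z * bil R (Pi.single 1 1) Y) := by
      rw [← hZY, hG, ← bil_rescaled_eq hρ, bil_rescaled, hLZ, hY0, hY1, hRZ]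
      simp
    have h8 : ρ ^ 2 * G Y Y ≤ ρ ^ 3 * B * nrm L Y := by
      rw [h7]
      calc _ ≤ ρ ^ 3 * (z * |bil R (Pi.single 1 1) Y|) := by gcongr; exact le_abs_self _
        _ ≤ ρ ^ 3 * (1 * (B * nrm L Y)) := by gcongr; exact hB Y
        _ = _ := by ring
    rw [bil_rescaled_eq hρ, ← hG] at h6
    have h9 := nrm_nonneg L Y
    refine ⟨?_, by nlinarith only [h6, sq_nonneg (nrm L Y)]⟩
    nlinarith only [h6, h8, sq_nonneg (nrm L Y - 2 * (ρ ^ 3 * B))]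
  have h10 : 2 * (ρ ^ 3 * B) ^ 2 ≤ ρ ^ 2 / 4 := by
    have : ρ ^ 3 * B ≤ ρ ^ 2 / 4 := by nlinarith [h.ρ_small, sq_nonneg ρ]
    have h0 : 0 ≤ ρ ^ 3 * B := by have := h.one_le; positivity
    calc 2 * (ρ ^ 3 * B) ^ 2 ≤ 2 * (ρ ^ 2 / 4) ^ 2 := by gcongr
      _ ≤ _ := by nlinarith [sq_nonneg ρ]
  have h11 : ρ ^ 2 ≤ 4 * f ^ 2 := k.ρ_sq_le hρ hρ4
  have h12 := k.cf_sq_le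
  have h13 : z ^ 2 ≤ 1 := pow_le_one₀ hz0 hz1
  rw [h1, mul_sub, h2]
  have h14 := abs_le.1 h3
  rw [abs_le]
  have h15 : 0 ≤ ρ ^ 2 * z ^ 2 := by positivity
  have h16 : ρ ^ 2 * z ^ 2 ≤ ρ ^ 2 * 1 := by gcongr
  have h17 := sq_nonneg (c * f)
  have h18 := sq_nonneg f
  constructor <;> linarith only [h5.1, h5.2, h14.1, h14.2, h10, h11, h12, h13, h15, h16, h17, h18]

/-- The main term `(1 - ¾ρ²)² ≥ 1/2` dominates the error `5 f² ≤ 5/64`. -/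
lemma NearPoint.checkV_timelike (h : NearPoint B ρ L R) (k : FoliationPoint ρ s c f)
    (e : IsFrame ρ L R E) :
    bil (pointMetric ρ L R) (checkV ρ c f L R E) (checkV ρ c f L R E) < 0 := by
  have h1 := (abs_le.1 (h.checkV_sq k e)).1
  have h2 : f ^ 2 ≤ 1 / 64 := by nlinarith [k.f_pos, k.f_le]
  have h3 : ρ ^ 2 ≤ 1 / 16 := by nlinarith [h.ρ_pos, h.ρ_le]
  have h4 : 1 / 2 ≤ (1 - 3 / 4 * ρ ^ 2) ^ 2 := by nlinarith [sq_nonneg ρ]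
  have h5 : 0 < ρ ^ 2 := by have := h.ρ_pos; positivity
  by_contra hc
  push Not at hc
  have := mul_nonneg h5.le hc
  linarith

/-- A combination of the unit vector along `checkV` and of the frame. -/
lemma NearPoint.tangent_bounds (h : NearPoint B ρ L R) (k : FoliationPoint ρ s c f)
    (e : IsFrame ρ L R E) {V T : Fin (d + 2) → ℝ}
    (hV : V = (Real.sqrt |bil (pointMetric ρ L R) (checkV ρ c f L R E) (checkV ρ c f L R E)|)⁻¹ •
      checkV ρ c f L R E) (x : ℝ) (y : Fin d → ℝ) (hT : T = x • V + ∑ X, y X • E X) {l : ℝ}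
    (hl : 0 ≤ l) (hl2 : l ^ 2 = x ^ 2 + ∑ X, y X ^ 2) :
    ρ ^ 2 * l ^ 2 * (1 - 52 * f ^ 2) ≤ T 1 ^ 2 + ‖L T‖ ^ 2 ∧
      |T 0| ≤ 4 * (f * ρ * l) ∧ ∀ α, |T α| ≤ 2 * B * (ρ * l) := by
  set G := bil (pointMetric ρ L R) with hG
  set U := checkV ρ c f L R E with hU
  have hUU := h.checkV_timelike k e
  rw [← hG, ← hU] at hUU
  have hΛ := h.checkV_sq k e
  rw [← hG, ← hU] at hΛ
  rw [abs_of_neg hUU] at hV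
  set q := Real.sqrt (-G U U) with hq
  have hq0 : 0 < q := Real.sqrt_pos.2 (by linarith)
  have hq2 : q ^ 2 = -G U U := Real.sq_sqrt (by linarith)
  set z := 1 - 3 / 4 * ρ ^ 2 with hz
  have hρ := h.ρ_pos
  have hρ4 := h.ρ_le
  have hρ2 : ρ ^ 2 ≤ 1 / 16 := by nlinarith only [hρ, hρ4]
  have hf := k.f_pos
  have hf8 : f ^ 2 ≤ 1 / 64 := k.f_sq_le
  have hT0 : T 0 = x * q⁻¹ * (c * f) := by
    rw [hT, Pi.add_apply, e.sum_zero, hV, Pi.smul_apply, Pi.smul_apply, hU, e.checkV_zero]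
    simp [mul_assoc]
  have hT1 : T 1 = x * q⁻¹ * z := by
    rw [hT, Pi.add_apply, e.sum_one, hV, Pi.smul_apply, Pi.smul_apply, hU, e.checkV_one]
    simp [mul_assoc, hz]
  have hTT : G T T = -x ^ 2 + ∑ X, y X ^ 2 := by
    have h1 : G U (∑ X, y X • E X) = 0 := by
      rw [map_sum]
      exact Finset.sum_eq_zero fun X _ => by rw [map_smul, e.bil_checkV, smul_zero]
    have h2 : G (∑ X, y X • E X) U = 0 := by rw [hG, h.bil_pointMetric_comm]; exact h1
    have h3 : G V V = -1 := by
      rw [hV, map_smul, map_smul, LinearMap.smul_apply, smul_eq_mul, smul_eq_mul]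
      have : G U U = -q ^ 2 := by linarith
      rw [this]; field_simp
    have h4 : G V (∑ X, y X • E X) = 0 := by
      rw [hV, map_smul, LinearMap.smul_apply, h1, smul_zero]
    have h5 : G (∑ X, y X • E X) V = 0 := by rw [hV, map_smul, h2, smul_zero]
    rw [hT]
    simp only [map_add, LinearMap.add_apply]
    rw [map_smul, map_smul, LinearMap.smul_apply, LinearMap.smul_apply, h3, map_smul, h4, h5,
      e.bil_sum_sum]
    simp only [smul_eq_mul]; ring
  set A := T 1 ^ 2 + ‖L T‖ ^ 2 with hA
  have hA1 : T 1 ^ 2 ≤ A := le_add_of_nonneg_right (sq_nonneg _)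
  have hA2 : ‖L T‖ ^ 2 ≤ A := le_add_of_nonneg_left (sq_nonneg _)
  have hz2 : 9 / 10 ≤ z ^ 2 := by rw [hz]; nlinarith only [sq_nonneg ρ, hρ2]
  set Λ := -(ρ ^ 2 * G U U) with hΛdef
  -- `x² ρ² z² = (T^t)² Λ`
  have hx : x ^ 2 * ρ ^ 2 * z ^ 2 = T 1 ^ 2 * Λ := by
    have : Λ = ρ ^ 2 * q ^ 2 := by rw [hq2]; ring
    rw [this, hT1]; field_simp
  have hx' : |x ^ 2 * ρ ^ 2 - T 1 ^ 2| ≤ 6 * f ^ 2 * T 1 ^ 2 := by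
    have h1 : (x ^ 2 * ρ ^ 2 - T 1 ^ 2) * z ^ 2 = T 1 ^ 2 * (Λ - z ^ 2) := by linarith
    have h2 : |x ^ 2 * ρ ^ 2 - T 1 ^ 2| * z ^ 2 ≤ T 1 ^ 2 * (5 * f ^ 2) := by
      rw [← abs_of_nonneg (sq_nonneg z), ← abs_mul, h1, abs_mul, abs_of_nonneg (sq_nonneg (T 1))]
      gcongr
    have h3 := mul_le_mul_of_nonneg_left hz2 (abs_nonneg (x ^ 2 * ρ ^ 2 - T 1 ^ 2))
    have h4 := mul_nonneg (sq_nonneg (T 1)) (sq_nonneg f)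
    linarith
  have hT0' : T 0 ^ 2 ≤ 2 * f ^ 2 * T 1 ^ 2 := by
    have h1 : T 0 ^ 2 * z ^ 2 = T 1 ^ 2 * (c ^ 2 * f ^ 2) := by rw [hT0, hT1]; ring
    have h2 : c ^ 2 * f ^ 2 ≤ 1 * f ^ 2 := by
      gcongr; exact k.c_sq_le
    have h3 := mul_le_mul_of_nonneg_left hz2 (sq_nonneg (T 0))
    have h4 := mul_le_mul_of_nonneg_left h2 (sq_nonneg (T 1))
    have h5 := mul_nonneg (sq_nonneg (T 1)) (sq_nonneg f)
    linarith
  have hf2A : f ^ 2 * T 1 ^ 2 ≤ f ^ 2 * A := by gcongr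
  have hA0 : 0 ≤ A := by positivity
  have hn : nrm L T ^ 2 ≤ 2 * A := by
    rw [nrm_sq]
    have : f ^ 2 * A ≤ 1 / 64 * A := by gcongr
    linarith
  have hR : |ρ ^ 3 * bil R T T| ≤ ρ ^ 2 / 2 * A := by
    rw [abs_mul, abs_of_pos (pow_pos hρ 3)]
    calc ρ ^ 3 * |bil R T T| ≤ ρ ^ 3 * (B * nrm L T * nrm L T) := by gcongr; exact h.bdd T T
      _ = ρ ^ 2 * (4 * B * ρ) / 4 * nrm L T ^ 2 := by ring
      _ ≤ ρ ^ 2 * 1 / 4 * (2 * A) := by gcongr; exact h.ρ_small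
      _ = _ := by ring
  have hHTT : ρ ^ 2 * G T T = T 0 * T 0 - (1 + ρ ^ 2 / 2) * (T 1 * T 1)
      + (1 - ρ ^ 2 / 2) * ‖L T‖ ^ 2 + ρ ^ 3 * bil R T T := by
    rw [hG, ← bil_rescaled_eq hρ, bil_rescaled, real_inner_self_eq_norm_sq]
  have h11 : ρ ^ 2 ≤ 4 * f ^ 2 := k.ρ_sq_le hρ hρ4
  have h12 : ρ ^ 2 * A ≤ 4 * f ^ 2 * A := by gcongr
  -- The identity `l² = G(T, T) + 2 x²` passes from the Lorentzian to the Riemannian length. Since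
  -- `x² ρ²` is `(T 1)²` up to `O(f²)` and `ρ² ≤ 4 f²`, every discrepancy is `O(f² A)`.
  have hmain : |ρ ^ 2 * l ^ 2 - A| ≤ 26 * (f ^ 2 * A) := by
    have h1 : ρ ^ 2 * l ^ 2 - A = T 0 ^ 2 - ρ ^ 2 / 2 * A + ρ ^ 3 * bil R T T
        + 2 * (x ^ 2 * ρ ^ 2 - T 1 ^ 2) := by
      have : l ^ 2 = G T T + 2 * x ^ 2 := by rw [hTT, hl2]; ring
      rw [this, mul_add, hHTT, hA]; ring
    rw [h1]
    have h2 := abs_le.1 hR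
    have h3 := abs_le.1 hx'
    have h4 : 0 ≤ f ^ 2 * A := by positivity
    have h5 : 0 ≤ ρ ^ 2 * A := by positivity
    rw [abs_le]
    have h6 := sq_nonneg (T 0)
    constructor <;> linarith only [h2.1, h2.2, h3.1, h3.2, h4, h5, h6, h12, hT0', hf2A]
  have hm := abs_le.1 hmain
  have hfA : f ^ 2 * A ≤ 1 / 64 * A := by gcongr
  have hA2l : A ≤ 2 * (ρ ^ 2 * l ^ 2) := by linarith
  have hnl : nrm L T ≤ 2 * (ρ * l) := by
    refine abs_le_of_sq_le_sq' ?_ (by positivity) |>.2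
    calc nrm L T ^ 2 ≤ 2 * A := hn
      _ ≤ 2 * (2 * (ρ ^ 2 * l ^ 2)) := by gcongr
      _ = _ := by ring
  refine ⟨?_, ?_, fun α => ?_⟩
  -- Replacing `A` by `2 ρ² l²` in the error turns 26 into 52.
  · have : f ^ 2 * A ≤ f ^ 2 * (2 * (ρ ^ 2 * l ^ 2)) := by gcongr
    linarith
  · refine abs_le_of_sq_le_sq ?_ (by positivity)
    calc T 0 ^ 2 ≤ 2 * f ^ 2 * T 1 ^ 2 := hT0'
      _ ≤ 2 * f ^ 2 * (2 * (ρ ^ 2 * l ^ 2)) := by gcongr; linarith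
      _ ≤ _ := by linarith only [sq_nonneg (f * ρ * l)]
  · refine (h.coord T α).trans ?_
    have := h.one_le
    calc B * nrm L T ≤ B * (2 * (ρ * l)) := by gcongr
      _ = _ := by ring

end point


end

section

variable {d : ℕ}

/-! ### The quadratic estimate at a point -/

lemma abs_bil_le_of_forall {M : Matrix (Fin (d + 2)) (Fin (d + 2)) ℝ} {t : ℝ}
    {X Y : Fin (d + 2) → ℝ} (h : ∀ α β, |M α β| * |X α| * |Y β| ≤ t) :
    |bil M X Y| ≤ (d + 2 : ℝ) ^ 2 * t := by
  rw [bil_eq_sum]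
  refine (Finset.abs_sum_le_sum_abs _ _).trans ?_
  have : ∀ α ∈ Finset.univ, |∑ β, M α β * X α * Y β| ≤ (d + 2 : ℝ) * t := by
    intro α _
    refine (Finset.abs_sum_le_sum_abs _ _).trans ?_
    refine (Finset.sum_le_sum (g := fun _ => t) fun β _ => ?_).trans ?_
    · rw [abs_mul, abs_mul]
      exact h α β
    · simp
  refine (Finset.sum_le_sum this).trans ?_
  simp [sq, mul_assoc]

section point

variable {F : Type*} [NormedAddCommGroup F] [InnerProductSpace ℝ F]
variable {B C K ρ s c f : ℝ} {L : (Fin (d + 2) → ℝ) →ₗ[ℝ] F}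
  {R Q P : Matrix (Fin (d + 2)) (Fin (d + 2)) ℝ}

/-- The components of the form `Q` agree with those of `s P` to leading order. -/
structure DeformBounds (C K ρ s : ℝ) (L : (Fin (d + 2) → ℝ) →ₗ[ℝ] F)
    (Q P : Matrix (Fin (d + 2)) (Fin (d + 2)) ℝ) : Prop where
  nonneg : 0 ≤ C
  K_pos : 0 < K
  zero_zero : |Q 0 0| ≤ C * s
  left : ∀ β, β ≠ 0 → |Q 0 β| ≤ C * ρ
  right : ∀ α, α ≠ 0 → |Q α 0| ≤ C * ρ
  main : ∀ α β, α ≠ 0 → β ≠ 0 → |Q α β - s * P α β| ≤ C * ρ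
  bdd : ∀ α β, α ≠ 0 → β ≠ 0 → |P α β| ≤ C
  pos : ∀ X : Fin (d + 2) → ℝ, X 0 = 0 → K * (X 1 ^ 2 + ‖L X‖ ^ 2) ≤ bil P X X

/-- An entrywise criterion for bounding `Q(X, Y)`. -/
lemma DeformBounds.abs_bil_le (q : DeformBounds C K ρ s L Q P) (hs : 0 ≤ s)
    {X Y : Fin (d + 2) → ℝ} {x₀ x y₀ y t : ℝ} (hX0 : |X 0| ≤ x₀) (hX : ∀ α, α ≠ 0 → |X α| ≤ x)
    (hY0 : |Y 0| ≤ y₀) (hY : ∀ α, α ≠ 0 → |Y α| ≤ y) (hρ : 0 ≤ ρ)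
    (h1 : s * x₀ * y₀ ≤ t) (h2 : ρ * x₀ * y ≤ t) (h3 : ρ * x * y₀ ≤ t)
    (h4 : (s + ρ) * x * y ≤ t) : |bil Q X Y| ≤ (d + 2 : ℝ) ^ 2 * (C * t) := by
  have hC := q.nonneg
  have hx₀ := (abs_nonneg _).trans hX0
  have hx := (abs_nonneg _).trans (hX 1 one_ne_zero')
  have hy₀ := (abs_nonneg _).trans hY0
  have hy := (abs_nonneg _).trans (hY 1 one_ne_zero')
  refine abs_bil_le_of_forall fun α β => ?_
  rcases eq_or_ne α 0 with rfl | hα <;> rcases eq_or_ne β 0 with rfl | hβ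
  · calc _ ≤ C * s * x₀ * y₀ := by gcongr; exact q.zero_zero
      _ = C * (s * x₀ * y₀) := by ring
      _ ≤ _ := by gcongr
  · calc _ ≤ C * ρ * x₀ * y := by gcongr; exacts [q.left β hβ, hY β hβ]
      _ = C * (ρ * x₀ * y) := by ring
      _ ≤ _ := by gcongr
  · calc _ ≤ C * ρ * x * y₀ := by gcongr; exacts [q.right α hα, hX α hα]
      _ = C * (ρ * x * y₀) := by ring
      _ ≤ _ := by gcongr
  · have h5 : |Q α β| ≤ C * (s + ρ) := by
      have h6 := q.main α β hα hβ
      have h7 := abs_sub_abs_le_abs_sub (Q α β) (s * P α β)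
      rw [abs_mul, abs_of_nonneg hs] at h7
      have h8 := mul_le_mul_of_nonneg_left (q.bdd α β hα hβ) hs
      linarith
    calc _ ≤ C * (s + ρ) * x * y := by gcongr; exacts [hX α hα, hY β hβ]
      _ = C * ((s + ρ) * x * y) := by ring
      _ ≤ _ := by gcongr

/-- The lower bound of `Q(X, X)` by the leading part `s P`. -/
lemma DeformBounds.le_bil (q : DeformBounds C K ρ s L Q P)
    {X : Fin (d + 2) → ℝ} {x₀ x t : ℝ} (hX0 : |X 0| ≤ x₀) (hX : ∀ α, α ≠ 0 → |X α| ≤ x)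
    (hs : 0 ≤ s) (hρ : 0 ≤ ρ) (hL : L (Pi.single 0 1) = 0)
    (h1 : s * x₀ * x₀ ≤ t) (h2 : ρ * x₀ * x ≤ t) (h4 : ρ * x * x ≤ t) :
    s * (K * (X 1 ^ 2 + ‖L X‖ ^ 2)) - (d + 2 : ℝ) ^ 2 * (C * t) ≤ bil Q X X := by
  have hC := q.nonneg
  have hx₀ := (abs_nonneg _).trans hX0
  have hx := (abs_nonneg _).trans (hX 1 one_ne_zero')
  -- Positivity of `P` is known only for vectors without `ρ`-component. Deleting its `ρ`-row and
  -- `ρ`-column makes the value at `X` equal to the value at the truncated vector `X'`.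
  set P' : Matrix (Fin (d + 2)) (Fin (d + 2)) ℝ :=
    Matrix.of fun α β => if α = 0 ∨ β = 0 then 0 else P α β with hP'
  set X' : Fin (d + 2) → ℝ := X - X 0 • Pi.single 0 1 with hX'
  have hX'0 : X' 0 = 0 := by simp [hX']
  have hX'α : ∀ α, α ≠ 0 → X' α = X α := fun α hα => by simp [hX', hα]
  have h5 : bil P' X X = bil P X' X' := by
    rw [bil_eq_sum, bil_eq_sum]
    refine Finset.sum_congr rfl fun α _ => Finset.sum_congr rfl fun β _ => ?_
    by_cases hα : α = 0
    · subst hα; simp [hP', hX'0]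
    · by_cases hβ : β = 0
      · subst hβ; simp [hP', hX'0]
      · simp [hP', hX'α, hα, hβ]
  have h6 := q.pos X' hX'0
  have h7 : L X' = L X := by simp [hX', hL]
  rw [hX'α 1 one_ne_zero', h7, ← h5] at h6
  have h8 : |bil (Q - s • P') X X| ≤ (d + 2 : ℝ) ^ 2 * (C * t) := by
    refine abs_bil_le_of_forall fun α β => ?_
    rcases eq_or_ne α 0 with rfl | hα <;> rcases eq_or_ne β 0 with rfl | hβ
    · have h9 : (Q - s • P') 0 0 = Q 0 0 := by simp [hP']
      rw [h9]
      calc _ ≤ C * s * x₀ * x₀ := by gcongr; exact q.zero_zero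
        _ = C * (s * x₀ * x₀) := by ring
        _ ≤ _ := by gcongr
    · have h9 : (Q - s • P') 0 β = Q 0 β := by simp [hP']
      rw [h9]
      calc _ ≤ C * ρ * x₀ * x := by gcongr; exacts [q.left β hβ, hX β hβ]
        _ = C * (ρ * x₀ * x) := by ring
        _ ≤ _ := by gcongr
    · have h9 : (Q - s • P') α 0 = Q α 0 := by simp [hP']
      rw [h9]
      calc _ ≤ C * ρ * x * x₀ := by gcongr; exacts [q.right α hα, hX α hα]
        _ = C * (ρ * x₀ * x) := by ring
        _ ≤ _ := by gcongr
    · have h9 : (Q - s • P') α β = Q α β - s * P α β := by simp [hP', hα, hβ]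
      rw [h9]
      calc _ ≤ C * ρ * x * x := by
            gcongr; exacts [q.main α β hα hβ, hX α hα, hX β hβ]
        _ = C * (ρ * x * x) := by ring
        _ ≤ _ := by gcongr
  have h10 : bil (Q - s • P') X X = bil Q X X - s * bil P' X X := by
    simp [bil, map_sub, map_smul]
  rw [h10] at h8
  have h11 := (abs_le.1 h8).1
  have h12 := mul_le_mul_of_nonneg_left h6 hs
  linarith

variable {E : Fin d → Fin (d + 2) → ℝ} {W N V : Fin (d + 2) → ℝ}

/-- Expansion of a vector in the adapted frame. -/
lemma NearPoint.eq_frame_sum (h : NearPoint B ρ L R) (k : FoliationPoint ρ s c f)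
    (hW : IsGrad ρ s c f L R W)
    (hN : N = (Real.sqrt |bil (pointMetric ρ L R) W W|)⁻¹ • W) (e : IsFrame ρ L R E)
    (hV : V = (Real.sqrt |bil (pointMetric ρ L R) (checkV ρ c f L R E) (checkV ρ c f L R E)|)⁻¹ •
      checkV ρ c f L R E) (v : Fin (d + 2) → ℝ) :
    v = bil (pointMetric ρ L R) v N • N + ((-bil (pointMetric ρ L R) v V) • V +
      ∑ X, bil (pointMetric ρ L R) v (E X) • E X) := by
  set G := bil (pointMetric ρ L R) with hG
  set U := checkV ρ c f L R E with hU
  have hcomm : ∀ X Y, G X Y = G Y X := h.bil_pointMetric_comm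
  have hUU : G U U < 0 := h.checkV_timelike k e
  have hWW : 0 < G W W := by
    have := h.grad_sq_bounds k hW; have := k.f_pos; rw [← hG] at *
    exact lt_of_lt_of_le (by positivity) ‹f ^ 2 / 4 ≤ _›
  -- The coefficients of `(1 - ¾ρ²) ∂_t + c f ∂_ρ` are chosen so that `df̂` annihilates it;
  -- horizontal corrections do not affect this.
  have hWU : G W U = 0 := by
    rw [hG, hW, hU, e.checkV_zero, e.checkV_one]
    ring
  have hWE : ∀ X, G W (E X) = 0 := fun X => by
    rw [hG, hW, e.zero, e.one]; ring
  have hUE : ∀ X, G U (E X) = 0 := fun X => e.bil_checkV X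
  rw [abs_of_pos hWW] at hN
  rw [abs_of_neg hUU] at hV
  have hq : Real.sqrt (G W W) ^ 2 = G W W := Real.sq_sqrt hWW.le
  have hq0 : 0 < Real.sqrt (G W W) := Real.sqrt_pos.2 hWW
  have hr : Real.sqrt (-G U U) ^ 2 = -G U U := Real.sq_sqrt (by linarith)
  have hr0 : 0 < Real.sqrt (-G U U) := Real.sqrt_pos.2 (by linarith)
  set q := Real.sqrt (G W W)
  set r := Real.sqrt (-G U U)
  have hNN : G N N = 1 := by
    rw [hN, map_smul, map_smul, LinearMap.smul_apply, smul_eq_mul, smul_eq_mul, ← hq]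
    field_simp
  have hVV : G V V = -1 := by
    rw [hV, map_smul, map_smul, LinearMap.smul_apply, smul_eq_mul, smul_eq_mul,
      (by linarith : G U U = -r ^ 2)]
    field_simp
  have hNV : G N V = 0 := by
    rw [hV, hN, map_smul, map_smul, LinearMap.smul_apply, hWU, smul_zero, smul_zero]
  have hNE : ∀ X, G N (E X) = 0 := fun X => by
    rw [hN, map_smul, LinearMap.smul_apply, hWE, smul_zero]
  have hVE : ∀ X, G V (E X) = 0 := fun X => by
    rw [hV, map_smul, LinearMap.smul_apply, hUE, smul_zero]
  -- The index type has `d + 2` elements, so the orthogonal family `N`, `V`, `E X` is a basis; only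
  -- `V` has negative sign.
  let b : Option (Option (Fin d)) → Fin (d + 2) → ℝ
    | none => N
    | some none => V
    | some (some X) => E X
  let ε : Option (Option (Fin d)) → ℝ
    | none => 1
    | some none => -1
    | some (some _) => 1
  have h1 := eq_sum_of_orthogonal (G := pointMetric ρ L R) (b := b) (ε := ε) (by simp)
    (by rintro (_ | _ | _) <;> simp [ε])
    (by
      rintro (_ | _ | X) (_ | _ | Y) <;> simp only [b, ε, ← hG] <;>
        simp [hNN, hVV, hNV, hcomm V N, hNE, hVE, hcomm (E _) N, hcomm (E _) V]
      rw [hG, e.orth]) v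
  rw [Fintype.sum_option, Fintype.sum_option] at h1
  simpa [b, ε] using h1

-- In the splitting `v = a N + T`, the leading part of `Q(T, T)` is `s K ρ² l²`, and `s = ρ (1 -
-- ρ²/4) / f` turns it into `K ρ³ / f`. The remaining terms must be `O(ρ³) l²` or `O(f) a²`. This
-- rests on `f s ≤ ρ`: the `ρ`-component of `T` carries a factor `f`, and `Q 0 0` carries a factor
-- `s`.
set_option maxHeartbeats 1000000 in
lemma NearPoint.frame_estimate (h : NearPoint B ρ L R) (k : FoliationPoint ρ s c f)
    (q : DeformBounds C K ρ s L Q P) (hW : IsGrad ρ s c f L R W)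
    (hN : N = (Real.sqrt |bil (pointMetric ρ L R) W W|)⁻¹ • W) (e : IsFrame ρ L R E)
    (hV : V = (Real.sqrt |bil (pointMetric ρ L R) (checkV ρ c f L R E) (checkV ρ c f L R E)|)⁻¹ •
      checkV ρ c f L R E) (v : Fin (d + 2) → ℝ) :
    (K * (ρ ^ 3 / f) - (53 * K + 300 * (d + 2) ^ 2 * C * B ^ 2) * ρ ^ 3) *
        (bil (pointMetric ρ L R) v V ^ 2 + ∑ X, bil (pointMetric ρ L R) v (E X) ^ 2)
      - 300 * (d + 2) ^ 2 * C * B ^ 2 * f * bil (pointMetric ρ L R) v N ^ 2 ≤ bil Q v v := by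
  have hv := h.eq_frame_sum k hW hN e hV v
  set a := bil (pointMetric ρ L R) v N
  set x := bil (pointMetric ρ L R) v V
  set y : Fin d → ℝ := fun X => bil (pointMetric ρ L R) v (E X)
  set T := (-x) • V + ∑ X, y X • E X with hT
  have hv' : v = a • N + T := hv
  have hl0 : 0 ≤ x ^ 2 + ∑ X, y X ^ 2 := by positivity
  set l := Real.sqrt (x ^ 2 + ∑ X, y X ^ 2) with hl
  have hl2 : l ^ 2 = x ^ 2 + ∑ X, y X ^ 2 := Real.sq_sqrt hl0
  have hlnn : 0 ≤ l := Real.sqrt_nonneg _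
  obtain ⟨hT1, hT0, hTα⟩ := h.tangent_bounds k e hV (-x) y hT hlnn (by rw [hl2, neg_sq])
  obtain ⟨hN0, hNα⟩ := h.normal_bounds k hW hN
  have hB := h.one_le
  have hB2 : B ≤ B ^ 2 := by nlinarith only [hB]
  have hB1 : 1 ≤ B ^ 2 := by nlinarith only [hB]
  have hB0 : 0 ≤ B := by linarith only [hB]
  have hρ := h.ρ_pos
  have hs := k.s_pos
  have hs1 := k.s_le
  have hf := k.f_pos
  have hf8 := k.f_le
  have hfs := k.fs_le hρ
  have hρ4 := h.ρ_le
  have hρf := k.ρ_le_f hρ hρ4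
  have hC := q.nonneg
  have hK := q.K_pos
  set D : ℝ := (d + 2 : ℝ) ^ 2 with hD
  have hD0 : 0 ≤ D := by positivity
  have hsf : (s + ρ) * f ≤ 2 * ρ := by
    have : ρ * f ≤ ρ * 1 := by gcongr; linarith only [hf8]
    linarith only [this, hfs]
  -- the three types of terms
  have hNN : |bil Q N N| ≤ D * (C * (128 * B ^ 2 * f)) := by
    refine q.abs_bil_le hs.le hN0 hNα hN0 hNα hρ.le ?_ ?_ ?_ ?_
    · calc s * (4 * ρ) * (4 * ρ) ≤ 1 * (4 * (1 / 4)) * (4 * (2 * f)) := by gcongr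
        _ = 8 * 1 * f := by ring
        _ ≤ 128 * B ^ 2 * f := by gcongr; norm_num
    · calc ρ * (4 * ρ) * (8 * B * (ρ * f)) = 32 * B * (ρ ^ 3 * f) := by ring
        _ ≤ 128 * B ^ 2 * (1 * f) := by
          gcongr
          · norm_num
          · exact pow_le_one₀ hρ.le (by linarith only [hρ4])
        _ = _ := by ring
    · calc ρ * (8 * B * (ρ * f)) * (4 * ρ) = 32 * B * (ρ ^ 3 * f) := by ring
        _ ≤ 128 * B ^ 2 * (1 * f) := by
          gcongr
          · norm_num
          · exact pow_le_one₀ hρ.le (by linarith only [hρ4])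
        _ = _ := by ring
    · calc (s + ρ) * (8 * B * (ρ * f)) * (8 * B * (ρ * f))
          = 64 * B ^ 2 * (((s + ρ) * f) * ρ ^ 2 * f) := by ring
        _ ≤ 64 * B ^ 2 * ((2 * ρ) * ρ ^ 2 * f) := by gcongr
        _ = 128 * B ^ 2 * (ρ ^ 3 * f) := by ring
        _ ≤ 128 * B ^ 2 * (1 * f) := by
          gcongr
          exact pow_le_one₀ hρ.le (by linarith only [hρ4])
        _ = _ := by ring
  -- One inequality for each kind of index pair in `Q(N, T)`; exchanging the two middle ones serves
  -- `Q(T, N)`.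
  have hmix : s * (4 * ρ) * (4 * (f * ρ * l)) ≤ 32 * B ^ 2 * (ρ ^ 3 * l) ∧
      ρ * (4 * ρ) * (2 * B * (ρ * l)) ≤ 32 * B ^ 2 * (ρ ^ 3 * l) ∧
      ρ * (8 * B * (ρ * f)) * (4 * (f * ρ * l)) ≤ 32 * B ^ 2 * (ρ ^ 3 * l) ∧
      (s + ρ) * (8 * B * (ρ * f)) * (2 * B * (ρ * l)) ≤ 32 * B ^ 2 * (ρ ^ 3 * l) := by
    refine ⟨?_, ?_, ?_, ?_⟩
    · calc s * (4 * ρ) * (4 * (f * ρ * l)) = 16 * 1 * (f * s * ρ ^ 2 * l) := by ring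
        _ ≤ 32 * B ^ 2 * (ρ * ρ ^ 2 * l) := by gcongr; norm_num
        _ = _ := by ring
    · calc ρ * (4 * ρ) * (2 * B * (ρ * l)) = 8 * B * (ρ ^ 3 * l) := by ring
        _ ≤ _ := by gcongr; norm_num
    · calc ρ * (8 * B * (ρ * f)) * (4 * (f * ρ * l)) = 32 * B * (ρ ^ 3 * l * f ^ 2) := by ring
        _ ≤ 32 * B ^ 2 * (ρ ^ 3 * l * 1) := by
          gcongr; exact pow_le_one₀ hf.le (by linarith only [hf8])
        _ = _ := by ring
    · calc (s + ρ) * (8 * B * (ρ * f)) * (2 * B * (ρ * l))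
          = 16 * B ^ 2 * ((s + ρ) * f * (ρ ^ 2 * l)) := by ring
        _ ≤ 16 * B ^ 2 * (2 * ρ * (ρ ^ 2 * l)) := by gcongr
        _ = _ := by ring
  have hNT : |bil Q N T| ≤ D * (C * (32 * B ^ 2 * (ρ ^ 3 * l))) :=
    q.abs_bil_le hs.le hN0 hNα hT0 (fun α _ => hTα α) hρ.le hmix.1 hmix.2.1 hmix.2.2.1 hmix.2.2.2
  have hTN : |bil Q T N| ≤ D * (C * (32 * B ^ 2 * (ρ ^ 3 * l))) :=
    q.abs_bil_le hs.le hT0 (fun α _ => hTα α) hN0 hNα hρ.le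
      (by linarith only [hmix.1]) (by linarith only [hmix.2.2.1])
      (by linarith only [hmix.2.1]) (by linarith only [hmix.2.2.2])
  have hTT : s * (K * (T 1 ^ 2 + ‖L T‖ ^ 2)) - D * (C * (16 * B ^ 2 * (ρ ^ 3 * l ^ 2)))
      ≤ bil Q T T := by
    refine q.le_bil hT0 (fun α _ => hTα α) hs.le hρ.le h.map_zero ?_ ?_ ?_
    · calc s * (4 * (f * ρ * l)) * (4 * (f * ρ * l)) = 16 * 1 * (f * s * (f * (ρ ^ 2 * l ^ 2))) := by
            ring
        _ ≤ 16 * B ^ 2 * (ρ * (1 * (ρ ^ 2 * l ^ 2))) := by gcongr; linarith only [hf8]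
        _ = _ := by ring
    · calc ρ * (4 * (f * ρ * l)) * (2 * B * (ρ * l)) = 8 * B * (f * (ρ ^ 3 * l ^ 2)) := by ring
        _ ≤ 16 * B ^ 2 * (1 * (ρ ^ 3 * l ^ 2)) := by
          gcongr
          · norm_num
          · linarith only [hf8]
        _ = _ := by ring
    · calc ρ * (2 * B * (ρ * l)) * (2 * B * (ρ * l)) = 4 * B ^ 2 * (ρ ^ 3 * l ^ 2) := by ring
        _ ≤ _ := by gcongr; norm_num
  have hlead : K * (ρ ^ 3 / f) * l ^ 2 - 53 * K * ρ ^ 3 * l ^ 2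
      ≤ s * (K * (T 1 ^ 2 + ‖L T‖ ^ 2)) := by
    have h1 : s = ρ * (1 - ρ ^ 2 / 4) / f := by rw [← k.f_mul]; field_simp
    have h2 : s * (K * (ρ ^ 2 * l ^ 2 * (1 - 52 * f ^ 2))) ≤ s * (K * (T 1 ^ 2 + ‖L T‖ ^ 2)) := by
      gcongr
    refine le_trans ?_ h2
    have h3 : s * (K * (ρ ^ 2 * l ^ 2 * (1 - 52 * f ^ 2)))
        = K * (ρ ^ 3 / f) * l ^ 2 * ((1 - ρ ^ 2 / 4) * (1 - 52 * f ^ 2)) := by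
      rw [h1]; field_simp
    have h4 : 53 * K * ρ ^ 3 * l ^ 2 = K * (ρ ^ 3 / f) * l ^ 2 * (53 * f) := by field_simp
    -- The factor from `s` loses `ρ²/4 ≤ f²` and the length comparison loses `52 f²`; together these
    -- are at most `53 f² ≤ 53 f`.
    have h5 : 1 - 53 * f ≤ (1 - ρ ^ 2 / 4) * (1 - 52 * f ^ 2) := by
      have h6 := k.ρ_sq_le hρ hρ4
      have h7 : f ^ 2 ≤ f := by nlinarith only [hf, hf8]
      have h8 : 0 ≤ ρ ^ 2 * f ^ 2 := by positivity
      linarith only [h6, h7, h8]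
    rw [h3, h4]
    have h9 : 0 ≤ K * (ρ ^ 3 / f) * l ^ 2 := by positivity
    have h10 := mul_le_mul_of_nonneg_left h5 h9
    linarith only [h10]
  have hsum : bil Q v v = a ^ 2 * bil Q N N + a * bil Q N T + a * bil Q T N + bil Q T T := by
    rw [hv']
    simp only [map_add, map_smul, LinearMap.add_apply, LinearMap.smul_apply, smul_eq_mul]
    ring
  set M := D * C * B ^ 2 with hM
  have hM0 : 0 ≤ M := by positivity
  -- Young's inequality: the `l²` half remains `O(ρ³)`, and `ρ³ ≤ 2 f` moves the `a²` half into the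
  -- normal error.
  have hcross : ∀ w : ℝ, |w| ≤ D * (C * (32 * B ^ 2 * (ρ ^ 3 * l))) →
      -(16 * M * (ρ ^ 3 * l ^ 2)) - 32 * M * f * a ^ 2 ≤ a * w := by
    intro w hw
    have h1 : |a * w| ≤ |a| * (32 * M * (ρ ^ 3 * l)) := by
      rw [abs_mul]
      calc |a| * |w| ≤ |a| * (D * (C * (32 * B ^ 2 * (ρ ^ 3 * l)))) := by gcongr
        _ = _ := by rw [hM]; ring
    have h2 : 2 * (|a| * l) ≤ a ^ 2 + l ^ 2 := by
      have := sq_nonneg (|a| - l)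
      have h3 := sq_abs a
      linarith only [this, h3]
    have h4 : ρ ^ 3 ≤ 2 * f := by
      calc ρ ^ 3 = ρ * ρ ^ 2 := by ring
        _ ≤ ρ * 1 := by gcongr; exact pow_le_one₀ hρ.le (by linarith only [hρ4])
        _ ≤ 2 * f := by linarith only [hρf]
    have h5 : 16 * M * ρ ^ 3 * (2 * (|a| * l)) ≤ 16 * M * ρ ^ 3 * (a ^ 2 + l ^ 2) := by gcongr
    have h6 : 16 * M * ρ ^ 3 * a ^ 2 ≤ 16 * M * (2 * f) * a ^ 2 := by gcongr
    have h7 := neg_abs_le (a * w)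
    linarith only [h1, h5, h6, h7]
  have h1 := hcross _ hNT
  have h2 := hcross _ hTN
  have h3 : -(128 * M * f * a ^ 2) ≤ a ^ 2 * bil Q N N := by
    have h4 := mul_le_mul_of_nonneg_left (neg_le_of_abs_le hNN) (sq_nonneg a)
    have h5 : a ^ 2 * -(D * (C * (128 * B ^ 2 * f))) = -(128 * M * f * a ^ 2) := by
      rw [hM]; ring
    linarith only [h4, h5]
  have h4 : D * (C * (16 * B ^ 2 * (ρ ^ 3 * l ^ 2))) = 16 * M * (ρ ^ 3 * l ^ 2) := by
    rw [hM]; ring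
  rw [h4] at hTT
  have h5 : 300 * (↑d + 2) ^ 2 * C * B ^ 2 = 300 * M := by rw [hM, hD]; ring
  rw [h5, ← hl2, hsum]
  have h6 : 0 ≤ M * (ρ ^ 3 * l ^ 2) := by positivity
  have h7 : 0 ≤ M * f * a ^ 2 := by positivity
  linarith only [h1, h2, h3, hTT, hlead, h6, h7]

end point


end

section

variable {d : ℕ}

/-! ### The leading part of the deformation tensor at a point -/

/-- Bounds for the coordinate components of the round metric `Γ`, of the remainder `r`, and of their
derivatives at a point at height `ρ`. -/
structure JetBounds (B ρ : ℝ) (Γ r b : Matrix (Fin (d + 2)) (Fin (d + 2)) ℝ)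
    (dΓ dr : Fin (d + 2) → Matrix (Fin (d + 2)) (Fin (d + 2)) ℝ) : Prop where
  Γ_le : ∀ α β, |Γ α β| ≤ B
  r_le : ∀ α β, |r α β| ≤ B
  dΓ_le : ∀ μ α β, |dΓ μ α β| ≤ B
  dr_le : ∀ μ α β, |dr μ α β| ≤ B
  b_le : ∀ α β, α ≠ 0 → β ≠ 0 → |r α β - b α β| ≤ B * ρ
  Γ_symm : ∀ α β, Γ α β = Γ β α
  r_symm : ∀ α β, r α β = r β α
  dΓ_symm : ∀ μ α β, dΓ μ α β = dΓ μ β α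
  dr_symm : ∀ μ α β, dr μ α β = dr μ β α
  Γ_zero : ∀ β, Γ 0 β = 0
  r_zero : ∀ β, r 0 β = 0
  dΓ_zero : ∀ μ β, dΓ μ 0 β = 0
  Γ_one : ∀ β, Γ 1 β = 0
  dΓ_one : ∀ μ β, dΓ μ 1 β = 0
  dr_zero : ∀ μ β, dr μ 0 β = 0
  d_zero : ∀ α β, dΓ 0 α β = 0
  d_one : ∀ α β, dΓ 1 α β = 0

/-- The derivatives of the rescaled metric. -/
def dRescaled (ρ : ℝ) (Γ r : Matrix (Fin (d + 2)) (Fin (d + 2)) ℝ)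
    (dΓ dr : Fin (d + 2) → Matrix (Fin (d + 2)) (Fin (d + 2)) ℝ) (μ α β : Fin (d + 2)) : ℝ :=
  (if μ = 0 then -ρ * dt2 d α β - ρ * Γ α β + 3 * ρ ^ 2 * r α β else 0)
    + (1 - ρ ^ 2 / 2) * dΓ μ α β + ρ ^ 3 * dr μ α β

/-- The first derivatives of `u = s / (ρ (1 - ρ²/4))`. -/
def du (ρ s c : ℝ) (α : Fin (d + 2)) : ℝ :=
  if α = 0 then -(s * (1 - 3 / 4 * ρ ^ 2) * (ρ * (1 - ρ ^ 2 / 4))⁻¹ ^ 2)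
  else if α = 1 then c * (ρ * (1 - ρ ^ 2 / 4))⁻¹ else 0

/-- The second derivatives of `u = s / (ρ (1 - ρ²/4))`. -/
def ddu (ρ s c : ℝ) (α β : Fin (d + 2)) : ℝ :=
  if β = 0 then
    if α = 0 then s * (3 / 2 * ρ * (ρ * (1 - ρ ^ 2 / 4))⁻¹ ^ 2
      + 2 * (1 - 3 / 4 * ρ ^ 2) ^ 2 * (ρ * (1 - ρ ^ 2 / 4))⁻¹ ^ 3)
    else if α = 1 then -(c * (1 - 3 / 4 * ρ ^ 2) * (ρ * (1 - ρ ^ 2 / 4))⁻¹ ^ 2) else 0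
  else if β = 1 then
    if α = 0 then -(c * (1 - 3 / 4 * ρ ^ 2) * (ρ * (1 - ρ ^ 2 / 4))⁻¹ ^ 2)
    else if α = 1 then -(s * (ρ * (1 - ρ ^ 2 / 4))⁻¹) else 0
  else 0

/-- The contraction of the Christoffel symbols of the rescaled metric with the vector `w`, without the
factor `1/2`. -/
def dualSum (ρ : ℝ) (w : Fin (d + 2) → ℝ) (Γ r : Matrix (Fin (d + 2)) (Fin (d + 2)) ℝ)
    (dΓ dr : Fin (d + 2) → Matrix (Fin (d + 2)) (Fin (d + 2)) ℝ) (α β : Fin (d + 2)) : ℝ :=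
  ∑ δ, w δ * (dRescaled ρ Γ r dΓ dr α δ β + dRescaled ρ Γ r dΓ dr β δ α
    - dRescaled ρ Γ r dΓ dr δ α β)

/-- The components of `∇²u - u (1 + ρ³ ζ) g`. -/
def hessQ (ρ s c ζ : ℝ) (w : Fin (d + 2) → ℝ) (Γ r : Matrix (Fin (d + 2)) (Fin (d + 2)) ℝ)
    (dΓ dr : Fin (d + 2) → Matrix (Fin (d + 2)) (Fin (d + 2)) ℝ) :
    Matrix (Fin (d + 2)) (Fin (d + 2)) ℝ := fun α β =>
  ddu ρ s c α β + ρ⁻¹ * ((if α = 0 then du ρ s c β else 0) + (if β = 0 then du ρ s c α else 0))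
    - ρ⁻¹ * du ρ s c (0 : Fin (d + 2)) * rescaled ρ Γ r α β
    + 1 / 2 * du ρ s c (0 : Fin (d + 2)) * dRescaled ρ Γ r dΓ dr 0 α β
    - 1 / 2 * du ρ s c (1 : Fin (d + 2)) * dualSum ρ w Γ r dΓ dr α β
    - s * (ρ * (1 - ρ ^ 2 / 4))⁻¹ * (ρ ^ 2)⁻¹ * (1 + ρ ^ 3 * ζ) * rescaled ρ Γ r α β

variable {B Z ρ s c ζ κ : ℝ} {w : Fin (d + 2) → ℝ}
  {Γ r b : Matrix (Fin (d + 2)) (Fin (d + 2)) ℝ}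
  {dΓ dr : Fin (d + 2) → Matrix (Fin (d + 2)) (Fin (d + 2)) ℝ}

lemma dt2_apply (α β : Fin (d + 2)) : dt2 d α β = if α = 1 ∧ β = 1 then 1 else 0 := by
  simp [dt2, Matrix.single_apply, eq_comm]

lemma dρ2_apply (α β : Fin (d + 2)) : dρ2 d α β = if α = 0 ∧ β = 0 then 1 else 0 := by
  simp [dρ2, Matrix.single_apply, eq_comm]

lemma rescaled_apply (α β : Fin (d + 2)) : rescaled ρ Γ r α β =
    dρ2 d α β - (1 + ρ ^ 2 / 2) * dt2 d α β + (1 - ρ ^ 2 / 2) * Γ α β + ρ ^ 3 * r α β := by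
  simp [rescaled]

lemma abs_sum_le_card {t : ℝ} {v : Fin (d + 2) → ℝ} (h : ∀ δ, |v δ| ≤ t) :
    |∑ δ, v δ| ≤ (d + 2 : ℝ) * t := by
  refine (Finset.abs_sum_le_sum_abs _ _).trans ?_
  refine (Finset.sum_le_sum fun δ _ => h δ).trans ?_
  simp

/-! ### Component estimates for the Hessian of `u`: the cancellations against the model space. -/

namespace JetBounds

lemma dRescaled_symm (j : JetBounds B ρ Γ r b dΓ dr) (μ α β : Fin (d + 2)) :
    dRescaled ρ Γ r dΓ dr μ α β = dRescaled ρ Γ r dΓ dr μ β α := by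
  simp only [dRescaled, dt2_apply, j.Γ_symm α β, j.r_symm α β, j.dΓ_symm μ α β, j.dr_symm μ α β,
    and_comm]

lemma dRescaled_zero (j : JetBounds B ρ Γ r b dΓ dr) (μ β : Fin (d + 2)) :
    dRescaled ρ Γ r dΓ dr μ 0 β = 0 := by
  simp [dRescaled, dt2_apply, j.Γ_zero, j.r_zero, j.dΓ_zero, j.dr_zero]

lemma dRescaled_zero' (j : JetBounds B ρ Γ r b dΓ dr) (μ β : Fin (d + 2)) :
    dRescaled ρ Γ r dΓ dr μ β 0 = 0 := by
  rw [j.dRescaled_symm, j.dRescaled_zero]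

lemma abs_dt2_le (α β : Fin (d + 2)) : |dt2 d α β| ≤ 1 := by
  rw [dt2_apply]; split_ifs <;> simp

lemma abs_dRescaled_le (j : JetBounds B ρ Γ r b dΓ dr) (hB : 1 ≤ B) (hρ : 0 < ρ) (hρ' : ρ ≤ 1 / 4)
    (μ α β : Fin (d + 2)) : |dRescaled ρ Γ r dΓ dr μ α β| ≤ 5 * B := by
  have h1 := abs_dt2_le α β
  have h2 := j.Γ_le α β
  have h3 := j.r_le α β
  have h4 := j.dΓ_le μ α β
  have h5 := j.dr_le μ α β
  have h6 : ρ ^ 2 ≤ 1 / 16 := by nlinarith only [hρ, hρ']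
  have h7 : ρ ^ 3 ≤ 1 / 16 := by nlinarith only [hρ, hρ', h6]
  have h8 : |(1 - ρ ^ 2 / 2) * dΓ μ α β| ≤ 1 * B := by
    rw [abs_mul, abs_of_nonneg (by linarith : 0 ≤ 1 - ρ ^ 2 / 2)]
    gcongr
    linarith only [sq_nonneg ρ]
  have h9 : |ρ ^ 3 * dr μ α β| ≤ 1 / 16 * B := by
    rw [abs_mul, abs_of_nonneg (by positivity : 0 ≤ ρ ^ 3)]
    gcongr
  have h10 : |(if μ = 0 then -ρ * dt2 d α β - ρ * Γ α β + 3 * ρ ^ 2 * r α β else 0)| ≤ 3 * B := by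
    split_ifs
    · have h11 : |ρ * dt2 d α β| ≤ 1 / 4 * 1 := by
        rw [abs_mul, abs_of_pos hρ]; gcongr
      have h12 : |ρ * Γ α β| ≤ 1 / 4 * B := by
        rw [abs_mul, abs_of_pos hρ]; gcongr
      have h13 : |3 * ρ ^ 2 * r α β| ≤ 3 * (1 / 16) * B := by
        rw [abs_mul, abs_of_nonneg (by positivity : 0 ≤ 3 * ρ ^ 2)]; gcongr
      rw [abs_le] at *
      constructor <;> linarith
    · simp; linarith
  unfold dRescaled
  rw [abs_le] at *
  constructor <;> linarith

/-- Contraction with the dual vector of `dt`. -/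
lemma sum_dual (hw : ∀ δ, |w δ + (if δ = 1 then κ else 0)| ≤ 2 * B ^ 2 * ρ ^ 3)
    {v : Fin (d + 2) → ℝ} {t : ℝ} (hv : ∀ δ, |v δ| ≤ t) :
    |∑ δ, w δ * v δ + κ * v 1| ≤ (d + 2 : ℝ) * (2 * B ^ 2 * ρ ^ 3 * t) := by
  have h1 : ∑ δ, w δ * v δ + κ * v 1 = ∑ δ, (w δ + (if δ = 1 then κ else 0)) * v δ := by
    simp [add_mul, Finset.sum_add_distrib]
  rw [h1]
  refine abs_sum_le_card fun δ => ?_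
  rw [abs_mul]
  exact mul_le_mul (hw δ) (hv δ) (abs_nonneg _) ((abs_nonneg _).trans (hw δ))

lemma dualSum_zero_zero (j : JetBounds B ρ Γ r b dΓ dr) : dualSum ρ w Γ r dΓ dr 0 0 = 0 :=
  Finset.sum_eq_zero fun δ _ => by simp [j.dRescaled_zero, j.dRescaled_zero']

lemma dualSum_zero (j : JetBounds B ρ Γ r b dΓ dr) (β : Fin (d + 2)) :
    dualSum ρ w Γ r dΓ dr 0 β = ∑ δ, w δ * dRescaled ρ Γ r dΓ dr 0 δ β :=
  Finset.sum_congr rfl fun δ _ => by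
    rw [j.dRescaled_zero' β δ, j.dRescaled_zero δ β]; ring

lemma dualSum_symm (j : JetBounds B ρ Γ r b dΓ dr) (α β : Fin (d + 2)) :
    dualSum ρ w Γ r dΓ dr α β = dualSum ρ w Γ r dΓ dr β α :=
  Finset.sum_congr rfl fun δ _ => by
    rw [j.dRescaled_symm δ α β]; ring

lemma rescaled_symm (j : JetBounds B ρ Γ r b dΓ dr) (α β : Fin (d + 2)) :
    rescaled ρ Γ r α β = rescaled ρ Γ r β α := by
  simp only [rescaled_apply, dρ2_apply, dt2_apply, j.Γ_symm α β, j.r_symm α β, and_comm]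

lemma ddu_symm (α β : Fin (d + 2)) : ddu ρ s c α β = ddu ρ s c β α := by
  unfold ddu
  by_cases hα : α = 0 <;> by_cases hβ : β = 0 <;> by_cases hα1 : α = 1 <;>
    by_cases hβ1 : β = 1 <;> simp [hα, hβ, hα1, hβ1]

lemma hessQ_symm (j : JetBounds B ρ Γ r b dΓ dr) (α β : Fin (d + 2)) :
    hessQ ρ s c ζ w Γ r dΓ dr α β = hessQ ρ s c ζ w Γ r dΓ dr β α := by
  rw [hessQ, hessQ, j.rescaled_symm α β, j.dualSum_symm α β, j.dRescaled_symm 0 α β,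
    ddu_symm α β, add_comm (if α = 0 then du ρ s c β else 0)]

/-- In the Fefferman-Graham gauge neither `Γ` nor `r` enters this component, and the negative powers
of `ρ` cancel. The overall factor `s` is essential for the frame estimate. -/
lemma hessQ_zero_zero (j : JetBounds B ρ Γ r b dΓ dr) (hρ : 0 < ρ) (hρ' : ρ ≤ 1 / 4) :
    hessQ ρ s c ζ w Γ r dΓ dr 0 0 =
      s * (ρ / 2 * (1 - ρ ^ 2 / 4)⁻¹ ^ 3 - ζ * (1 - ρ ^ 2 / 4)⁻¹) := by
  have hm : 4 - ρ ^ 2 ≠ 0 := by nlinarith only [hρ, hρ']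
  simp only [hessQ, j.dualSum_zero_zero, j.dRescaled_zero, rescaled_apply, dρ2_apply, dt2_apply,
    j.Γ_zero, j.r_zero, du, ddu, if_true, and_self, if_neg (one_ne_zero' (d := d)).symm]
  field_simp
  ring

/-- For `β = t` the `ρ⁻²` poles of `∂_ρ ∂_t u` and `ρ⁻¹ ∂_t u` cancel. They leave a term of order
one, `c / 2` to leading order, which cancels against the contraction of `w ≈ -κ ∂_t` with the model
derivative `-ρ` of the `tt`-component. -/
lemma abs_hessQ_left (j : JetBounds B ρ Γ r b dΓ dr) (hB : 1 ≤ B) (hρ : 0 < ρ) (hρ' : ρ ≤ 1 / 4)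
    (hc : |c| ≤ 1)
    (hw : ∀ δ, |w δ + (if δ = 1 then (1 + ρ ^ 2 / 2)⁻¹ else 0)| ≤ 2 * B ^ 2 * ρ ^ 3)
    (β : Fin (d + 2)) (hβ : β ≠ 0) :
    |hessQ ρ s c ζ w Γ r dΓ dr 0 β| ≤ 20 * (d + 2) * B ^ 3 * ρ := by
  have hm4 : 4 - ρ ^ 2 ≠ 0 := by nlinarith only [hρ, hρ']
  have hρ2 : ρ ^ 2 ≤ 1 / 16 := by nlinarith only [hρ, hρ']
  have hm0 : 63 / 64 ≤ 1 - ρ ^ 2 / 4 := by linarith only [hρ2]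
  have hκ0 : 0 < (1 + ρ ^ 2 / 2)⁻¹ := by positivity
  have hκ1 : (1 + ρ ^ 2 / 2)⁻¹ ≤ 1 := inv_le_one_of_one_le₀ (by linarith only [sq_nonneg ρ])
  set S := ∑ δ, w δ * dRescaled ρ Γ r dΓ dr 0 δ β with hS
  have h1 : hessQ ρ s c ζ w Γ r dΓ dr 0 β =
      (if β = 1 then c * (3 / 8 * ρ ^ 2 * (1 + ρ ^ 2 / 2)⁻¹ * (1 - ρ ^ 2 / 4)⁻¹ ^ 2) else 0)
      - 1 / 2 * c * (ρ * (1 - ρ ^ 2 / 4))⁻¹ *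
        (S + (1 + ρ ^ 2 / 2)⁻¹ * (if β = 1 then -ρ else 0)) := by
    simp only [hessQ, j.dualSum_zero, ← hS, j.dRescaled_zero, rescaled_apply, dρ2_apply, dt2_apply,
      j.Γ_zero, j.r_zero, hβ, ddu, du, if_true, and_false, (one_ne_zero' (d := d)).symm,
      one_ne_zero', if_false, false_and]
    by_cases hβ1 : β = 1
    · simp only [hβ1, if_true]
      field_simp
      ring
    · simp only [hβ1, if_false]
      ring
  set m := 1 - ρ ^ 2 / 4
  have hmpos : 0 < m := by linarith only [hm0]
  set κ := (1 + ρ ^ 2 / 2)⁻¹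
  have h3 := sum_dual hw (fun δ => j.abs_dRescaled_le hB hρ hρ' 0 δ β)
  rw [← hS] at h3
  have h4 : |dRescaled ρ Γ r dΓ dr 0 1 β - (if β = 1 then -ρ else 0)| ≤ 5 * B * ρ ^ 2 := by
    have h5 : dRescaled ρ Γ r dΓ dr 0 1 β - (if β = 1 then -ρ else 0)
        = 3 * ρ ^ 2 * r 1 β + ρ ^ 3 * dr 0 1 β := by
      simp only [dRescaled, dt2_apply, j.dΓ_one, j.Γ_one, if_true, true_and]
      split_ifs <;> ring
    have h6 : |3 * ρ ^ 2 * r 1 β| ≤ 3 * ρ ^ 2 * B := by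
      rw [abs_mul, abs_of_nonneg (by positivity : 0 ≤ 3 * ρ ^ 2)]
      gcongr; exact j.r_le _ _
    have h7 : |ρ ^ 3 * dr 0 1 β| ≤ 1 / 4 * ρ ^ 2 * B := by
      rw [abs_mul, abs_of_nonneg (by positivity : 0 ≤ ρ ^ 3)]
      calc ρ ^ 3 * |dr 0 1 β| ≤ ρ ^ 3 * B := by gcongr; exact j.dr_le _ _ _
        _ = ρ * ρ ^ 2 * B := by ring
        _ ≤ _ := by gcongr
    rw [h5]
    have h8 : 0 ≤ ρ ^ 2 * B := by positivity
    exact (abs_add_le _ _).trans (by linarith only [h6, h7, h8])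
  have h9 : |S + κ * (if β = 1 then -ρ else 0)| ≤ 10 * (d + 2) * B ^ 3 * ρ ^ 3 + 5 * B * ρ ^ 2 := by
    have h10 : S + κ * (if β = 1 then -ρ else 0) = (S + κ * dRescaled ρ Γ r dΓ dr 0 1 β)
        - κ * (dRescaled ρ Γ r dΓ dr 0 1 β - (if β = 1 then -ρ else 0)) := by ring
    rw [h10]
    refine (abs_sub _ _).trans ?_
    rw [abs_mul, abs_of_pos hκ0]
    refine add_le_add (h3.trans (le_of_eq (by ring))) ?_
    calc _ ≤ 1 * (5 * B * ρ ^ 2) := by gcongr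
      _ = _ := by ring
  have hm1 : m⁻¹ ≤ 64 / 63 := by
    rw [inv_le_comm₀ hmpos (by norm_num)]; linarith only [hm0]
  have h11 : |(if β = 1 then c * (3 / 8 * ρ ^ 2 * κ * m⁻¹ ^ 2) else 0)| ≤ ρ := by
    split_ifs
    · rw [abs_mul, abs_of_nonneg (by positivity : 0 ≤ 3 / 8 * ρ ^ 2 * κ * m⁻¹ ^ 2)]
      calc |c| * (3 / 8 * ρ ^ 2 * κ * m⁻¹ ^ 2)
          ≤ 1 * (3 / 8 * (ρ * (1 / 4)) * 1 * (64 / 63) ^ 2) := by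
            rw [sq ρ]; gcongr
        _ ≤ ρ := by linarith only [hρ]
    · simp [hρ.le]
  have h12 : |1 / 2 * c * (ρ * m)⁻¹ * (S + κ * (if β = 1 then -ρ else 0))|
      ≤ (10 * (d + 2) * B ^ 3 * ρ ^ 3 + 5 * B * ρ ^ 2) / ρ := by
    rw [abs_mul, abs_mul, abs_mul, mul_inv, abs_mul, abs_of_pos (inv_pos.2 hρ),
      abs_of_pos (inv_pos.2 hmpos), abs_of_pos (by norm_num : (0 : ℝ) < 1 / 2)]
    calc 1 / 2 * |c| * (ρ⁻¹ * m⁻¹) * |S + κ * (if β = 1 then -ρ else 0)|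
        ≤ 1 / 2 * 1 * (ρ⁻¹ * 2) * (10 * (d + 2) * B ^ 3 * ρ ^ 3 + 5 * B * ρ ^ 2) := by
          gcongr; linarith only [hm1]
      _ = _ := by field_simp
  have h13 : (10 * (d + 2) * B ^ 3 * ρ ^ 3 + 5 * B * ρ ^ 2) / ρ
      = 10 * (d + 2) * B ^ 3 * ρ * ρ + 5 * B * ρ := by field_simp
  rw [h1]
  refine (abs_sub _ _).trans ?_
  rw [h13] at h12
  have hB3 : B ≤ B ^ 3 := le_self_pow₀ hB (by norm_num)
  have hB4 : 1 ≤ B ^ 3 := one_le_pow₀ hB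
  have hd : (2 : ℝ) ≤ d + 2 := by linarith only [(Nat.cast_nonneg d : (0 : ℝ) ≤ d)]
  have h14 : 10 * (d + 2) * B ^ 3 * ρ * ρ ≤ 10 * (d + 2) * B ^ 3 * ρ * (1 / 4) := by gcongr
  have h15 : 5 * B * ρ ≤ 5 / 2 * (d + 2) * B ^ 3 * ρ := by
    have : 5 ≤ 5 / 2 * ((d : ℝ) + 2) := by linarith only [hd]
    calc 5 * B * ρ ≤ 5 / 2 * ((d : ℝ) + 2) * B ^ 3 * ρ := by gcongr
      _ = _ := by ring
  have h16 : ρ ≤ (d + 2) * B ^ 3 * ρ := by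
    calc ρ = 1 * 1 * ρ := by ring
      _ ≤ _ := by gcongr; linarith only [hd]
  have h17 : 0 ≤ (d + 2) * B ^ 3 * ρ := by positivity
  linarith only [h11, h12, h14, h15, h16, h17]

/-- Contraction with `-κ ∂_t` meets only `t`-rows and `t`-derivatives. The round metric has neither,
so just the derivatives of `ρ³ r` survive, and `w + κ ∂_t` is itself `O(ρ³)`. -/
lemma abs_dualSum_le (j : JetBounds B ρ Γ r b dΓ dr) (hB : 1 ≤ B) (hρ : 0 < ρ) (hρ' : ρ ≤ 1 / 4)
    (hw : ∀ δ, |w δ + (if δ = 1 then (1 + ρ ^ 2 / 2)⁻¹ else 0)| ≤ 2 * B ^ 2 * ρ ^ 3)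
    {α β : Fin (d + 2)} (hα : α ≠ 0) (hβ : β ≠ 0) :
    |dualSum ρ w Γ r dΓ dr α β| ≤ 33 * (d + 2) * B ^ 3 * ρ ^ 3 := by
  have hκ0 : 0 < (1 + ρ ^ 2 / 2)⁻¹ := by positivity
  have hκ1 : (1 + ρ ^ 2 / 2)⁻¹ ≤ 1 := inv_le_one_of_one_le₀ (by linarith only [sq_nonneg ρ])
  set κ := (1 + ρ ^ 2 / 2)⁻¹
  have h0 : ∀ a b c : ℝ, |a + b - c| ≤ |a| + |b| + |c| := fun a b c =>
    (abs_sub _ _).trans (add_le_add_left (abs_add_le _ _) _)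
  have h3 := sum_dual (t := 15 * B) hw (v := fun δ => dRescaled ρ Γ r dΓ dr α δ β
    + dRescaled ρ Γ r dΓ dr β δ α - dRescaled ρ Γ r dΓ dr δ α β) fun δ => by
      have h1 := j.abs_dRescaled_le hB hρ hρ' α δ β
      have h2 := j.abs_dRescaled_le hB hρ hρ' β δ α
      have h3 := j.abs_dRescaled_le hB hρ hρ' δ α β
      exact (h0 _ _ _).trans (by linarith only [h1, h2, h3])
  have h4 : |dRescaled ρ Γ r dΓ dr α 1 β + dRescaled ρ Γ r dΓ dr β 1 α
      - dRescaled ρ Γ r dΓ dr 1 α β| ≤ 3 * B * ρ ^ 3 := by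
    have h5 : dRescaled ρ Γ r dΓ dr α 1 β + dRescaled ρ Γ r dΓ dr β 1 α
      - dRescaled ρ Γ r dΓ dr 1 α β = ρ ^ 3 * (dr α 1 β + dr β 1 α - dr 1 α β) := by
      simp only [dRescaled, hα, hβ, one_ne_zero', if_false, j.dΓ_one, j.d_one]
      ring
    rw [h5, abs_mul, abs_of_nonneg (by positivity : 0 ≤ ρ ^ 3)]
    calc _ ≤ ρ ^ 3 * (B + B + B) := by
          gcongr
          exact (h0 _ _ _).trans (add_le_add (add_le_add (j.dr_le _ _ _) (j.dr_le _ _ _))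
            (j.dr_le _ _ _))
      _ = _ := by ring
  have h5 : |κ * (dRescaled ρ Γ r dΓ dr α 1 β + dRescaled ρ Γ r dΓ dr β 1 α
      - dRescaled ρ Γ r dΓ dr 1 α β)| ≤ 1 * (3 * B * ρ ^ 3) := by
    rw [abs_mul, abs_of_pos hκ0]; gcongr
  have h6 : dualSum ρ w Γ r dΓ dr α β = (dualSum ρ w Γ r dΓ dr α β
      + κ * (dRescaled ρ Γ r dΓ dr α 1 β + dRescaled ρ Γ r dΓ dr β 1 α
      - dRescaled ρ Γ r dΓ dr 1 α β)) - κ * (dRescaled ρ Γ r dΓ dr α 1 β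
      + dRescaled ρ Γ r dΓ dr β 1 α - dRescaled ρ Γ r dΓ dr 1 α β) := by ring
  rw [h6]
  refine (abs_sub _ _).trans ((add_le_add h3 h5).trans ?_)
  have hB3 : B ≤ B ^ 3 := le_self_pow₀ hB (by norm_num)
  have hd : (1 : ℝ) ≤ d + 2 := by linarith only [(Nat.cast_nonneg d : (0 : ℝ) ≤ d)]
  have h7 : B * ρ ^ 3 ≤ (d + 2) * B ^ 3 * ρ ^ 3 := by
    calc B * ρ ^ 3 = 1 * B * ρ ^ 3 := by ring
      _ ≤ _ := by gcongr
  linarith only [h7]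

/-- The tangential components of `∇²u - u (1 + ρ³ ζ) g`. -/
lemma hessQ_sub (j : JetBounds B ρ Γ r b dΓ dr) (hρ : 0 < ρ) (hρ' : ρ ≤ 1 / 4)
    {α β : Fin (d + 2)} (hα : α ≠ 0) (hβ : β ≠ 0) :
    hessQ ρ s c ζ w Γ r dΓ dr α β
      - s * (-(3 / 2) * b α β - ζ * (-dt2 d α β + Γ α β)) =
    s * (ρ / 8 * (1 - ρ ^ 2 / 4)⁻¹ ^ 2 * (dt2 d α β - Γ α β) - 3 / 2 * (r α β - b α β)
      + ρ ^ 2 * (3 / 32 * ρ ^ 2 - 1 / 8) * (1 - ρ ^ 2 / 4)⁻¹ ^ 2 * r α β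
      - 1 / 2 * ρ * (1 - 3 / 4 * ρ ^ 2) * (1 - ρ ^ 2 / 4)⁻¹ ^ 2 * dr 0 α β
      + ζ * (1 - ρ ^ 2 / 4)⁻¹ * (3 / 4 * ρ ^ 2 * dt2 d α β + 1 / 4 * ρ ^ 2 * Γ α β
        - ρ ^ 3 * r α β))
      - 1 / 2 * c * (ρ * (1 - ρ ^ 2 / 4))⁻¹ * dualSum ρ w Γ r dΓ dr α β := by
  have hm4 : 4 - ρ ^ 2 ≠ 0 := by nlinarith only [hρ, hρ']
  have h1 : ddu ρ s c α β = -(s * (ρ * (1 - ρ ^ 2 / 4))⁻¹) * dt2 d α β := by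
    simp only [ddu, dt2_apply, hα, hβ, if_false]
    by_cases hα1 : α = 1 <;> by_cases hβ1 : β = 1 <;> simp [hα1, hβ1]
  -- The leading term `-(3/2) s r` is `½ ∂_ρ u · 3 ρ² r` with `∂_ρ u ≈ -s ρ⁻²`, and replacing `r` by
  -- `b` leaves the error `r - b`. The `ζ` term is the leading part of `u ρ³ ζ g`.
  simp only [hessQ, h1, rescaled_apply, dρ2_apply, hα, hβ, dRescaled, j.d_zero, if_false, if_true,
    false_and, du, one_ne_zero']
  field_simp
  ring

/-- Each term of the exact difference in `hessQ_sub` is `O(ρ)`; in the last one the factor `ρ⁻¹` is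
beaten by the cubic bound on `dualSum`. -/
lemma abs_hessQ_sub_le (j : JetBounds B ρ Γ r b dΓ dr) (hB : 1 ≤ B) (hρ : 0 < ρ)
    (hρ' : ρ ≤ 1 / 4) (hs : 0 ≤ s) (hs' : s ≤ 1) (hc : |c| ≤ 1) (hζ : |ζ| ≤ Z)
    (hw : ∀ δ, |w δ + (if δ = 1 then (1 + ρ ^ 2 / 2)⁻¹ else 0)| ≤ 2 * B ^ 2 * ρ ^ 3)
    {α β : Fin (d + 2)} (hα : α ≠ 0) (hβ : β ≠ 0) :
    |hessQ ρ s c ζ w Γ r dΓ dr α β - s * (-(3 / 2) * b α β - ζ * (-dt2 d α β + Γ α β))|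
      ≤ (40 * (d + 2) * B ^ 3 + 4 * Z * B) * ρ := by
  rw [j.hessQ_sub hρ hρ' hα hβ]
  have hD := j.abs_dualSum_le hB hρ hρ' hw hα hβ
  have hρ2 : ρ ^ 2 ≤ 1 / 16 := by nlinarith only [hρ, hρ']
  have hm0 : 63 / 64 ≤ 1 - ρ ^ 2 / 4 := by linarith only [hρ2]
  set m := 1 - ρ ^ 2 / 4
  have hmpos : 0 < m := by linarith only [hm0]
  have hm1 : m⁻¹ ≤ 64 / 63 := by
    rw [inv_le_comm₀ hmpos (by norm_num)]; linarith only [hm0]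
  have hm2 : m⁻¹ ^ 2 ≤ 2 := by
    calc m⁻¹ ^ 2 ≤ (64 / 63) ^ 2 := by gcongr
      _ ≤ 2 := by norm_num
  have hZ : 0 ≤ Z := (abs_nonneg _).trans hζ
  have hB0 : 0 ≤ B := by linarith only [hB]
  have h1 := abs_dt2_le α β
  have h2 := j.Γ_le α β
  have h3 := j.r_le α β
  have h4 := j.dr_le 0 α β
  have e1 : |ρ / 8 * m⁻¹ ^ 2 * (dt2 d α β - Γ α β)| ≤ ρ * B := by
    rw [abs_mul, abs_of_nonneg (by positivity : 0 ≤ ρ / 8 * m⁻¹ ^ 2)]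
    calc _ ≤ ρ / 8 * 2 * (1 + B) := by
          gcongr; exact (abs_sub _ _).trans (add_le_add h1 h2)
      _ ≤ _ := by nlinarith only [hρ, hB]
  have e2 : |3 / 2 * (r α β - b α β)| ≤ 3 / 2 * (B * ρ) := by
    rw [abs_mul, abs_of_pos (by norm_num : (0 : ℝ) < 3 / 2)]
    gcongr; exact j.b_le α β hα hβ
  have e3 : |ρ ^ 2 * (3 / 32 * ρ ^ 2 - 1 / 8) * m⁻¹ ^ 2 * r α β| ≤ ρ * B := by
    rw [abs_mul, abs_mul, abs_mul, abs_of_nonneg (sq_nonneg ρ), abs_of_nonneg (sq_nonneg m⁻¹)]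
    have h5 : |3 / 32 * ρ ^ 2 - 1 / 8| ≤ 1 := by
      rw [abs_le]; constructor <;> linarith only [hρ2, sq_nonneg ρ]
    calc _ ≤ (ρ * (1 / 4)) * 1 * 2 * B := by rw [sq ρ]; gcongr; rwa [sq] at h5
      _ ≤ _ := by nlinarith only [hρ, hB]
  have e4 : |1 / 2 * ρ * (1 - 3 / 4 * ρ ^ 2) * m⁻¹ ^ 2 * dr 0 α β| ≤ ρ * B := by
    rw [abs_mul, abs_of_nonneg (mul_nonneg (mul_nonneg (by positivity)
      (by linarith only [hρ2])) (by positivity) : 0 ≤ 1 / 2 * ρ * (1 - 3 / 4 * ρ ^ 2) * m⁻¹ ^ 2)]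
    calc _ ≤ 1 / 2 * ρ * 1 * 2 * B := by
          gcongr
          linarith only [sq_nonneg ρ]
      _ = _ := by ring
  have e5 : |ζ * m⁻¹ * (3 / 4 * ρ ^ 2 * dt2 d α β + 1 / 4 * ρ ^ 2 * Γ α β - ρ ^ 3 * r α β)|
      ≤ 4 * Z * B * ρ := by
    rw [abs_mul, abs_mul, abs_of_pos (inv_pos.2 hmpos)]
    have h5 : |3 / 4 * ρ ^ 2 * dt2 d α β + 1 / 4 * ρ ^ 2 * Γ α β - ρ ^ 3 * r α β| ≤ 2 * B * ρ := by
      have f1 : |3 / 4 * ρ ^ 2 * dt2 d α β| ≤ 3 / 4 * ρ ^ 2 * 1 := by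
        rw [abs_mul, abs_of_nonneg (by positivity : 0 ≤ 3 / 4 * ρ ^ 2)]; gcongr
      have f2 : |1 / 4 * ρ ^ 2 * Γ α β| ≤ 1 / 4 * ρ ^ 2 * B := by
        rw [abs_mul, abs_of_nonneg (by positivity : 0 ≤ 1 / 4 * ρ ^ 2)]; gcongr
      have f3 : |ρ ^ 3 * r α β| ≤ ρ ^ 3 * B := by
        rw [abs_mul, abs_of_nonneg (by positivity : 0 ≤ ρ ^ 3)]; gcongr
      have f4 : ρ ^ 3 * B ≤ ρ ^ 2 * 1 * B := by
        rw [pow_succ ρ 2]; gcongr; linarith only [hρ']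
      have f5 : ρ ^ 2 * 1 ≤ ρ ^ 2 * B := by gcongr
      have f6 : ρ ^ 2 * B ≤ ρ * (1 / 4) * B := by rw [sq]; gcongr
      have f7 : 0 ≤ ρ * B := by positivity
      refine (abs_sub _ _).trans ((add_le_add_left (abs_add_le _ _) _).trans ?_)
      linarith only [f1, f2, f3, f4, f5, f6, f7]
    calc _ ≤ Z * 2 * (2 * B * ρ) := by gcongr; linarith only [hm1]
      _ = _ := by ring
  have e6 : |1 / 2 * c * (ρ * m)⁻¹ * dualSum ρ w Γ r dΓ dr α β| ≤ 33 * (d + 2) * B ^ 3 * ρ := by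
    rw [abs_mul, abs_mul, abs_mul, mul_inv, abs_mul, abs_of_pos (inv_pos.2 hρ),
      abs_of_pos (inv_pos.2 hmpos), abs_of_pos (by norm_num : (0 : ℝ) < 1 / 2)]
    calc _ ≤ 1 / 2 * 1 * (ρ⁻¹ * 2) * (33 * (d + 2) * B ^ 3 * ρ ^ 3) := by
          gcongr; linarith only [hm1]
      _ = 33 * (d + 2) * B ^ 3 * (ρ * ρ) := by field_simp
      _ ≤ 33 * (d + 2) * B ^ 3 * (ρ * 1) := by gcongr; linarith only [hρ']
      _ = _ := by ring
  have key : ∀ a₁ a₂ a₃ a₄ a₅ : ℝ,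
      |a₁ - a₂ + a₃ - a₄ + a₅| ≤ |a₁| + |a₂| + |a₃| + |a₄| + |a₅| := fun a₁ a₂ a₃ a₄ a₅ =>
    (abs_add_le _ _).trans (add_le_add_left ((abs_sub _ _).trans (add_le_add_left
      ((abs_add_le _ _).trans (add_le_add_left (abs_sub _ _) _)) _)) _)
  refine (abs_sub _ _).trans ?_
  rw [abs_mul, abs_of_nonneg hs]
  have e7 := key (ρ / 8 * m⁻¹ ^ 2 * (dt2 d α β - Γ α β)) (3 / 2 * (r α β - b α β))
    (ρ ^ 2 * (3 / 32 * ρ ^ 2 - 1 / 8) * m⁻¹ ^ 2 * r α β)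
    (1 / 2 * ρ * (1 - 3 / 4 * ρ ^ 2) * m⁻¹ ^ 2 * dr 0 α β)
    (ζ * m⁻¹ * (3 / 4 * ρ ^ 2 * dt2 d α β + 1 / 4 * ρ ^ 2 * Γ α β - ρ ^ 3 * r α β))
  have e8 := mul_le_mul hs' e7 (abs_nonneg _) zero_le_one
  have hB3 : B ≤ B ^ 3 := le_self_pow₀ hB (by norm_num)
  have hd : (2 : ℝ) ≤ d + 2 := by linarith only [(Nat.cast_nonneg d : (0 : ℝ) ≤ d)]
  have e9 : 2 * B * ρ ≤ (d + 2) * B ^ 3 * ρ := by gcongr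
  have e10 : 0 ≤ B * ρ := by positivity
  linarith only [e1, e2, e3, e4, e5, e6, e8, e9, e10]

end JetBounds

/-! ### Assembly of the component bounds with the pseudoconvexity hypothesis. -/

section point

variable {F : Type*} [NormedAddCommGroup F] [InnerProductSpace ℝ F]
  {K : ℝ} {L : (Fin (d + 2) → ℝ) →ₗ[ℝ] F}

lemma NearPoint.deformBounds (h : NearPoint B ρ L r) (j : JetBounds B ρ (gramM L) r b dΓ dr)
    (hs : 0 ≤ s) (hs' : s ≤ 1) (hc : |c| ≤ 1) (hζ : |ζ| ≤ Z) (hK : 0 < K)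
    (hw0 : ∀ Y, bil (rescaled ρ (gramM L) r) w Y = Y 1)
    (hpos : ∀ X : Fin (d + 2) → ℝ, X 0 = 0 → K * (X 1 ^ 2 + ‖L X‖ ^ 2) ≤
      bil (fun α β => -(3 / 2) * b α β - ζ * (-dt2 d α β + gramM L α β)) X X) :
    DeformBounds (40 * (d + 2) * B ^ 3 + 4 * Z * B) K ρ s L
      (hessQ ρ s c ζ w (gramM L) r dΓ dr)
      (fun α β => -(3 / 2) * b α β - ζ * (-dt2 d α β + gramM L α β)) := by
  have hB := h.one_le
  have hB0 : 0 ≤ B := by linarith only [hB]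
  have hρ := h.ρ_pos
  have hρ' := h.ρ_le
  have hZ : 0 ≤ Z := (abs_nonneg _).trans hζ
  have hd : (2 : ℝ) ≤ d + 2 := by linarith only [(Nat.cast_nonneg d : (0 : ℝ) ≤ d)]
  have hB3 : B ≤ B ^ 3 := le_self_pow₀ hB (by norm_num)
  have hdB : 2 * B ≤ (d + 2) * B ^ 3 := by gcongr
  have hZB : Z ≤ Z * B := le_mul_of_one_le_right hZ hB
  have hZB0 : 0 ≤ Z * B := by positivity
  have hw : ∀ δ, |w δ + (if δ = 1 then (1 + ρ ^ 2 / 2)⁻¹ else 0)| ≤ 2 * B ^ 2 * ρ ^ 3 := by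
    obtain ⟨w', hw', -, -, hw2⟩ := h.exists_dual_dt
    -- The dual vector of `dt` is unique, so `w` inherits the closeness to `-κ ∂_t`.
    have hww : w = w' := by
      have h1 := h.nrm_le_of_forall (X := w - w') (b := 0) fun Y => by
        rw [map_sub, LinearMap.sub_apply, hw0, hw', sub_self, zero_mul]
      rw [mul_zero] at h1
      exact sub_eq_zero.1 (h.eq_zero_of_nrm (le_antisymm h1 (nrm_nonneg _ _)))
    intro δ
    have h2 := h.coord (w' + (1 + ρ ^ 2 / 2)⁻¹ • Pi.single 1 1) δ
    have h3 : (w' + (1 + ρ ^ 2 / 2)⁻¹ • (Pi.single 1 1 : Fin (d + 2) → ℝ)) δ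
        = w δ + (if δ = 1 then (1 + ρ ^ 2 / 2)⁻¹ else 0) := by
      simp [hww, Pi.single_apply]
    rw [h3] at h2
    calc _ ≤ B * (2 * (B * ρ ^ 3)) := h2.trans (by gcongr)
      _ = _ := by ring
  have hleft : ∀ β, β ≠ 0 → |hessQ ρ s c ζ w (gramM L) r dΓ dr 0 β|
      ≤ (40 * (d + 2) * B ^ 3 + 4 * Z * B) * ρ := fun β hβ => by
    refine (j.abs_hessQ_left hB hρ hρ' hc hw β hβ).trans ?_
    gcongr
    linarith only [hdB, hZB0, hB0]
  refine ⟨by positivity, hK, ?_, hleft, fun α hα => ?_, fun α β hα hβ => ?_, fun α β hα hβ => ?_,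
    hpos⟩
  · rw [j.hessQ_zero_zero hρ hρ', abs_mul, abs_of_nonneg hs, mul_comm]
    refine mul_le_mul_of_nonneg_right ?_ hs
    have hρ2 : ρ ^ 2 ≤ 1 / 16 := by nlinarith only [hρ, hρ']
    have hm0 : 63 / 64 ≤ 1 - ρ ^ 2 / 4 := by linarith only [hρ2]
    set m := 1 - ρ ^ 2 / 4
    have hmpos : 0 < m := by linarith only [hm0]
    have hm1 : m⁻¹ ≤ 2 := by
      rw [inv_le_comm₀ hmpos (by norm_num)]; linarith only [hm0]
    refine (abs_sub _ _).trans ?_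
    rw [abs_mul ζ, abs_of_pos (inv_pos.2 hmpos),
      abs_of_nonneg (by positivity : 0 ≤ ρ / 2 * m⁻¹ ^ 3)]
    calc _ ≤ (1 / 4) / 2 * 2 ^ 3 + Z * 2 := by gcongr
      _ ≤ _ := by linarith only [hdB, hB, hZB, hZB0]
  · rw [j.hessQ_symm]; exact hleft α hα
  · exact j.abs_hessQ_sub_le hB hρ hρ' hs hs' hc hζ hw hα hβ
  · have h1 := j.b_le α β hα hβ
    have h2 := j.r_le α β
    have h3 := JetBounds.abs_dt2_le α β
    have h4 := j.Γ_le α β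
    -- No bound on `b` is assumed; it follows from those on `r` and on `r - b`.
    have h5 : |b α β| ≤ 2 * B := by
      have h6 : B * ρ ≤ B * 1 := by gcongr; linarith only [hρ']
      have h7 := abs_sub_abs_le_abs_sub (b α β) (r α β)
      rw [abs_sub_comm] at h7
      linarith only [h1, h2, h6, h7]
    have h6 : |ζ * (-dt2 d α β + gramM L α β)| ≤ Z * (2 * B) := by
      rw [abs_mul]
      gcongr
      refine (abs_add_le _ _).trans ?_
      rw [abs_neg]; linarith only [h3, h4, hB]
    have h7 : |-(3 / 2) * b α β| ≤ 3 / 2 * (2 * B) := by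
      rw [abs_mul, abs_neg, abs_of_pos (by norm_num : (0 : ℝ) < 3 / 2)]; gcongr
    refine (abs_sub _ _).trans ?_
    linarith only [h6, h7, hdB, hZB0, hB0]

end point


end

section

variable {d : ℕ}

/-! ### Partial derivatives -/

open Filter Topology

section pd

variable {u v : (Fin (d + 2) → ℝ) → ℝ} {z : Fin (d + 2) → ℝ} (α : Fin (d + 2))

lemma pd_congr (h : u =ᶠ[𝓝 z] v) : pd α u z = pd α v z := by
  rw [pd, pd, h.fderiv_eq]

lemma pd_add (hu : DifferentiableAt ℝ u z) (hv : DifferentiableAt ℝ v z) :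
    pd α (fun y => u y + v y) z = pd α u z + pd α v z := by
  rw [pd, fderiv_fun_add hu hv]; rfl

lemma pd_sub (hu : DifferentiableAt ℝ u z) (hv : DifferentiableAt ℝ v z) :
    pd α (fun y => u y - v y) z = pd α u z - pd α v z := by
  rw [pd, fderiv_fun_sub hu hv]; rfl

lemma pd_mul (hu : DifferentiableAt ℝ u z) (hv : DifferentiableAt ℝ v z) :
    pd α (fun y => u y * v y) z = pd α u z * v z + u z * pd α v z := by
  rw [pd, fderiv_fun_mul hu hv]
  simp [pd]; ring

lemma pd_const (a : ℝ) : pd α (fun _ => a) z = 0 := by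
  simp [pd]

lemma pd_const_mul (a : ℝ) (hu : DifferentiableAt ℝ u z) :
    pd α (fun y => a * u y) z = a * pd α u z := by
  rw [pd_mul α (differentiableAt_const a) hu, pd_const]; ring

lemma differentiableAt_coord {a : ℝ → ℝ} {a' : ℝ} {i : Fin (d + 2)} (h : HasDerivAt a a' (z i)) :
    DifferentiableAt ℝ (fun y : Fin (d + 2) → ℝ => a (y i)) z :=
  h.differentiableAt.comp z (differentiableAt_apply (𝕜 := ℝ) i z)

lemma pd_coord {a : ℝ → ℝ} {a' : ℝ} {i : Fin (d + 2)} (h : HasDerivAt a a' (z i)) :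
    pd α (fun y => a (y i)) z = if α = i then a' else 0 := by
  have h1 : HasFDerivAt (fun y : Fin (d + 2) → ℝ => y i)
      (ContinuousLinearMap.proj (R := ℝ) (φ := fun _ : Fin (d + 2) => ℝ) i) z :=
    hasFDerivAt_apply i z
  have h2 := h.hasFDerivAt.comp z h1
  have h3 : pd α (fun y => a (y i)) z = _ := congrArg (fun L => L (Pi.single α (1 : ℝ))) h2.fderiv
  rw [h3]
  simp [Pi.single_apply, eq_comm]

lemma pd_pow (n : ℕ) (hu : DifferentiableAt ℝ u z) :
    pd α (fun y => u y ^ n) z = n * u z ^ (n - 1) * pd α u z := by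
  have := (hu.hasFDerivAt.pow n).fderiv
  rw [pd, this]
  simp [pd]

end pd

/-! ### Uniform bounds for the coefficients of the metric -/

/-- The constant is phrased through `atTop` so that the bounds for finitely many components and
charts can be intersected into a single one. -/
lemma bdd_of_isBigO {D : Set (Fin (d + 2) → ℝ)} {u h : (Fin (d + 2) → ℝ) → ℝ}
    (hu : IsBigO D u h) (hh : ∀ z ∈ D, 0 ≤ h z) : ∀ᶠ b : ℝ in atTop, ∀ z ∈ D, |u z| ≤ b * h z := by
  obtain ⟨C, hC⟩ := hu.2 0 []
  filter_upwards [eventually_ge_atTop C] with b hb z hz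
  have := hC z hz
  simp only [List.replicate_zero, List.map_nil, pdList, List.foldr_nil, pow_zero, inv_one,
    one_mul] at this
  exact this.trans (by gcongr; exact hh z hz)

lemma pd_succ_bdd_of_isBigO {D : Set (Fin (d + 2) → ℝ)} {u h : (Fin (d + 2) → ℝ) → ℝ}
    (hu : IsBigO D u h) (hh : ∀ z ∈ D, 0 ≤ h z) (a : Fin (d + 1)) :
    ∀ᶠ b : ℝ in atTop, ∀ z ∈ D, |pd a.succ u z| ≤ b * h z := by
  obtain ⟨C, hC⟩ := hu.2 0 [a]
  filter_upwards [eventually_ge_atTop C] with b hb z hz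
  have := hC z hz
  simp only [List.replicate_zero, List.map_cons, List.map_nil, pdList, List.foldr_nil,
    List.foldr_cons, pow_zero, inv_one, one_mul] at this
  exact this.trans (by gcongr; exact hh z hz)

lemma pd_zero_bdd_of_isBigO {D : Set (Fin (d + 2) → ℝ)} {u h : (Fin (d + 2) → ℝ) → ℝ}
    (hu : IsBigO D u h) (hh : ∀ z ∈ D, 0 ≤ h z) (hD : ∀ z ∈ D, 0 < z 0) :
    ∀ᶠ b : ℝ in atTop, ∀ z ∈ D, |pd 0 u z| ≤ b * ((z 0)⁻¹ * h z) := by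
  obtain ⟨C, hC⟩ := hu.2 1 []
  filter_upwards [eventually_ge_atTop C] with b hb z hz
  have := hC z hz
  simp only [List.replicate_one, List.map_nil, pdList, List.foldr_nil, List.foldr_cons,
    pow_one] at this
  refine this.trans ?_
  have := hh z hz
  have := hD z hz
  gcongr

/-- The remainder of the expansion of the metric of third order. -/
def expRem (g : TensorM d) (gb : TensorI d) (φ : Coord d) (a b : Fin (d + 1))
    (z : Fin (d + 2) → ℝ) : ℝ :=
  compM g φ z a.succ b.succ - (z 0 ^ 2)⁻¹ * gm φ z a.succ b.succ
    - ggs φ z a.succ b.succ - z 0 * compI gb φ z a.succ b.succ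

/-- Bounds for the coefficients in the expansion of the metric at a point. -/
structure CoeffBounds (b : ℝ) (g : TensorM d) (gb : TensorI d) (φ : Coord d)
    (z : Fin (d + 2) → ℝ) : Prop where
  one_le : 1 ≤ b
  ggm_le : ∀ α β, |ggm φ z α β| ≤ b
  inv_le : ∀ α β, |(ggm φ z)⁻¹ α β| ≤ b
  ggr_le : ∀ α β, |ggr g φ z α β| ≤ b
  pd_ggm : ∀ (a : Fin (d + 1)) α β, |pd a.succ (fun y => ggm φ y α β) z| ≤ b
  pd_ggr : ∀ (a : Fin (d + 1)) α β, |pd a.succ (fun y => ggr g φ y α β) z| ≤ b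
  rem : ∀ a c, |expRem g gb φ a c z| ≤ b * z 0 ^ 2
  pd_rem : ∀ a c, |pd 0 (expRem g gb φ a c) z| ≤ b * z 0

variable {ρs : ℝ} {g : TensorM d} {gb : TensorI d} {Ξ : Set (Coord d)}

lemma IsBorderlineSegment.exists_coeffBounds (hg : IsBorderlineSegment ρs g gb Ξ) :
    ∃ b : ℝ, ∀ φ ∈ Ξ, ∀ z ∈ coordDomain ρs φ, CoeffBounds b g gb φ z := by
  have h1 : ∀ z : Fin (d + 2) → ℝ, 0 ≤ (fun _ : Fin (d + 2) → ℝ => (1 : ℝ)) z :=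
    fun _ => zero_le_one
  have key : ∀ᶠ b : ℝ in atTop, ∀ φ ∈ Ξ, ∀ z ∈ coordDomain ρs φ, CoeffBounds b g gb φ z := by
    rw [eventually_all_finite hg.finite]
    intro φ hφ
    have e1 := eventually_all.2 fun α => eventually_all.2 fun β =>
      bdd_of_isBigO (hg.ggm_bdd φ hφ α β) fun z _ => h1 z
    have e2 := eventually_all.2 fun α => eventually_all.2 fun β =>
      bdd_of_isBigO (hg.ggm_inv_bdd φ hφ α β) fun z _ => h1 z
    have e3 := eventually_all.2 fun α => eventually_all.2 fun β =>
      bdd_of_isBigO (hg.ggr_bdd φ hφ α β) fun z _ => h1 z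
    have e4 := eventually_all.2 fun α => eventually_all.2 fun β => eventually_all.2 fun a =>
      pd_succ_bdd_of_isBigO (hg.ggm_bdd φ hφ α β) (fun z _ => h1 z) a
    have e5 := eventually_all.2 fun α => eventually_all.2 fun β => eventually_all.2 fun a =>
      pd_succ_bdd_of_isBigO (hg.ggr_bdd φ hφ α β) (fun z _ => h1 z) a
    have e6 := eventually_all.2 fun a => eventually_all.2 fun c =>
      bdd_of_isBigO (hg.expansion φ hφ a c) fun z _ => sq_nonneg (z 0)
    have e7 := eventually_all.2 fun a => eventually_all.2 fun c =>
      pd_zero_bdd_of_isBigO (hg.expansion φ hφ a c) (fun z _ => sq_nonneg (z 0)) fun z hz => hz.1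
    filter_upwards [eventually_ge_atTop 1, e1, e2, e3, e4, e5, e6, e7] with
      b f0 f1 f2 f3 f4 f5 f6 f7 z hz
    refine ⟨f0, fun α β => by simpa using f1 α β z hz, fun α β => by simpa using f2 α β z hz,
      fun α β => by simpa using f3 α β z hz, fun a α β => by simpa using f4 α β a z hz,
      fun a α β => by simpa using f5 α β a z hz, fun a c => f6 a c z hz, fun a c => ?_⟩
    have h2 := f7 a c z hz
    have h3 : (z 0)⁻¹ * z 0 ^ 2 = z 0 := by
      have : z 0 ≠ 0 := hz.1.ne'
      field_simp
    rwa [h3] at h2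
  exact key.exists

/-! ### From bounds for the coefficients to bounds at a point -/

/-- The differential of the embedding of the sphere. -/
abbrev diffS (φ : Coord d) (z : Fin (d + 2) → ℝ) :
    (Fin (d + 2) → ℝ) →ₗ[ℝ] EuclideanSpace ℝ (Fin (d + 1)) :=
  (fderiv ℝ (pointS φ) z : (Fin (d + 2) → ℝ) →ₗ[ℝ] EuclideanSpace ℝ (Fin (d + 1)))

lemma roundM_eq_gramM (φ : Coord d) (z : Fin (d + 2) → ℝ) : roundM φ z = gramM (diffS φ z) := rfl

lemma diffS_single_zero (φ : Coord d) (z : Fin (d + 2) → ℝ) :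
    diffS φ z (Pi.single 0 1) = 0 :=
  fderiv_pointS_single z xPart_single_zero

lemma diffS_single_one (φ : Coord d) (z : Fin (d + 2) → ℝ) :
    diffS φ z (Pi.single 1 1) = 0 :=
  fderiv_pointS_single z xPart_single_one

lemma roundM_zero (φ : Coord d) (z : Fin (d + 2) → ℝ) (β : Fin (d + 2)) : roundM φ z 0 β = 0 := by
  rw [roundM_eq_gramM, gramM, diffS_single_zero, inner_zero_left]

lemma roundM_one (φ : Coord d) (z : Fin (d + 2) → ℝ) (β : Fin (d + 2)) : roundM φ z 1 β = 0 := by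
  rw [roundM_eq_gramM, gramM, diffS_single_one, inner_zero_left]

lemma roundM_symm (φ : Coord d) (z : Fin (d + 2) → ℝ) (α β : Fin (d + 2)) :
    roundM φ z α β = roundM φ z β α :=
  real_inner_comm _ _

lemma ggm_apply (φ : Coord d) (z : Fin (d + 2) → ℝ) (α β : Fin (d + 2)) :
    ggm φ z α β = dρ2 d α β + (-dt2 d α β + roundM φ z α β) := rfl

lemma compM_eq_pointMetric {φ : Coord d} {z : Fin (d + 2) → ℝ} (hz : 0 < z 0) :
    compM g φ z = pointMetric (z 0) (diffS φ z) (ggr g φ z) := by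
  ext α β
  have h1 : ggr g φ z α β = (z 0 ^ 3)⁻¹ * (z 0 ^ 2 * compM g φ z α β - ggm φ z α β
    - z 0 ^ 2 * ggs φ z α β) := rfl
  have h2 : pointMetric (z 0) (diffS φ z) (ggr g φ z) α β
      = (z 0 ^ 2)⁻¹ * rescaled (z 0) (roundM φ z) (ggr g φ z) α β := rfl
  have h3 : ggs φ z α β = -(1 / 2) * (dt2 d α β + roundM φ z α β) := rfl
  rw [h2, rescaled_apply, h1, ggm_apply, h3]
  field_simp
  ring

lemma bil_ggm (φ : Coord d) (z X Y : Fin (d + 2) → ℝ) : bil (ggm φ z) X Y =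
    X 0 * Y 0 - X 1 * Y 1 + inner ℝ (diffS φ z X) (diffS φ z Y) := by
  simp only [bil, ggm, gm, map_add, map_neg, LinearMap.add_apply, LinearMap.neg_apply]
  rw [bil_dρ2, bil_dt2, roundM_eq_gramM, bil_gramM]
  ring

/-- Pairing a kernel vector with its time reflection gives a vanishing sum of squares, and the
embedding of the sphere is an immersion. -/
lemma isUnit_det_ggm {φ : Coord d} (hφ : φ ∈ smoothCoords d) {z : Fin (d + 2) → ℝ}
    (hz : xPart z ∈ φ.target) : IsUnit (ggm φ z).det := by
  rw [isUnit_iff_ne_zero]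
  intro h0
  obtain ⟨v, hv, hv'⟩ := Matrix.exists_mulVec_eq_zero_iff.2 h0
  have h1 : bil (ggm φ z) (flip v) v = 0 := by
    rw [bil_eq_dotProduct, hv', dotProduct_zero]
  have h2 : diffS φ z (flip v) = diffS φ z v := by
    rw [flip, map_sub, map_smul, diffS_single_one, smul_zero, sub_zero]
  rw [bil_ggm, h2, NearPoint.flip_zero, NearPoint.flip_one, real_inner_self_eq_norm_sq] at h1
  have h3 : v 0 = 0 := by nlinarith only [h1, sq_nonneg (v 0), sq_nonneg (v 1), sq_nonneg ‖diffS φ z v‖]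
  have h4 : v 1 = 0 := by nlinarith only [h1, sq_nonneg (v 0), sq_nonneg (v 1), sq_nonneg ‖diffS φ z v‖]
  have h5 : ‖diffS φ z v‖ = 0 := by
    nlinarith only [h1, sq_nonneg (v 0), sq_nonneg (v 1), sq_nonneg ‖diffS φ z v‖]
  have h6 := fderiv_pointS_apply_eq_zero hφ hz (norm_eq_zero.1 h5)
  apply hv
  funext α
  refine Fin.cases h3 (fun a => Fin.cases h4 (fun A => ?_) a) α
  exact congrFun (congrArg (WithLp.ofLp) h6) A

/-- Row `α` of the inverse matrix is a vector `Y` representing the coordinate `X α` through the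
leading metric. Cauchy-Schwarz for the Euclidean norm then reduces the claim to the size of `Y`. -/
lemma CoeffBounds.abs_coord_le {b : ℝ} {φ : Coord d} {z : Fin (d + 2) → ℝ}
    (h : CoeffBounds b g gb φ z) (hφ : φ ∈ smoothCoords d) (hz : xPart z ∈ φ.target)
    (X : Fin (d + 2) → ℝ) (α : Fin (d + 2)) : |X α| ≤ 2 * b * nrm (diffS φ z) X := by
  set P := (ggm φ z)⁻¹ with hP
  set Y : Fin (d + 2) → ℝ := Pi.single α 1 ᵥ* P with hY
  have h1 : ∀ V, bil (ggm φ z) Y V = V α := fun V => by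
    rw [bil_eq_dotProduct, Matrix.dotProduct_mulVec, hY, Matrix.vecMul_vecMul,
      Matrix.nonsing_inv_mul _ (isUnit_det_ggm hφ hz), Matrix.vecMul_one, single_one_dotProduct]
  have hYβ : ∀ β, |Y β| ≤ b := fun β => by
    have : Y β = P α β := by rw [hY, Matrix.single_one_vecMul]; rfl
    rw [this]; exact h.inv_le α β
  have hb := h.one_le
  set n := nrm (diffS φ z) with hn
  -- The squared norm of `Y` is `Y α + 2 (Y 1)² ≤ b + 2 b²`.
  have h2 : n Y ^ 2 ≤ (2 * b) ^ 2 := by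
    have h3 := h1 Y
    rw [bil_ggm, real_inner_self_eq_norm_sq] at h3
    have h4 : Y 1 ^ 2 ≤ b ^ 2 := sq_le_sq' (abs_le.1 (hYβ 1)).1 (abs_le.1 (hYβ 1)).2
    have h5 := (abs_le.1 (hYβ α)).2
    rw [hn, nrm_sq]
    nlinarith only [h3, h4, h5, hb]
  have h3 : n Y ≤ 2 * b := abs_le_of_sq_le_sq' h2 (by linarith) |>.2
  have h4 : (X α) ^ 2 ≤ (n Y * n X) ^ 2 := by
    rw [← h1 X, bil_ggm, mul_pow, hn, nrm_sq, nrm_sq]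
    have h5 := abs_real_inner_le_norm (diffS φ z Y) (diffS φ z X)
    have h6 : (inner ℝ (diffS φ z Y) (diffS φ z X)) ^ 2
        ≤ (‖diffS φ z Y‖ * ‖diffS φ z X‖) ^ 2 := by
      rw [← sq_abs]; gcongr
    have h7 := abs_le.1 h5
    set i := inner ℝ (diffS φ z Y) (diffS φ z X)
    set y := ‖diffS φ z Y‖
    set x := ‖diffS φ z X‖
    have h8 : |Y 0 * X 0 - Y 1 * X 1 + i| ≤ |Y 0| * |X 0| + |Y 1| * |X 1| + y * x := by
      refine (abs_add_le _ _).trans (add_le_add ((abs_sub _ _).trans ?_) h5)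
      rw [abs_mul, abs_mul]
    have h9 : (Y 0 * X 0 - Y 1 * X 1 + i) ^ 2 ≤ (|Y 0| * |X 0| + |Y 1| * |X 1| + y * x) ^ 2 := by
      rw [← sq_abs]; gcongr
    refine h9.trans ?_
    rw [← sq_abs (Y 0), ← sq_abs (Y 1), ← sq_abs (X 0), ← sq_abs (X 1)]
    nlinarith only [sq_nonneg (|Y 0| * |X 1| - |Y 1| * |X 0|), sq_nonneg (|Y 0| * x - y * |X 0|),
      sq_nonneg (|Y 1| * x - y * |X 1|)]
  have hnX : 0 ≤ n X := nrm_nonneg _ _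
  calc |X α| ≤ n Y * n X := abs_le_of_sq_le_sq h4 (mul_nonneg (nrm_nonneg _ _) hnX)
    _ ≤ _ := by gcongr

lemma IsBorderlineSegment.ggr_symm (hg : IsBorderlineSegment ρs g gb Ξ) {φ : Coord d}
    {z : Fin (d + 2) → ℝ} (hz : z ∈ coordDomain ρs φ) (α β : Fin (d + 2)) :
    ggr g φ z α β = ggr g φ z β α := by
  have hp : pointM φ z ∈ spacetime d ρs := ⟨hz.1, hz.2.1, hz.2.2.1, hz.2.2.2.1⟩
  have h1 : compM g φ z α β = compM g φ z β α := hg.lorentz.symm _ hp _ _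
  have h3 : ∀ α β, ggr g φ z α β = (z 0 ^ 3)⁻¹ * (z 0 ^ 2 * compM g φ z α β
    - (dρ2 d α β + (-dt2 d α β + roundM φ z α β))
    - z 0 ^ 2 * (-(1 / 2) * (dt2 d α β + roundM φ z α β))) := fun _ _ => rfl
  rw [h3, h3, h1, roundM_symm φ z α β, dρ2_apply, dρ2_apply, dt2_apply, dt2_apply]
  simp only [and_comm]

/-- The pointwise constant obtained from a bound `b` for the coefficients. -/
def pointConst (d : ℕ) (b : ℝ) : ℝ := 4 * (d + 2) ^ 2 * b ^ 3

lemma le_pointConst {b : ℝ} (hb : 1 ≤ b) : 16 * b ≤ pointConst d b := by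
  have h1 : b ≤ b ^ 3 := le_self_pow₀ hb (by norm_num)
  have h2 : (4 : ℝ) ≤ (d + 2) ^ 2 := by
    nlinarith only [(Nat.cast_nonneg d : (0 : ℝ) ≤ d)]
  unfold pointConst
  calc 16 * b = 4 * 4 * b := by ring
    _ ≤ _ := by gcongr

/-- The value of `pointConst` is `(d + 2)² · b · (2 b)²`: the entries of the remainder are at most
`b`, and the components of each argument at most `2 b` times its norm. -/
lemma IsBorderlineSegment.nearPoint (hg : IsBorderlineSegment ρs g gb Ξ) {φ : Coord d}
    (hφ : φ ∈ Ξ) {z : Fin (d + 2) → ℝ} (hz : z ∈ coordDomain ρs φ) {b : ℝ}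
    (h : CoeffBounds b g gb φ z) (hρ : 4 * pointConst d b * z 0 ≤ 1) :
    NearPoint (pointConst d b) (z 0) (diffS φ z) (ggr g φ z) := by
  have hb := h.one_le
  have hB := le_pointConst (d := d) hb
  have hc := h.abs_coord_le (hg.smoothCoord hφ) hz.2.2.2.2
  refine ⟨by linarith, hz.1, hρ, diffS_single_zero φ z, diffS_single_one φ z, hg.ggr_symm hz,
    fun α => (hg.fefferman_graham φ hφ z hz α).1, fun X Y => ?_, fun X α => ?_⟩
  · have hX := nrm_nonneg (diffS φ z) X
    refine (abs_bil_le (by linarith : 0 ≤ b) (by positivity) h.ggr_le (hc X) (hc Y)).trans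
      (le_of_eq ?_)
    rw [pointConst]; ring
  · refine (hc X α).trans ?_
    have := nrm_nonneg (diffS φ z) X
    gcongr
    linarith

lemma IsBorderlineSegment.differentiableAt_ggr (hg : IsBorderlineSegment ρs g gb Ξ) {φ : Coord d}
    (hφ : φ ∈ Ξ) {z : Fin (d + 2) → ℝ} (hz : z ∈ coordDomain ρs φ) (α β : Fin (d + 2)) :
    DifferentiableAt ℝ (fun y => ggr g φ y α β) z :=
  ((hg.ggr_bdd φ hφ α β).1.contDiffAt ((isOpen_coordDomain ρs φ).mem_nhds hz)).differentiableAt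
    (by simp)

lemma IsBorderlineSegment.differentiableAt_roundM (hg : IsBorderlineSegment ρs g gb Ξ)
    {φ : Coord d} (hφ : φ ∈ Ξ) {z : Fin (d + 2) → ℝ} (hz : z ∈ coordDomain ρs φ)
    (α β : Fin (d + 2)) : DifferentiableAt ℝ (fun y => roundM φ y α β) z := by
  have h1 : DifferentiableAt ℝ (fun y => ggm φ y α β) z :=
    ((hg.ggm_bdd φ hφ α β).1.contDiffAt ((isOpen_coordDomain ρs φ).mem_nhds hz)).differentiableAt
      (by simp)
  have h2 := h1.sub_const (dρ2 d α β - dt2 d α β)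
  refine h2.congr_of_eventuallyEq (Eventually.of_forall fun y => ?_)
  simp only [ggm_apply]; ring

lemma pd_ggm_eq {φ : Coord d} (z : Fin (d + 2) → ℝ) (μ α β : Fin (d + 2)) :
    pd μ (fun y => ggm φ y α β) z = pd μ (fun y => roundM φ y α β) z := by
  have : (fun y => ggm φ y α β) = fun y => roundM φ y α β + (dρ2 d α β - dt2 d α β) :=
    funext fun y => by rw [ggm_apply]; ring
  rw [pd, pd, this, fderiv_add_const]

lemma expRem_eq {φ : Coord d} (a c : Fin (d + 1)) {z : Fin (d + 2) → ℝ} (hz : 0 < z 0) :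
    expRem g gb φ a c z
      = z 0 * (ggr g φ z a.succ c.succ - compI gb φ z a.succ c.succ) := by
  have h1 : ggr g φ z a.succ c.succ = (z 0 ^ 3)⁻¹ * (z 0 ^ 2 * compM g φ z a.succ c.succ
    - (dρ2 d a.succ c.succ + gm φ z a.succ c.succ)
    - z 0 ^ 2 * ggs φ z a.succ c.succ) := rfl
  have h2 : dρ2 d a.succ c.succ = 0 := by simp [dρ2_apply, Fin.succ_ne_zero]
  rw [h1, h2, expRem]
  field_simp
  ring

/-- The `ρ`-derivative of the remainder is bounded, since the third order coefficient does not
depend on `ρ`. -/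
lemma IsBorderlineSegment.abs_pd_zero_ggr_le (hg : IsBorderlineSegment ρs g gb Ξ) {φ : Coord d}
    (hφ : φ ∈ Ξ) {z : Fin (d + 2) → ℝ} (hz : z ∈ coordDomain ρs φ) {b : ℝ}
    (h : CoeffBounds b g gb φ z) (α β : Fin (d + 2)) :
    |pd 0 (fun y => ggr g φ y α β) z| ≤ 2 * b := by
  have hnhds := (isOpen_coordDomain ρs φ).mem_nhds hz
  have hb := h.one_le
  have hz0 : 0 < z 0 := hz.1
  by_cases hαβ : α = 0 ∨ β = 0
  · have h1 : (fun y => ggr g φ y α β) =ᶠ[𝓝 z] fun _ => 0 := by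
      filter_upwards [hnhds] with y hy
      rcases hαβ with rfl | rfl
      · exact (hg.fefferman_graham φ hφ y hy β).1
      · exact (hg.fefferman_graham φ hφ y hy α).2
    rw [pd_congr 0 h1, pd_const]; simp; linarith
  · push Not at hαβ
    obtain ⟨a, rfl⟩ := Fin.exists_succ_eq.2 hαβ.1
    obtain ⟨c, rfl⟩ := Fin.exists_succ_eq.2 hαβ.2
    have hr := hg.differentiableAt_ggr hφ hz a.succ c.succ
    have hm : DifferentiableAt ℝ (expRem g gb φ a c) z :=
      ((hg.expansion φ hφ a c).1.contDiffAt hnhds).differentiableAt (by simp)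
    have hinv : HasDerivAt (fun t : ℝ => t⁻¹) (-(z 0 ^ 2)⁻¹) (z 0) := hasDerivAt_inv hz0.ne'
    -- Write `b = r - ρ⁻¹ · (expansion remainder)`. Since `∂_ρ b = 0`, the derivative of `r` is that
    -- of `ρ⁻¹` times an `O(ρ²)` term, hence bounded.
    have h1 : (fun y => compI gb φ y a.succ c.succ) =ᶠ[𝓝 z]
        fun y => ggr g φ y a.succ c.succ - (y 0)⁻¹ * expRem g gb φ a c y := by
      filter_upwards [hnhds] with y hy
      rw [expRem_eq a c hy.1, inv_mul_cancel_left₀ hy.1.ne']; ring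
    have h2 := pd_congr 0 h1
    rw [pd_zero_compI (hg.smoothCoord hφ) gb hz.2.2.2.2,
      pd_sub 0 hr ((differentiableAt_coord hinv).fun_mul hm),
      pd_mul 0 (differentiableAt_coord hinv) hm, pd_coord 0 hinv, if_pos rfl] at h2
    have h3 : pd 0 (fun y => ggr g φ y a.succ c.succ) z
        = -((z 0 ^ 2)⁻¹ * expRem g gb φ a c z) + (z 0)⁻¹ * pd 0 (expRem g gb φ a c) z := by
      linarith
    rw [h3]
    refine (abs_add_le _ _).trans ?_
    rw [abs_neg, abs_mul, abs_mul, abs_of_pos (by positivity : 0 < (z 0 ^ 2)⁻¹),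
      abs_of_pos (by positivity : 0 < (z 0)⁻¹)]
    calc _ ≤ (z 0 ^ 2)⁻¹ * (b * z 0 ^ 2) + (z 0)⁻¹ * (b * z 0) := by
          gcongr
          · exact h.rem a c
          · exact h.pd_rem a c
      _ = _ := by field_simp; ring

lemma IsBorderlineSegment.jetBounds (hg : IsBorderlineSegment ρs g gb Ξ) {φ : Coord d}
    (hφ : φ ∈ Ξ) {z : Fin (d + 2) → ℝ} (hz : z ∈ coordDomain ρs φ) {b : ℝ}
    (h : CoeffBounds b g gb φ z) :
    JetBounds (pointConst d b) (z 0) (gramM (diffS φ z)) (ggr g φ z) (compI gb φ z)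
      (fun μ α β => pd μ (fun y => roundM φ y α β) z)
      (fun μ α β => pd μ (fun y => ggr g φ y α β) z) := by
  have hb := h.one_le
  have hB := le_pointConst (d := d) hb
  have hnhds := (isOpen_coordDomain ρs φ).mem_nhds hz
  have hz0 : 0 < z 0 := hz.1
  refine
    { Γ_le := fun α β => ?_
      r_le := fun α β => (h.ggr_le α β).trans (by linarith)
      dΓ_le := fun μ α β => ?_
      dr_le := fun μ α β => ?_
      b_le := fun α β hα hβ => ?_
      Γ_symm := roundM_symm φ z
      r_symm := hg.ggr_symm hz
      dΓ_symm := fun μ α β => by simp only [roundM_symm φ _ α β]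
      dr_symm := fun μ α β => pd_congr μ ?_
      Γ_zero := roundM_zero φ z
      r_zero := fun α => (hg.fefferman_graham φ hφ z hz α).1
      dΓ_zero := fun μ β => by simp only [roundM_zero, pd_const]
      Γ_one := roundM_one φ z
      dΓ_one := fun μ β => by simp only [roundM_one, pd_const]
      dr_zero := fun μ β => ?_
      d_zero := fun α β => pd_zero_roundM φ z α β
      d_one := fun α β => pd_one_roundM φ z α β }
  · have h1 : gramM (diffS φ z) α β = ggm φ z α β - dρ2 d α β + dt2 d α β := by
      rw [ggm_apply, roundM_eq_gramM]; ring
    have h2 := h.ggm_le α β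
    have h3 := JetBounds.abs_dt2_le α β
    have h4 : |dρ2 d α β| ≤ 1 := by rw [dρ2_apply]; split_ifs <;> simp
    rw [h1]
    refine (abs_add_le _ _).trans ((add_le_add_left (abs_sub _ _) _).trans ?_)
    linarith
  · refine Fin.cases ?_ (fun a => ?_) μ
    · rw [pd_zero_roundM, abs_zero]; linarith
    · rw [← pd_ggm_eq]; exact (h.pd_ggm a α β).trans (by linarith)
  · refine Fin.cases ?_ (fun a => ?_) μ
    · exact (hg.abs_pd_zero_ggr_le hφ hz h α β).trans (by linarith)
    · exact (h.pd_ggr a α β).trans (by linarith)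
  · obtain ⟨a, rfl⟩ := Fin.exists_succ_eq.2 hα
    obtain ⟨c, rfl⟩ := Fin.exists_succ_eq.2 hβ
    have h1 := h.rem a c
    rw [expRem_eq a c hz0, abs_mul, abs_of_pos hz0] at h1
    have h2 : |ggr g φ z a.succ c.succ - compI gb φ z a.succ c.succ| ≤ b * z 0 := by
      refine le_of_mul_le_mul_left (h1.trans (le_of_eq ?_)) hz0
      ring
    exact h2.trans (by gcongr; linarith)
  · filter_upwards [hnhds] with y hy
    exact hg.ggr_symm hy α β
  · have h1 : (fun y => ggr g φ y 0 β) =ᶠ[𝓝 z] fun _ => 0 := by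
      filter_upwards [hnhds] with y hy
      exact (hg.fefferman_graham φ hφ y hy β).1
    rw [pd_congr μ h1, pd_const]


end

section

variable {d : ℕ}

/-! ### The deformation tensor in coordinates -/

open Filter Topology

section derivatives

variable {z : Fin (d + 2) → ℝ}

lemma differentiableAt_coord_mul {a b : ℝ → ℝ} {a' b' : ℝ} (ha : HasDerivAt a a' (z 1))
    (hb : HasDerivAt b b' (z 0)) :
    DifferentiableAt ℝ (fun y : Fin (d + 2) → ℝ => a (y 1) * b (y 0)) z :=
  (differentiableAt_coord ha).fun_mul (differentiableAt_coord hb)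

lemma pd_coord_mul {a b : ℝ → ℝ} {a' b' : ℝ} (ha : HasDerivAt a a' (z 1))
    (hb : HasDerivAt b b' (z 0)) (α : Fin (d + 2)) :
    pd α (fun y : Fin (d + 2) → ℝ => a (y 1) * b (y 0)) z =
      (if α = 1 then a' else 0) * b (z 0) + a (z 1) * (if α = 0 then b' else 0) := by
  rw [pd_mul α (differentiableAt_coord ha) (differentiableAt_coord hb), pd_coord α ha,
    pd_coord α hb]

lemma hasDerivAt_cubic (ρ : ℝ) :
    HasDerivAt (fun x : ℝ => x * (1 - x ^ 2 / 4)) (1 - 3 / 4 * ρ ^ 2) ρ := by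
  have h1 := (hasDerivAt_id ρ).fun_mul (((hasDerivAt_pow 2 ρ).div_const 4).const_sub 1)
  simp only [id] at h1
  convert! h1 using 1
  simp; ring

lemma hasDerivAt_cubic_inv {ρ : ℝ} (hρ : 0 < ρ) (hρ' : ρ ≤ 1 / 4) :
    HasDerivAt (fun x : ℝ => (x * (1 - x ^ 2 / 4))⁻¹)
      (-((1 - 3 / 4 * ρ ^ 2) * (ρ * (1 - ρ ^ 2 / 4))⁻¹ ^ 2)) ρ := by
  have hm : 0 < ρ * (1 - ρ ^ 2 / 4) := mul_pos hρ (by nlinarith only [hρ, hρ'])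
  refine ((hasDerivAt_cubic ρ).fun_inv hm.ne').congr_deriv ?_
  field_simp

lemma hasDerivAt_cubic_inv_deriv {ρ : ℝ} (hρ : 0 < ρ) (hρ' : ρ ≤ 1 / 4) :
    HasDerivAt (fun x : ℝ => (1 - 3 / 4 * x ^ 2) * (x * (1 - x ^ 2 / 4))⁻¹ ^ 2)
      (-(3 / 2 * ρ * (ρ * (1 - ρ ^ 2 / 4))⁻¹ ^ 2
        + 2 * (1 - 3 / 4 * ρ ^ 2) ^ 2 * (ρ * (1 - ρ ^ 2 / 4))⁻¹ ^ 3)) ρ := by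
  have h1 := (((hasDerivAt_pow 2 ρ).const_mul (3 / 4)).const_sub 1).fun_mul
    ((hasDerivAt_cubic_inv hρ hρ').fun_pow 2)
  refine h1.congr_deriv ?_
  simp
  ring

lemma pd_fhatC (φ : Coord d) (hs : 0 < Real.sin (z 1)) (α : Fin (d + 2)) :
    pd α (fhatC φ) z = if α = 0 then (1 - 3 / 4 * z 0 ^ 2) / Real.sin (z 1)
      else if α = 1 then -(Real.cos (z 1) * fhatC φ z / Real.sin (z 1)) else 0 := by
  have h := pd_coord_mul ((Real.hasDerivAt_sin (z 1)).fun_inv hs.ne') (hasDerivAt_cubic (z 0)) α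
  refine Eq.trans h ?_
  by_cases hα : α = 0
  · subst hα
    simp
    field_simp
  · by_cases hα1 : α = 1
    · subst hα1
      simp [fhatC, fhat, pointM]
      field_simp
    · simp [hα, hα1]

lemma differentiableAt_fhatC (φ : Coord d) (hs : 0 < Real.sin (z 1)) :
    DifferentiableAt ℝ (fhatC φ) z :=
  differentiableAt_coord_mul ((Real.hasDerivAt_sin (z 1)).fun_inv hs.ne') (hasDerivAt_cubic (z 0))

lemma fhatC_eq_inv (φ : Coord d) : fhatC φ z = (Real.sin (z 1) * (z 0 * (1 - z 0 ^ 2 / 4))⁻¹)⁻¹ := by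
  rw [mul_inv, inv_inv]; rfl

lemma pd_fhatC_eq_du (φ : Coord d) (hρ : 0 < z 0) (hρ' : z 0 ≤ 1 / 4) (hs : 0 < Real.sin (z 1))
    (α : Fin (d + 2)) :
    pd α (fhatC φ) z = -(fhatC φ z ^ 2 * du (z 0) (Real.sin (z 1)) (Real.cos (z 1)) α) := by
  have hm : 4 - z 0 ^ 2 ≠ 0 := by nlinarith only [hρ, hρ']
  rw [pd_fhatC φ hs, du, fhatC_eq_inv]
  split_ifs
  · field_simp
  · field_simp
  · simp

lemma differentiableAt_du (hρ : 0 < z 0) (hρ' : z 0 ≤ 1 / 4) (β : Fin (d + 2)) :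
    DifferentiableAt ℝ
      (fun y : Fin (d + 2) → ℝ => du (y 0) (Real.sin (y 1)) (Real.cos (y 1)) β) z := by
  unfold du
  split_ifs
  · have := (differentiableAt_coord_mul (Real.hasDerivAt_sin (z 1))
      (hasDerivAt_cubic_inv_deriv hρ hρ')).fun_neg
    simpa only [mul_assoc] using this
  · exact differentiableAt_coord_mul (Real.hasDerivAt_cos (z 1)) (hasDerivAt_cubic_inv hρ hρ')
  · exact differentiableAt_const _

lemma pd_du (hρ : 0 < z 0) (hρ' : z 0 ≤ 1 / 4) (α β : Fin (d + 2)) :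
    pd α (fun y : Fin (d + 2) → ℝ => du (y 0) (Real.sin (y 1)) (Real.cos (y 1)) β) z
      = ddu (z 0) (Real.sin (z 1)) (Real.cos (z 1)) α β := by
  unfold du ddu
  have h10 := one_ne_zero' (d := d)
  by_cases hβ : β = 0
  · have h1 := pd_const_mul α (-1) (differentiableAt_coord_mul (Real.hasDerivAt_sin (z 1))
      (hasDerivAt_cubic_inv_deriv hρ hρ'))
    rw [pd_coord_mul (Real.hasDerivAt_sin (z 1)) (hasDerivAt_cubic_inv_deriv hρ hρ') α] at h1
    simp only [neg_mul, one_mul, ← mul_assoc] at h1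
    simp only [hβ, if_true, h1]
    by_cases hα : α = 0
    · simp [hα, h10.symm]
      ring
    · by_cases hα1 : α = 1 <;> simp [hα, hα1, mul_assoc]
  · by_cases hβ1 : β = 1
    · have h1 := pd_coord_mul (Real.hasDerivAt_cos (z 1)) (hasDerivAt_cubic_inv hρ hρ') α
      simp only [hβ1, if_true, h10, if_false, h1]
      by_cases hα : α = 0
      · simp [hα, h10.symm, mul_assoc]
      · by_cases hα1 : α = 1 <;> simp [hα, hα1]
    · simp only [hβ, hβ1, if_false, pd_const]

end derivatives

/-! ### Derivatives of the metric and the Christoffel contraction with `du`. -/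

variable {ρs : ℝ} {g : TensorM d} {gb : TensorI d} {Ξ : Set (Coord d)} {φ : Coord d}
  {z : Fin (d + 2) → ℝ}

/-- The derivatives of the metric components. -/
lemma IsBorderlineSegment.pd_compM (hg : IsBorderlineSegment ρs g gb Ξ) (hφ : φ ∈ Ξ)
    (hz : z ∈ coordDomain ρs φ) (μ α β : Fin (d + 2)) :
    pd μ (fun y => compM g φ y α β) z =
      (if μ = 0 then -(2 * (z 0)⁻¹ * compM g φ z α β) else 0) + (z 0 ^ 2)⁻¹ *
        dRescaled (z 0) (roundM φ z) (ggr g φ z) (fun μ α β => pd μ (fun y => roundM φ y α β) z)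
          (fun μ α β => pd μ (fun y => ggr g φ y α β) z) μ α β := by
  have hz0 : 0 < z 0 := hz.1
  have hnhds := (isOpen_coordDomain ρs φ).mem_nhds hz
  have hr := hg.differentiableAt_ggr hφ hz α β
  have hΓ := hg.differentiableAt_roundM hφ hz α β
  have d0 : HasDerivAt (fun t : ℝ => (t ^ 2)⁻¹) (-(2 * (z 0)⁻¹ * (z 0 ^ 2)⁻¹)) (z 0) := by
    refine ((hasDerivAt_pow 2 (z 0)).fun_inv (by positivity)).congr_deriv ?_
    field_simp
    norm_num
    ring
  have d1 : HasDerivAt (fun t : ℝ => dρ2 d α β - (1 + t ^ 2 / 2) * dt2 d α β)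
      (-z 0 * dt2 d α β) (z 0) := by
    refine ((((hasDerivAt_pow 2 (z 0)).div_const 2).const_add 1).mul_const
      (dt2 d α β)).const_sub (dρ2 d α β) |>.congr_deriv ?_
    simp
  have d2 : HasDerivAt (fun t : ℝ => 1 - t ^ 2 / 2) (-z 0) (z 0) := by
    refine ((hasDerivAt_pow 2 (z 0)).div_const 2).const_sub 1 |>.congr_deriv ?_
    simp
  have d3 : HasDerivAt (fun t : ℝ => t ^ 3) (3 * z 0 ^ 2) (z 0) := by
    refine (hasDerivAt_pow 3 (z 0)).congr_deriv ?_
    norm_num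
  have h1 : (fun y => compM g φ y α β) =ᶠ[𝓝 z] fun y => (y 0 ^ 2)⁻¹ *
      ((dρ2 d α β - (1 + y 0 ^ 2 / 2) * dt2 d α β) + (1 - y 0 ^ 2 / 2) * roundM φ y α β
        + y 0 ^ 3 * ggr g φ y α β) := by
    filter_upwards [hnhds] with y hy
    rw [compM_eq_pointMetric hy.1]
    change (y 0 ^ 2)⁻¹ * rescaled (y 0) (roundM φ y) (ggr g φ y) α β = _
    rw [rescaled_apply]
  have h2 : compM g φ z α β = _ := h1.self_of_nhds
  have e2 := (differentiableAt_coord d2).fun_mul hΓ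
  have e3 := (differentiableAt_coord d3).fun_mul hr
  have e4 := (differentiableAt_coord d1).fun_add e2
  rw [pd_congr μ h1, pd_mul μ (differentiableAt_coord d0) (e4.fun_add e3), pd_add μ e4 e3,
    pd_add μ (differentiableAt_coord d1) e2, pd_mul μ (differentiableAt_coord d2) hΓ,
    pd_mul μ (differentiableAt_coord d3) hr, pd_coord μ d0, pd_coord μ d1, pd_coord μ d2,
    pd_coord μ d3, h2]
  unfold dRescaled
  split_ifs <;> ring

/-- Contraction with the inverse matrix. -/
lemma bil_vecMul_inv {G : Matrix (Fin (d + 2)) (Fin (d + 2)) ℝ} (hG : IsUnit G.det)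
    (θ Y : Fin (d + 2) → ℝ) : bil G (θ ᵥ* G⁻¹) Y = θ ⬝ᵥ Y := by
  rw [bil_eq_dotProduct, Matrix.dotProduct_mulVec, Matrix.vecMul_vecMul,
    Matrix.nonsing_inv_mul _ hG, Matrix.vecMul_one]

lemma NearPoint.isUnit_det_pointMetric {B ρ : ℝ} {F : Type*} [NormedAddCommGroup F]
    [InnerProductSpace ℝ F] {L : (Fin (d + 2) → ℝ) →ₗ[ℝ] F}
    {R : Matrix (Fin (d + 2)) (Fin (d + 2)) ℝ} (h : NearPoint B ρ L R) :
    IsUnit (pointMetric ρ L R).det := by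
  have h1 := h.ρ_pos
  rw [pointMetric, Matrix.det_smul, isUnit_iff_ne_zero]
  exact mul_ne_zero (by positivity) h.isUnit_det.ne_zero

lemma grad_eq_vecMul (G : (Fin (d + 2) → ℝ) → Matrix (Fin (d + 2)) (Fin (d + 2)) ℝ)
    (u : (Fin (d + 2) → ℝ) → ℝ) (z : Fin (d + 2) → ℝ) :
    grad G u z = (fun α => pd α u z) ᵥ* (G z)⁻¹ := by
  funext β
  exact Finset.sum_congr rfl fun α _ => mul_comm _ _

/-- Lowering the index of the gradient. -/
lemma sum_grad {G : (Fin (d + 2) → ℝ) → Matrix (Fin (d + 2)) (Fin (d + 2)) ℝ}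
    (hG : IsUnit (G z).det) (hsymm : ∀ α β, G z α β = G z β α)
    (u : (Fin (d + 2) → ℝ) → ℝ) (a : ℝ) (β : Fin (d + 2)) :
    ∑ γ, G z β γ * (a * grad G u z γ) = a * pd β u z := by
  have h1 := bil_vecMul_inv hG (fun α => pd α u z) (Pi.single β 1)
  rw [← grad_eq_vecMul, bil_comm hsymm, bil_eq_dotProduct, single_one_dotProduct,
    dotProduct_single_one] at h1
  rw [← h1, Matrix.mulVec, dotProduct, Finset.mul_sum]
  exact Finset.sum_congr rfl fun γ _ => by ring

lemma sum_christoffel (G : (Fin (d + 2) → ℝ) → Matrix (Fin (d + 2)) (Fin (d + 2)) ℝ)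
    (α β : Fin (d + 2)) (S : Fin (d + 2) → ℝ) :
    ∑ γ, christoffel G γ α β z * S γ = 1 / 2 * ∑ δ, (S ᵥ* (G z)⁻¹) δ *
      (pd α (fun y => G y δ β) z + pd β (fun y => G y δ α) z - pd δ (fun y => G y α β) z) := by
  simp only [christoffel, Matrix.vecMul, dotProduct, Finset.mul_sum, Finset.sum_mul]
  rw [Finset.sum_comm]
  exact Finset.sum_congr rfl fun δ _ => Finset.sum_congr rfl fun γ _ => by ring

/-- The Christoffel symbols contracted with `du`. -/
lemma IsBorderlineSegment.sum_christoffel_du (hg : IsBorderlineSegment ρs g gb Ξ) (hφ : φ ∈ Ξ)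
    (hz : z ∈ coordDomain ρs φ) {B s c ζ : ℝ}
    (h : NearPoint B (z 0) (diffS φ z) (ggr g φ z)) {b : Matrix (Fin (d + 2)) (Fin (d + 2)) ℝ}
    (j : JetBounds B (z 0) (gramM (diffS φ z)) (ggr g φ z) b
      (fun μ α β => pd μ (fun y => roundM φ y α β) z)
      (fun μ α β => pd μ (fun y => ggr g φ y α β) z)) {w : Fin (d + 2) → ℝ}
    (hw : ∀ Y, bil (rescaled (z 0) (gramM (diffS φ z)) (ggr g φ z)) w Y = Y 1)
    (α β : Fin (d + 2)) :
    ddu (z 0) s c α β - ∑ γ, christoffel (compM g φ) γ α β z * du (z 0) s c γ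
      - s * (z 0 * (1 - z 0 ^ 2 / 4))⁻¹ * (1 + z 0 ^ 3 * ζ) * compM g φ z α β =
    hessQ (z 0) s c ζ w (gramM (diffS φ z)) (ggr g φ z)
      (fun μ α β => pd μ (fun y => roundM φ y α β) z)
      (fun μ α β => pd μ (fun y => ggr g φ y α β) z) α β := by
  have hz0 : 0 < z 0 := hz.1
  have hG := compM_eq_pointMetric (g := g) (φ := φ) hz0
  have hdet : IsUnit (compM g φ z).det := by rw [hG]; exact h.isUnit_det_pointMetric
  have hsymm : ∀ α β, compM g φ z α β = compM g φ z β α := fun α β => by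
    have := h.bil_pointMetric_comm (Pi.single α 1) (Pi.single β 1)
    rwa [bil_single, bil_single, ← hG] at this
  set u : Fin (d + 2) → ℝ := du (z 0) s c with hu
  set dH := dRescaled (z 0) (gramM (diffS φ z)) (ggr g φ z)
    (fun μ α β => pd μ (fun y => roundM φ y α β) z)
    (fun μ α β => pd μ (fun y => ggr g φ y α β) z) with hdH
  set W := u ᵥ* (compM g φ z)⁻¹ with hW
  have hWY : ∀ Y, bil (pointMetric (z 0) (diffS φ z) (ggr g φ z)) W Y = u 0 * Y 0 + u 1 * Y 1 := by
    intro Y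
    rw [← hG, hW, bil_vecMul_inv hdet, dotProduct, Fin.sum_univ_succ, Fin.sum_univ_succ]
    have : ∀ A : Fin d, u A.succ.succ = 0 := fun A => by
      have h1 : A.succ.succ ≠ (1 : Fin (d + 2)) := by
        rw [← Fin.succ_zero_eq_one]; exact fun h => Fin.succ_ne_zero _ (Fin.succ_injective _ h)
      rw [hu, du, if_neg (Fin.succ_ne_zero _), if_neg h1]
    simp [this]
  -- The gradient of `u` is `ρ² (u_ρ ∂_ρ + u_t w)`, so the inverse metric never has to be computed.
  have hWw := h.eq_of_dual hWY hw
  set k : Fin (d + 2) → ℝ := fun μ => if μ = 0 then 1 else 0 with hk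
  have hWδ : ∀ δ, W δ = z 0 ^ 2 * (u 0 * k δ + u 1 * w δ) := fun δ => by
    rw [hWw]
    simp only [Pi.add_apply, Pi.smul_apply, Pi.single_apply, smul_eq_mul, hk]
    ring
  have hWG : ∀ β, ∑ δ, W δ * compM g φ z δ β = u β := fun β => by
    have h1 := bil_vecMul_inv hdet u (Pi.single β 1)
    rw [dotProduct_single_one, ← hW, bil_eq_dotProduct, Matrix.dotProduct_mulVec,
      dotProduct_single_one] at h1
    exact h1
  have hpd : ∀ μ α β, pd μ (fun y => compM g φ y α β) z =
      -(2 * (z 0)⁻¹) * k μ * compM g φ z α β + (z 0 ^ 2)⁻¹ * dH μ α β := fun μ α β => by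
    rw [hg.pd_compM hφ hz, roundM_eq_gramM, ← hdH]
    simp only [hk]
    split_ifs <;> ring
  have h0 : z 0 ^ 2 * (z 0 ^ 2)⁻¹ = 1 := mul_inv_cancel₀ (by positivity)
  -- The terms with `2 (z 0)⁻¹` come from differentiating the conformal factor `ρ⁻²`; the last two
  -- contain the derivatives of the rescaled metric.
  have hterm : ∀ δ, W δ * (pd α (fun y => compM g φ y δ β) z + pd β (fun y => compM g φ y δ α) z
      - pd δ (fun y => compM g φ y α β) z) =
      -(2 * (z 0)⁻¹) * k α * (W δ * compM g φ z δ β)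
      + -(2 * (z 0)⁻¹) * k β * (W δ * compM g φ z δ α)
      + 2 * (z 0)⁻¹ * compM g φ z α β * (k δ * W δ)
      + u 0 * (k δ * (dH α δ β + dH β δ α - dH δ α β))
      + u 1 * (w δ * (dH α δ β + dH β δ α - dH δ α β)) := by
    intro δ
    rw [hpd, hpd, hpd]
    linear_combination ((z 0 ^ 2)⁻¹ * (dH α δ β + dH β δ α - dH δ α β)) * hWδ δ
      + (u 0 * k δ + u 1 * w δ) * (dH α δ β + dH β δ α - dH δ α β) * h0
  have hksum : ∀ v : Fin (d + 2) → ℝ, ∑ δ, k δ * v δ = v 0 := fun v => by simp [hk]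
  have hw0 : w 0 = 0 := by
    have h1 := hw (Pi.single 0 1)
    rw [bil_rescaled, h.map_zero, bil_comm h.symm, h.bil_zero] at h1
    simpa using h1
  have hW0 : W 0 = z 0 ^ 2 * u 0 := by rw [hWδ, hw0]; simp [hk]
  have hd0 : ∀ μ β, dH μ 0 β = 0 := j.dRescaled_zero
  have hdual : dualSum (z 0) w (gramM (diffS φ z)) (ggr g φ z)
      (fun μ α β => pd μ (fun y => roundM φ y α β) z)
      (fun μ α β => pd μ (fun y => ggr g φ y α β) z) α β =
      ∑ δ, w δ * (dH α δ β + dH β δ α - dH δ α β) := rfl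
  have hsum : ∑ γ, christoffel (compM g φ) γ α β z * u γ =
      1 / 2 * (-(2 * (z 0)⁻¹) * k α * u β + -(2 * (z 0)⁻¹) * k β * u α
        + 2 * (z 0)⁻¹ * compM g φ z α β * (z 0 ^ 2 * u 0) - u 0 * dH 0 α β
        + u 1 * dualSum (z 0) w (gramM (diffS φ z)) (ggr g φ z)
          (fun μ α β => pd μ (fun y => roundM φ y α β) z)
          (fun μ α β => pd μ (fun y => ggr g φ y α β) z) α β) := by
    rw [sum_christoffel, ← hW]
    simp only [hterm, Finset.sum_add_distrib, ← Finset.mul_sum, hWG, hksum, hW0]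
    rw [hd0, hd0, hdual]
    ring
  have hcomp : compM g φ z α β =
      (z 0 ^ 2)⁻¹ * rescaled (z 0) (gramM (diffS φ z)) (ggr g φ z) α β := by rw [hG]; rfl
  have hif : ∀ (γ : Fin (d + 2)) (x : ℝ), (if γ = 0 then x else 0) = k γ * x := fun γ x => by
    simp [hk]
  unfold hessQ
  rw [hsum, hcomp, hif, hif, ← hu, ← hdH]
  linear_combination (-(z 0)⁻¹ * u 0 *
    rescaled (z 0) (gramM (diffS φ z)) (ggr g φ z) α β) * h0

end

section

variable {d : ℕ}

/-! ### The deformation tensor in terms of the Hessian of the inverse of the foliation function -/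

open Filter Topology

section deformation

variable {ρs : ℝ} {g : TensorM d} {gb : TensorI d} {Ξ : Set (Coord d)} {φ : Coord d}
  {z : Fin (d + 2) → ℝ} {B : ℝ}

lemma NearPoint.compM_symm (hz0 : 0 < z 0) (h : NearPoint B (z 0) (diffS φ z) (ggr g φ z))
    (α β : Fin (d + 2)) : compM g φ z α β = compM g φ z β α := by
  have := h.bil_pointMetric_comm (Pi.single α 1) (Pi.single β 1)
  rwa [bil_single, bil_single, ← compM_eq_pointMetric hz0] at this

lemma fhatC_pos (φ : Coord d) (hρ : 0 < z 0) (hρ' : z 0 ≤ 1 / 4) (hs : 0 < Real.sin (z 1)) :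
    0 < fhatC φ z := by
  have h1 : 0 < 1 - z 0 ^ 2 / 4 := by nlinarith only [hρ, hρ']
  change 0 < (Real.sin (z 1))⁻¹ * (z 0 * (1 - z 0 ^ 2 / 4))
  positivity

lemma zpow_bdim_sub_three {f : ℝ} (hf : 0 < f) : f ^ (bdim d - 3) * f ^ 2 = f ^ d := by
  rw [← zpow_natCast f 2, ← zpow_add₀ hf.ne', ← zpow_natCast]
  congr 1
  simp only [bdim]
  push_cast
  ring

/-- The components of `Ŝ` with lower indices. -/
lemma NearPoint.sum_Shat (hz0 : 0 < z 0) (hs : 0 < Real.sin (z 1))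
    (h : NearPoint B (z 0) (diffS φ z) (ggr g φ z)) (β : Fin (d + 2)) :
    ∑ γ, compM g φ z β γ * Shat g φ z γ =
      -(fhatC φ z ^ d * du (z 0) (Real.sin (z 1)) (Real.cos (z 1)) β) := by
  have hG := compM_eq_pointMetric (g := g) (φ := φ) hz0
  have hdet : IsUnit (compM g φ z).det := by rw [hG]; exact h.isUnit_det_pointMetric
  refine (sum_grad hdet (h.compM_symm hz0) (fhatC φ) (fhatC φ z ^ (bdim d - 3)) β).trans ?_
  rw [pd_fhatC_eq_du φ hz0 h.ρ_le hs, ← zpow_bdim_sub_three (d := d) (fhatC_pos φ hz0 h.ρ_le hs)]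
  ring

/-- The deformation tensor is the Hessian of `1 / f̂` up to a term in the normal direction. -/
lemma IsBorderlineSegment.deform_eq (hg : IsBorderlineSegment ρs g gb Ξ) (hφ : φ ∈ Ξ)
    (hz : z ∈ coordDomain ρs φ)
    (hn : ∀ᶠ y in 𝓝 z, NearPoint B (y 0) (diffS φ y) (ggr g φ y))
    {b : Matrix (Fin (d + 2)) (Fin (d + 2)) ℝ}
    (j : JetBounds B (z 0) (gramM (diffS φ z)) (ggr g φ z) b
      (fun μ α β => pd μ (fun y => roundM φ y α β) z)
      (fun μ α β => pd μ (fun y => ggr g φ y α β) z)) {w : Fin (d + 2) → ℝ}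
    (hw : ∀ Y, bil (rescaled (z 0) (gramM (diffS φ z)) (ggr g φ z)) w Y = Y 1)
    (ζ : ℝ × ℝ × Sph d → ℝ) (α β : Fin (d + 2)) :
    deform g ζ φ z α β =
      -(d * fhatC φ z ^ (d + 1) * (du (z 0) (Real.sin (z 1)) (Real.cos (z 1)) α
        * du (z 0) (Real.sin (z 1)) (Real.cos (z 1)) β))
      + fhatC φ z ^ d * hessQ (z 0) (Real.sin (z 1)) (Real.cos (z 1)) (ζ (pointM φ z)) w
          (gramM (diffS φ z)) (ggr g φ z)
          (fun μ α β => pd μ (fun y => roundM φ y α β) z)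
          (fun μ α β => pd μ (fun y => ggr g φ y α β) z) α β := by
  have hz0 : 0 < z 0 := hz.1
  have hs : 0 < Real.sin (z 1) := Real.sin_pos_of_pos_of_lt_pi hz.2.2.1 hz.2.2.2.1
  have h := hn.self_of_nhds
  have hf := fhatC_pos φ hz0 h.ρ_le hs
  -- This identity is about to be differentiated, so it is needed on a neighbourhood, not only at
  -- `z`.
  have hS : (fun y => ∑ γ, compM g φ y β γ * Shat g φ y γ) =ᶠ[𝓝 z] fun y =>
      (-1) * (fhatC φ y ^ d * du (y 0) (Real.sin (y 1)) (Real.cos (y 1)) β) := by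
    filter_upwards [hn, (isOpen_coordDomain ρs φ).mem_nhds hz] with y hy hy'
    rw [hy.sum_Shat hy'.1 (Real.sin_pos_of_pos_of_lt_pi hy'.2.2.1 hy'.2.2.2.1)]
    ring
  have hdf := differentiableAt_fhatC φ hs
  have hdfd : DifferentiableAt ℝ (fun y => fhatC φ y ^ d) z := hdf.pow d
  have hddu := differentiableAt_du hz0 h.ρ_le β
  -- For `d = 0` the truncated exponent `d - 1` is harmless because of the factor `d`.
  have hpow : (d : ℝ) * fhatC φ z ^ (d - 1) * fhatC φ z ^ 2 = d * fhatC φ z ^ (d + 1) := by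
    rcases d with _ | d
    · simp
    · simp only [Nat.add_sub_cancel]; ring
  have hpd : pd α (fun y => ∑ γ, compM g φ y β γ * Shat g φ y γ) z =
      d * fhatC φ z ^ (d + 1) * (du (z 0) (Real.sin (z 1)) (Real.cos (z 1)) α
        * du (z 0) (Real.sin (z 1)) (Real.cos (z 1)) β)
      - fhatC φ z ^ d * ddu (z 0) (Real.sin (z 1)) (Real.cos (z 1)) α β := by
    rw [pd_congr α hS, pd_const_mul α _ (hdfd.fun_mul hddu), pd_mul α hdfd hddu, pd_pow α d hdf,
      pd_du hz0 h.ρ_le, pd_fhatC_eq_du φ hz0 h.ρ_le hs, ← hpow]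
    ring
  have hfinv : fhatC φ z * (Real.sin (z 1) * (z 0 * (1 - z 0 ^ 2 / 4))⁻¹) = 1 := by
    have h1 := fhatC_eq_inv (z := z) φ
    rw [h1]
    refine inv_mul_cancel₀ fun h2 => ?_
    rw [h2, inv_zero] at h1
    exact hf.ne' h1
  have hwhat : fhatC φ z ^ (bdim d - 3) * what ζ φ z = fhatC φ z ^ d *
      (Real.sin (z 1) * (z 0 * (1 - z 0 ^ 2 / 4))⁻¹ * (1 + z 0 ^ 3 * ζ (pointM φ z))) := by
    rw [← zpow_bdim_sub_three hf, what]
    linear_combination (-(fhatC φ z ^ (bdim d - 3) * fhatC φ z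
      * (1 + z 0 ^ 3 * ζ (pointM φ z)))) * hfinv
  rw [← hg.sum_christoffel_du hφ hz h j hw α β]
  change -((pd α (fun y => ∑ γ, compM g φ y β γ * Shat g φ y γ) z
    - ∑ γ, christoffel (compM g φ) γ α β z * ∑ δ, compM g φ z γ δ * Shat g φ z δ)
    + fhatC φ z ^ (bdim d - 3) * what ζ φ z * compM g φ z α β) = _
  rw [hpd, hwhat]
  simp only [h.sum_Shat hz0 hs]
  have hsum : ∑ γ, christoffel (compM g φ) γ α β z *
      -(fhatC φ z ^ d * du (z 0) (Real.sin (z 1)) (Real.cos (z 1)) γ) =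
      -(fhatC φ z ^ d) * ∑ γ, christoffel (compM g φ) γ α β z *
        du (z 0) (Real.sin (z 1)) (Real.cos (z 1)) γ := by
    rw [Finset.mul_sum]
    exact Finset.sum_congr rfl fun γ _ => by ring
  rw [hsum]
  ring

lemma deformUp_eq_bil (g : TensorM d) (ζ : ℝ × ℝ × Sph d → ℝ) (φ : Coord d)
    (z θ : Fin (d + 2) → ℝ) : deformUp g ζ φ z θ =
      bil (deform g ζ φ z) (θ ᵥ* (compM g φ z)⁻¹) (θ ᵥ* (compM g φ z)⁻¹) := by
  set I := (compM g φ z)⁻¹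
  set D := deform g ζ φ z
  have h1 : bil D (θ ᵥ* I) (θ ᵥ* I) = bil (I * D * Iᵀ) θ θ := by
    rw [bil_eq_dotProduct, bil_eq_dotProduct, ← Matrix.dotProduct_mulVec, ← Matrix.mulVec_transpose,
      Matrix.mulVec_mulVec, Matrix.mulVec_mulVec, Matrix.mul_assoc]
  have h2 : ∀ α β, (I * D * Iᵀ) α β = ∑ μ, ∑ ν, I α μ * I β ν * D μ ν := fun α β => by
    simp only [Matrix.mul_apply, Matrix.transpose_apply, Finset.sum_mul]
    rw [Finset.sum_comm]
    exact Finset.sum_congr rfl fun μ _ => Finset.sum_congr rfl fun ν _ => by ring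
  rw [h1, bil_eq_sum]
  simp only [h2]
  rfl

end deformation

end

section

variable {d : ℕ}

/-! ### The lower bound in coordinates -/

open Filter Topology

section bound

variable {ρs : ℝ} {g : TensorM d} {gb : TensorI d} {Ξ : Set (Coord d)} {φ : Coord d}
  {z : Fin (d + 2) → ℝ} {b : ℝ}

lemma succ_succ_ne_one (A : Fin d) : A.succ.succ ≠ (1 : Fin (d + 2)) := by
  rw [← Fin.succ_zero_eq_one]
  exact fun h => Fin.succ_ne_zero _ (Fin.succ_injective _ h)

lemma sum_gm_sphere (φ : Coord d) (z X : Fin (d + 2) → ℝ) :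
    ∑ A : Fin d, ∑ B : Fin d, gm φ z A.succ.succ B.succ.succ * X A.succ.succ * X B.succ.succ =
      ‖diffS φ z X‖ ^ 2 := by
  rw [← real_inner_self_eq_norm_sq, ← bil_gramM, ← roundM_eq_gramM, bil_eq_sum]
  have h1 : ∀ α, roundM φ z α 0 = 0 := fun α => by rw [roundM_symm, roundM_zero]
  have h2 : ∀ α, roundM φ z α 1 = 0 := fun α => by rw [roundM_symm, roundM_one]
  have h3 : ∀ A B : Fin d, gm φ z A.succ.succ B.succ.succ = roundM φ z A.succ.succ B.succ.succ :=
    fun A B => by simp [gm, dt2_apply, succ_succ_ne_one]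
  simp only [h3, Fin.sum_univ_succ (n := d + 1), Fin.sum_univ_succ (n := d),
    Fin.succ_zero_eq_one, h1, h2, roundM_zero, roundM_one, zero_mul, zero_add,
    Finset.sum_const_zero]

lemma BorderlinePseudoconvex.positive_bil {K : ℝ} {ζ : ℝ × ℝ × Sph d → ℝ}
    (p : BorderlinePseudoconvex ρs gb Ξ K ζ) (hφ : φ ∈ Ξ) (hz : z ∈ coordDomain ρs φ)
    (X : Fin (d + 2) → ℝ) (hX : X 0 = 0) : K * (X 1 ^ 2 + ‖diffS φ z X‖ ^ 2) ≤
      bil (fun α β => -(3 / 2) * compI gb φ z α β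
        - ζ (pointM φ z) * (-dt2 d α β + gramM (diffS φ z) α β)) X X := by
  have h1 := p.positive φ hφ z hz X hX
  rw [sum_gm_sphere] at h1
  exact h1.trans_eq (bil_eq_sum _ X X).symm

lemma foliationPoint (hz : z ∈ coordDomain ρs φ) (hρ : z 0 ≤ 1 / 4) (hf : fhatC φ z ≤ 1 / 8) :
    FoliationPoint (z 0) (Real.sin (z 1)) (Real.cos (z 1)) (fhatC φ z) := by
  have hs : 0 < Real.sin (z 1) := Real.sin_pos_of_pos_of_lt_pi hz.2.2.1 hz.2.2.2.1
  refine ⟨hs, Real.sin_sq_add_cos_sq _, fhatC_pos φ hz.1 hρ hs, ?_, hf⟩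
  change (Real.sin (z 1))⁻¹ * (z 0 * (1 - z 0 ^ 2 / 4)) * Real.sin (z 1) = _
  field_simp

lemma pair_eq_bil {G : Matrix (Fin (d + 2)) (Fin (d + 2)) ℝ} (hG : IsUnit G.det)
    (θ Y : Fin (d + 2) → ℝ) : pair θ Y = bil G (θ ᵥ* G⁻¹) Y := (bil_vecMul_inv hG θ Y).symm

lemma NearPoint.isGrad {B : ℝ} (h : NearPoint B (z 0) (diffS φ z) (ggr g φ z))
    (hs : 0 < Real.sin (z 1)) :
    IsGrad (z 0) (Real.sin (z 1)) (Real.cos (z 1)) (fhatC φ z) (diffS φ z) (ggr g φ z)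
      (grad (compM g φ) (fhatC φ) z) := by
  intro Y
  have hG := compM_eq_pointMetric (g := g) (φ := φ) h.ρ_pos
  have hdet : IsUnit (compM g φ z).det := by rw [hG]; exact h.isUnit_det_pointMetric
  rw [← hG, grad_eq_vecMul, bil_vecMul_inv hdet, dotProduct]
  simp only [pd_fhatC φ hs, Fin.sum_univ_succ (n := d + 1), Fin.sum_univ_succ (n := d),
    Fin.succ_zero_eq_one, if_true, Fin.succ_ne_zero, succ_succ_ne_one, if_false,
    zero_mul, Finset.sum_const_zero]
  ring

lemma IsHorizontalFrame.isFrame {E : Fin d → Fin (d + 2) → ℝ} (hz : 0 < z 0)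
    (e : IsHorizontalFrame g φ z E) : IsFrame (z 0) (diffS φ z) (ggr g φ z) E := by
  refine ⟨fun X => (e.1 X).1, fun X => (e.1 X).2, fun X Y => ?_⟩
  rw [← compM_eq_pointMetric hz, ← innerAt_eq_bil]
  exact e.2 X Y

lemma Vcheck_eq (hz : 0 < z 0) (E : Fin d → Fin (d + 2) → ℝ) :
    Vcheck g φ z E = checkV (z 0) (Real.cos (z 1)) (fhatC φ z) (diffS φ z) (ggr g φ z) E := by
  unfold Vcheck checkV
  simp only [innerAt_eq_bil, compM_eq_pointMetric hz]
  rfl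

/-- The normal component of the deformation tensor. -/
lemma NearPoint.normal_le {B : ℝ} (h : NearPoint B (z 0) (diffS φ z) (ggr g φ z))
    (k : FoliationPoint (z 0) (Real.sin (z 1)) (Real.cos (z 1)) (fhatC φ z))
    (θ : Fin (d + 2) → ℝ) :
    d * fhatC φ z ^ (d + 1) * (∑ α, du (z 0) (Real.sin (z 1)) (Real.cos (z 1)) α
      * (θ ᵥ* (compM g φ z)⁻¹) α) ^ 2 ≤
    (d * (fhatC φ z ^ d / fhatC φ z) + 10 * d * fhatC φ z ^ (d + 1)) * pair θ (Nhat g φ z) ^ 2 := by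
  have hG := compM_eq_pointMetric (g := g) (φ := φ) h.ρ_pos
  have hdet : IsUnit (compM g φ z).det := by rw [hG]; exact h.isUnit_det_pointMetric
  have hf := k.f_pos
  set v := θ ᵥ* (compM g φ z)⁻¹
  set W := grad (compM g φ) (fhatC φ) z with hW
  have hb := (abs_le.1 (h.grad_bounds k (h.isGrad k.s_pos)).2.2).2
  have hb' := h.grad_sq_bounds k (h.isGrad k.s_pos)
  rw [← hW, ← hG] at hb hb'
  set q := bil (compM g φ z) W W with hq
  have hq0 : 0 < q := lt_of_lt_of_le (by positivity) hb'
  have h1 : bil (compM g φ z) v W =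
      -(fhatC φ z ^ 2 * ∑ α, du (z 0) (Real.sin (z 1)) (Real.cos (z 1)) α * v α) := by
    rw [BorderlineAdS.bil_comm (h.compM_symm h.ρ_pos), hW, grad_eq_vecMul, bil_vecMul_inv hdet, dotProduct,
      Finset.mul_sum, ← Finset.sum_neg_distrib]
    refine Finset.sum_congr rfl fun α _ => ?_
    rw [pd_fhatC_eq_du φ h.ρ_pos h.ρ_le k.s_pos]
    ring
  set D := ∑ α, du (z 0) (Real.sin (z 1)) (Real.cos (z 1)) α * v α with hD
  -- `θ(N̂)` is `df̂(v) / |grad f̂|`, and `df̂ = -f̂² du`.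
  have h2 : pair θ (Nhat g φ z) ^ 2 * q = (fhatC φ z ^ 2 * D) ^ 2 := by
    have h3 : Nhat g φ z = (Real.sqrt |q|)⁻¹ • W := by
      simp only [Nhat, innerAt_eq_bil]
      rfl
    rw [pair_eq_bil hdet, h3, map_smul, h1, smul_eq_mul, mul_pow, inv_pow,
      Real.sq_sqrt (abs_nonneg q), abs_of_pos hq0]
    field_simp
  have h4 : (fhatC φ z ^ 2 * D) ^ 2 ≤
      (fhatC φ z ^ 2 + 10 * fhatC φ z ^ 4) * pair θ (Nhat g φ z) ^ 2 := by
    rw [← h2, mul_comm]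
    gcongr
    linarith only [hb]
  have h5 : (d : ℝ) * fhatC φ z ^ (d + 1) * D ^ 2 =
      d * fhatC φ z ^ d / fhatC φ z ^ 3 * (fhatC φ z ^ 2 * D) ^ 2 := by
    field_simp
    ring
  calc _ = _ := h5
    _ ≤ d * fhatC φ z ^ d / fhatC φ z ^ 3 *
      ((fhatC φ z ^ 2 + 10 * fhatC φ z ^ 4) * pair θ (Nhat g φ z) ^ 2) := by gcongr
    _ = _ := by
      field_simp
      ring

/-- The constant in the bounds for the components of the deformation tensor. -/
def deformConst (d : ℕ) (b Z : ℝ) : ℝ :=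
  300 * (d + 2) ^ 2 * (40 * (d + 2) * pointConst d b ^ 3 + 4 * Z * pointConst d b)
    * pointConst d b ^ 2

/-- The `du ⊗ du` part is handled by `normal_le`, the Hessian part by `f̂^d` times `frame_estimate`.
Strictness in `4 B ρ < 1` keeps the pointwise hypotheses valid nearby, as the differentiation of `Ŝ`
requires. -/
lemma IsBorderlineSegment.deformUp_ge (hg : IsBorderlineSegment ρs g gb Ξ) (hφ : φ ∈ Ξ)
    (hc : ∀ y ∈ coordDomain ρs φ, CoeffBounds b g gb φ y) (hz : z ∈ coordDomain ρs φ)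
    (hρ : 4 * pointConst d b * z 0 < 1) (hf : fhatC φ z ≤ 1 / 8) {K Z : ℝ}
    {ζ : ℝ × ℝ × Sph d → ℝ} (p : BorderlinePseudoconvex ρs gb Ξ K ζ) (hζ : |ζ (pointM φ z)| ≤ Z)
    {E : Fin d → Fin (d + 2) → ℝ} (e : IsHorizontalFrame g φ z E) (θ : Fin (d + 2) → ℝ) :
    (K * fhatC φ z ^ (bdim d - 2) * z 0 ^ 3
        + -(53 * K + deformConst d b Z) * (fhatC φ z ^ d * z 0 ^ 3))
        * (pair θ (Vhat g φ z E) ^ 2 + ∑ X, pair θ (E X) ^ 2)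
      - (((bdim d - 1 : ℤ) : ℝ) * fhatC φ z ^ (bdim d - 2)
        + (deformConst d b Z + 10 * d) * fhatC φ z ^ (d + 1)) * pair θ (Nhat g φ z) ^ 2 ≤
      deformUp g ζ φ z θ := by
  have hnear : ∀ᶠ y in 𝓝 z, NearPoint (pointConst d b) (y 0) (diffS φ y) (ggr g φ y) := by
    have h1 : ∀ᶠ y : Fin (d + 2) → ℝ in 𝓝 z, 4 * pointConst d b * y 0 < 1 :=
      (continuous_const.mul (continuous_apply 0)).continuousAt.eventually_lt_const hρ
    filter_upwards [h1, (isOpen_coordDomain ρs φ).mem_nhds hz] with y hy hy'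
    exact hg.nearPoint hφ hy' (hc y hy') hy.le
  have h := hnear.self_of_nhds
  have j := hg.jetBounds hφ hz (hc z hz)
  have k := foliationPoint hz h.ρ_le hf
  have hG := compM_eq_pointMetric (g := g) (φ := φ) h.ρ_pos
  have hdet : IsUnit (compM g φ z).det := by rw [hG]; exact h.isUnit_det_pointMetric
  have hf0 := k.f_pos
  obtain ⟨w, hw, -⟩ := h.exists_dual_dt
  have q := h.deformBounds j k.s_pos.le (Real.sin_le_one _) (Real.abs_cos_le_one (z 1)) hζ p.K_pos hw
    fun X hX => p.positive_bil hφ hz X hX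
  have hfr := h.frame_estimate k q (h.isGrad k.s_pos) (N := Nhat g φ z)
    (by simp only [Nhat, innerAt_eq_bil, hG]) (e.isFrame h.ρ_pos) (V := Vhat g φ z E)
    (by simp only [Vhat, innerAt_eq_bil, hG, Vcheck_eq h.ρ_pos]) (θ ᵥ* (compM g φ z)⁻¹)
  simp only [← hG, ← pair_eq_bil hdet] at hfr
  have hno := h.normal_le k θ
  rw [deformUp_eq_bil]
  set v := θ ᵥ* (compM g φ z)⁻¹
  have hbil : bil (deform g ζ φ z) v v =
      -(d * fhatC φ z ^ (d + 1) * (∑ α, du (z 0) (Real.sin (z 1)) (Real.cos (z 1)) α * v α) ^ 2)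
      + fhatC φ z ^ d * bil (hessQ (z 0) (Real.sin (z 1)) (Real.cos (z 1)) (ζ (pointM φ z)) w
          (gramM (diffS φ z)) (ggr g φ z)
          (fun μ α β => pd μ (fun y => roundM φ y α β) z)
          (fun μ α β => pd μ (fun y => ggr g φ y α β) z)) v v := by
    rw [bil_eq_sum, bil_eq_sum, sq, Finset.sum_mul_sum]
    simp only [hg.deform_eq hφ hz hnear j hw ζ, Finset.mul_sum, ← Finset.sum_neg_distrib,
      ← Finset.sum_add_distrib]
    exact Finset.sum_congr rfl fun α _ => Finset.sum_congr rfl fun β _ => by ring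
  rw [hbil]
  have hz2 : fhatC φ z ^ (bdim d - 2) = fhatC φ z ^ d / fhatC φ z := by
    rw [eq_div_iff hf0.ne', ← zpow_natCast, ← zpow_add_one₀ hf0.ne']
    congr 1
    simp only [bdim]
    ring
  have hd : ((bdim d - 1 : ℤ) : ℝ) = d := by simp [bdim]
  have hfr' := mul_le_mul_of_nonneg_left hfr (by positivity : 0 ≤ fhatC φ z ^ d)
  rw [hz2, hd]
  refine le_trans (le_of_eq ?_) (add_le_add (neg_le_neg hno) hfr')
  unfold deformConst
  field_simp
  ring

end bound

end

section

variable {d : ℕ}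

/-! ### Error terms with controlled derivatives -/

open Filter Topology

section error

/-- `u` is smooth on `D`, and its derivatives up to order `m` are bounded as in `𝒪₀(h)`. -/
def DerivBound (D : Set (Fin (d + 2) → ℝ)) :
    ℕ → ((Fin (d + 2) → ℝ) → ℝ) → ((Fin (d + 2) → ℝ) → ℝ) → Prop
  | 0, u, h => ContDiffOn ℝ ∞ u D ∧ ∃ C, 0 ≤ C ∧ ∀ z ∈ D, |u z| ≤ C * h z
  | m + 1, u, h => (ContDiffOn ℝ ∞ u D ∧ ∃ C, 0 ≤ C ∧ ∀ z ∈ D, |u z| ≤ C * h z) ∧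
      ∀ α, DerivBound D m (pd α u) (fun z => (z 0)⁻¹ * h z)

variable {D : Set (Fin (d + 2) → ℝ)} {m : ℕ} {u v h k : (Fin (d + 2) → ℝ) → ℝ}

lemma DerivBound.base (hu : DerivBound D m u h) :
    ContDiffOn ℝ ∞ u D ∧ ∃ C, 0 ≤ C ∧ ∀ z ∈ D, |u z| ≤ C * h z := by
  cases m with
  | zero => exact hu
  | succ m => exact hu.1

lemma DerivBound.differentiableAt (hD : IsOpen D) (hu : DerivBound D m u h)
    {z : Fin (d + 2) → ℝ} (hz : z ∈ D) : DifferentiableAt ℝ u z :=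
  (hu.base.1.contDiffAt (hD.mem_nhds hz)).differentiableAt (by simp)

lemma DerivBound.congr (hD : IsOpen D) (hu : DerivBound D m u h) (huv : EqOn v u D) :
    DerivBound D m v h := by
  induction m generalizing u v h with
  | zero =>
    obtain ⟨h1, C, hC, h2⟩ := hu
    exact ⟨h1.congr huv, C, hC, fun z hz => by rw [huv hz]; exact h2 z hz⟩
  | succ m ih =>
    obtain ⟨⟨h1, C, hC, h2⟩, h3⟩ := hu
    refine ⟨⟨h1.congr huv, C, hC, fun z hz => by rw [huv hz]; exact h2 z hz⟩, fun α => ?_⟩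
    refine ih (h3 α) fun z hz => pd_congr α ?_
    filter_upwards [hD.mem_nhds hz] with y hy using huv hy

lemma DerivBound.mono (hD : ∀ z ∈ D, 0 < z 0) (hu : DerivBound D m u h) {a : ℝ} (ha : 0 ≤ a)
    (hk : ∀ z ∈ D, h z ≤ a * k z) : DerivBound D m u k := by
  induction m generalizing u h k with
  | zero =>
    obtain ⟨h1, C, hC, h2⟩ := hu
    refine ⟨h1, C * a, by positivity, fun z hz => (h2 z hz).trans ?_⟩
    rw [mul_assoc]
    gcongr
    exact hk z hz
  | succ m ih =>
    obtain ⟨⟨h1, C, hC, h2⟩, h3⟩ := hu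
    refine ⟨⟨h1, C * a, by positivity, fun z hz => (h2 z hz).trans ?_⟩, fun α => ?_⟩
    · rw [mul_assoc]
      gcongr
      exact hk z hz
    · refine ih (h3 α) fun z hz => ?_
      have h4 := hD z hz
      calc (z 0)⁻¹ * h z ≤ (z 0)⁻¹ * (a * k z) := by gcongr; exact hk z hz
        _ = _ := by ring

lemma DerivBound.of_succ (hu : DerivBound D (m + 1) u h) : DerivBound D m u h := by
  induction m generalizing u h with
  | zero => exact hu.1
  | succ m ih => exact ⟨hu.1, fun α => ih (hu.2 α)⟩

lemma DerivBound.add (hD : IsOpen D) (hu : DerivBound D m u h) (hv : DerivBound D m v h) :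
    DerivBound D m (fun z => u z + v z) h := by
  have key : ContDiffOn ℝ ∞ (fun z => u z + v z) D ∧
      ∃ C, 0 ≤ C ∧ ∀ z ∈ D, |u z + v z| ≤ C * h z := by
    obtain ⟨h1, C, hC, h2⟩ := hu.base
    obtain ⟨h1', C', hC', h2'⟩ := hv.base
    exact ⟨h1.add h1', C + C', by positivity, fun z hz =>
      (abs_add_le _ _).trans (by rw [add_mul]; exact add_le_add (h2 z hz) (h2' z hz))⟩
  induction m generalizing u v h with
  | zero => exact key
  | succ m ih =>
    refine ⟨key, fun α => ?_⟩
    refine DerivBound.congr hD (ih (hu.2 α) (hv.2 α) ?_) fun z hz =>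
      pd_add α (hu.differentiableAt hD hz) (hv.differentiableAt hD hz)
    obtain ⟨h1, C, hC, h2⟩ := (hu.2 α).base
    obtain ⟨h1', C', hC', h2'⟩ := (hv.2 α).base
    exact ⟨h1.add h1', C + C', by positivity, fun z hz =>
      (abs_add_le _ _).trans (by rw [add_mul]; exact add_le_add (h2 z hz) (h2' z hz))⟩

lemma DerivBound.mul_base (hu : DerivBound D m u h) (hv : DerivBound D m v k) :
    ContDiffOn ℝ ∞ (fun z => u z * v z) D ∧
      ∃ C, 0 ≤ C ∧ ∀ z ∈ D, |u z * v z| ≤ C * (h z * k z) := by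
  obtain ⟨h1, C, hC, h2⟩ := hu.base
  obtain ⟨h1', C', hC', h2'⟩ := hv.base
  refine ⟨h1.mul h1', C * C', by positivity, fun z hz => ?_⟩
  rw [abs_mul, mul_mul_mul_comm]
  exact mul_le_mul (h2 z hz) (h2' z hz) (abs_nonneg _) ((abs_nonneg _).trans (h2 z hz))

/-- By the Leibniz rule each derivative puts its `ρ⁻¹` on exactly one factor, so the weights
multiply. -/
lemma DerivBound.mul (hD : IsOpen D) (hu : DerivBound D m u h) (hv : DerivBound D m v k) :
    DerivBound D m (fun z => u z * v z) (fun z => h z * k z) := by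
  induction m generalizing u v h k with
  | zero => exact hu.mul_base hv
  | succ m ih =>
    refine ⟨hu.mul_base hv, fun α => ?_⟩
    have h1 := ih (hu.2 α) hv.of_succ
    have h2 := ih hu.of_succ (hv.2 α)
    simp only [mul_assoc] at h1
    simp only [mul_left_comm (h _)] at h2
    exact (h1.add hD h2).congr hD fun z hz =>
      pd_mul α (hu.differentiableAt hD hz) (hv.differentiableAt hD hz)

lemma DerivBound.const (D : Set (Fin (d + 2) → ℝ)) (m : ℕ) (a : ℝ)
    (hk : ∃ C, 0 ≤ C ∧ ∀ z ∈ D, |a| ≤ C * k z) : DerivBound D m (fun _ => a) k := by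
  induction m generalizing a k with
  | zero => exact ⟨contDiffOn_const, hk⟩
  | succ m ih =>
    refine ⟨⟨contDiffOn_const, hk⟩, fun α => ?_⟩
    have h1 : pd α (fun _ : Fin (d + 2) → ℝ => a) = fun _ => 0 := funext fun z => pd_const α a
    rw [h1]
    refine ih 0 ⟨0, le_rfl, fun z _ => by simp⟩

lemma DerivBound.const_one (D : Set (Fin (d + 2) → ℝ)) (m : ℕ) (a : ℝ) :
    DerivBound D m (fun _ => a) (fun _ => 1) :=
  DerivBound.const D m a ⟨|a|, abs_nonneg a, fun z _ => by simp⟩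

lemma DerivBound.pow (hD : IsOpen D) (hu : DerivBound D m u h) (n : ℕ) :
    DerivBound D m (fun z => u z ^ n) (fun z => h z ^ n) := by
  induction n with
  | zero => simpa using DerivBound.const_one D m 1
  | succ n ih => simpa only [pow_succ] using ih.mul hD hu

lemma isBigO0_of_derivBound (hu : ∀ m, DerivBound D m u h) : IsBigO0 D u h := by
  refine ⟨(hu 0).1, fun l => ?_⟩
  have key : ∀ (l : List (Fin (d + 2))) (u h : (Fin (d + 2) → ℝ) → ℝ),
      DerivBound D l.length u h → ∃ C : ℝ, ∀ z ∈ D,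
        |pdList l u z| ≤ C * ((z 0 ^ l.length)⁻¹ * h z) := by
    intro l
    -- `pdList` applies the last index of the list first, while `DerivBound` strips the innermost
    -- derivative; hence induction from the end of the list.
    induction l using List.reverseRecOn with
    | nil =>
      intro u h hu
      obtain ⟨-, C, -, hC⟩ := hu
      exact ⟨C, by simpa [pdList] using hC⟩
    | append_singleton l α ih =>
      intro u h hu
      rw [List.length_append, List.length_singleton] at hu
      obtain ⟨C, hC⟩ := ih _ _ (hu.2 α)
      refine ⟨C, fun z hz => ?_⟩
      have h1 := hC z hz
      rw [List.length_append, List.length_singleton, pow_succ, mul_inv, mul_assoc]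
      simpa only [pdList, List.foldr_append, List.foldr_cons, List.foldr_nil] using h1
  exact key l u h (hu _)

lemma derivBound_rho (hD : ∀ z ∈ D, 0 < z 0) (m : ℕ) :
    DerivBound D m (fun z => z 0) (fun z => z 0) := by
  have key : ContDiffOn ℝ ∞ (fun z : Fin (d + 2) → ℝ => z 0) D ∧
      ∃ C : ℝ, 0 ≤ C ∧ ∀ z ∈ D, |z 0| ≤ C * z 0 :=
    ⟨(contDiff_apply ℝ ℝ (0 : Fin (d + 2))).contDiffOn, 1, zero_le_one, fun z hz => by
      rw [abs_of_pos (hD z hz), one_mul]⟩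
  cases m with
  | zero => exact key
  | succ m =>
    refine ⟨key, fun α => ?_⟩
    have h1 : pd α (fun z : Fin (d + 2) → ℝ => z 0) = fun _ => if α = 0 then 1 else 0 :=
      funext fun z => pd_coord (a := fun t => t) α (hasDerivAt_id (z 0))
    rw [h1]
    refine DerivBound.const D m _ ⟨1, zero_le_one, fun z hz => ?_⟩
    rw [inv_mul_cancel₀ (hD z hz).ne']
    split_ifs <;> simp

/-- Differentiation exchanges the two functions, so they are treated together; `ρ ≤ 1` gives `1 ≤
ρ⁻¹`. -/
lemma derivBound_sin_cos (hD : IsOpen D) (hD0 : ∀ z ∈ D, 0 < z 0) (hD1 : ∀ z ∈ D, z 0 ≤ 1) (m : ℕ) :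
    DerivBound D m (fun z => Real.sin (z 1)) (fun _ => 1) ∧
      DerivBound D m (fun z => Real.cos (z 1)) (fun _ => 1) := by
  have hs : ContDiffOn ℝ ∞ (fun z : Fin (d + 2) → ℝ => Real.sin (z 1)) D ∧
      ∃ C : ℝ, 0 ≤ C ∧ ∀ z ∈ D, |Real.sin (z 1)| ≤ C * 1 :=
    ⟨(Real.contDiff_sin.comp (contDiff_apply ℝ ℝ (1 : Fin (d + 2)))).contDiffOn, 1, zero_le_one,
      fun z _ => by simpa using Real.abs_sin_le_one (z 1)⟩
  have hc : ContDiffOn ℝ ∞ (fun z : Fin (d + 2) → ℝ => Real.cos (z 1)) D ∧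
      ∃ C : ℝ, 0 ≤ C ∧ ∀ z ∈ D, |Real.cos (z 1)| ≤ C * 1 :=
    ⟨(Real.contDiff_cos.comp (contDiff_apply ℝ ℝ (1 : Fin (d + 2)))).contDiffOn, 1, zero_le_one,
      fun z _ => by simpa using Real.abs_cos_le_one (z 1)⟩
  have hle : ∀ z ∈ D, (1 : ℝ) * 1 ≤ 1 * ((z 0)⁻¹ * 1) := fun z hz => by
    simpa using (one_le_inv₀ (hD0 z hz)).2 (hD1 z hz)
  induction m with
  | zero => exact ⟨hs, hc⟩
  | succ m ih =>
    refine ⟨⟨hs, fun α => ?_⟩, ⟨hc, fun α => ?_⟩⟩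
    · have h1 : pd α (fun z : Fin (d + 2) → ℝ => Real.sin (z 1)) =
          fun z => (if α = 1 then 1 else 0) * Real.cos (z 1) := funext fun z => by
        rw [pd_coord α (Real.hasDerivAt_sin (z 1))]; split_ifs <;> simp
      rw [h1]
      exact ((DerivBound.const_one D m _).mul hD ih.2).mono hD0 zero_le_one hle
    · have h1 : pd α (fun z : Fin (d + 2) → ℝ => Real.cos (z 1)) =
          fun z => (if α = 1 then -1 else 0) * Real.sin (z 1) := funext fun z => by
        rw [pd_coord α (Real.hasDerivAt_cos (z 1))]; split_ifs <;> simp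
      rw [h1]
      exact ((DerivBound.const_one D m _).mul hD ih.1).mono hD0 zero_le_one hle

/-- Each `t`-derivative costs one more factor `1 / sin t`, which the hypothesis `hs'` trades for the
permitted `ρ⁻¹`. -/
lemma derivBound_inv_sin (hD : IsOpen D) (hD0 : ∀ z ∈ D, 0 < z 0) (hD1 : ∀ z ∈ D, z 0 ≤ 1)
    (hs : ∀ z ∈ D, 0 < Real.sin (z 1)) (hs' : ∀ z ∈ D, (Real.sin (z 1))⁻¹ ≤ (z 0)⁻¹) (m : ℕ) :
    DerivBound D m (fun z => (Real.sin (z 1))⁻¹) (fun z => (Real.sin (z 1))⁻¹) := by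
  have key : ContDiffOn ℝ ∞ (fun z : Fin (d + 2) → ℝ => (Real.sin (z 1))⁻¹) D ∧
      ∃ C : ℝ, 0 ≤ C ∧ ∀ z ∈ D, |(Real.sin (z 1))⁻¹| ≤ C * (Real.sin (z 1))⁻¹ :=
    ⟨((derivBound_sin_cos hD hD0 hD1 0).1.1).inv fun z hz => (hs z hz).ne', 1, zero_le_one,
      fun z hz => by rw [abs_of_pos (inv_pos.2 (hs z hz)), one_mul]⟩
  induction m with
  | zero => exact key
  | succ m ih =>
    refine ⟨key, fun α => ?_⟩
    have h2 := (((DerivBound.const_one D m (if α = 1 then -1 else 0)).mul hD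
      (derivBound_sin_cos hD hD0 hD1 m).2).mul hD ih).mul hD ih
    refine (h2.congr hD fun z hz => ?_).mono hD0 zero_le_one fun z hz => ?_
    · rw [pd_coord α ((Real.hasDerivAt_sin (z 1)).fun_inv (hs z hz).ne')]
      split_ifs
      · field_simp
      · simp
    · have h3 := inv_pos.2 (hs z hz)
      simp only [one_mul]
      exact mul_le_mul_of_nonneg_right (hs' z hz) h3.le

/-! ### Error terms that are monomials in `f̂` and `ρ`. -/

variable {ρs : ℝ} {φ : Coord d} {ρ₀ : ℝ}

lemma isOpen_nearBoundary (ρs : ℝ) (φ : Coord d) (ρ₀ f₀ : ℝ) :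
    IsOpen (nearBoundary ρs φ ρ₀ f₀) := by
  rw [isOpen_iff_mem_nhds]
  rintro z ⟨hz, hz0, hzf⟩
  have hs : 0 < Real.sin (z 1) := Real.sin_pos_of_pos_of_lt_pi hz.2.2.1 hz.2.2.2.1
  filter_upwards [(isOpen_coordDomain ρs φ).mem_nhds hz,
    (continuous_apply (0 : Fin (d + 2))).continuousAt.eventually_lt_const hz0,
    (differentiableAt_fhatC φ hs).continuousAt.eventually_lt_const hzf] with y h1 h2 h3
  exact ⟨h1, h2, h3⟩

lemma derivBound_fhatC (hρ : ρ₀ ≤ 1 / 4) (m : ℕ) :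
    DerivBound (nearBoundary ρs φ ρ₀ (1 / 8)) m (fhatC φ) (fhatC φ) := by
  set D := nearBoundary ρs φ ρ₀ (1 / 8) with hDdef
  have hD : IsOpen D := isOpen_nearBoundary _ _ _ _
  have hD0 : ∀ z ∈ D, 0 < z 0 := fun z hz => hz.1.1
  have hD1 : ∀ z ∈ D, z 0 ≤ 1 / 4 := fun z hz => hz.2.1.le.trans hρ
  have hD2 : ∀ z ∈ D, z 0 ≤ 1 := fun z hz => (hD1 z hz).trans (by norm_num)
  have hD3 : ∀ z ∈ D, 1 / 2 ≤ 1 - z 0 ^ 2 / 4 := fun z hz => by nlinarith [hD0 z hz, hD1 z hz]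
  have hs : ∀ z ∈ D, 0 < Real.sin (z 1) := fun z hz =>
    Real.sin_pos_of_pos_of_lt_pi hz.1.2.2.1 hz.1.2.2.2.1
  -- From `f̂ < 1/8` and `1 - ρ²/4 ≥ 1/2` one gets `ρ / sin t < 1/4`.
  have hs' : ∀ z ∈ D, (Real.sin (z 1))⁻¹ ≤ (z 0)⁻¹ := fun z hz => by
    have h1 : (Real.sin (z 1))⁻¹ * (z 0 * (1 - z 0 ^ 2 / 4)) < 1 / 8 := hz.2.2
    have h2 := hD0 z hz
    have h3 := inv_pos.2 (hs z hz)
    rw [← one_div (z 0), le_div_iff₀ h2]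
    nlinarith [mul_le_mul_of_nonneg_left (hD3 z hz) (mul_pos h3 h2).le]
  have h1 := derivBound_rho hD0 m
  have h2 : DerivBound D m (fun z => 1 + -(1 / 4) * (z 0 * z 0)) (fun _ => 1) := by
    refine (DerivBound.const_one D m 1).add hD ?_
    refine ((DerivBound.const_one D m (-(1 / 4))).mul hD (h1.mul hD h1)).mono hD0 zero_le_one
      fun z hz => ?_
    nlinarith [hD0 z hz, hD2 z hz]
  have h3 := (derivBound_inv_sin hD hD0 hD2 hs hs' m).mul hD (h1.mul hD h2)
  refine (h3.congr hD fun z hz => ?_).mono hD0 zero_le_two fun z hz => ?_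
  · simp only [fhatC, fhat, pointM]; ring
  · have h4 := inv_pos.2 (hs z hz)
    have h5 := hD0 z hz
    simp only [fhatC, fhat, pointM]
    nlinarith [mul_le_mul_of_nonneg_left (hD3 z hz) (mul_pos h4 h5).le]

lemma isBigO0_fhatC (hρ : ρ₀ ≤ 1 / 4) (a : ℝ) (i j : ℕ) :
    IsBigO0 (nearBoundary ρs φ ρ₀ (1 / 8)) (fun z => a * (fhatC φ z ^ i * z 0 ^ j))
      (fun z => fhatC φ z ^ i * z 0 ^ j) := by
  refine isBigO0_of_derivBound fun m => ?_
  have hD : IsOpen (nearBoundary ρs φ ρ₀ (1 / 8)) := isOpen_nearBoundary _ _ _ _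
  have h1 := (DerivBound.const_one _ m a).mul hD
    (((derivBound_fhatC (ρs := ρs) (φ := φ) hρ m).pow hD i).mul hD
      ((derivBound_rho (fun z hz => hz.1.1) m).pow hD j))
  simpa only [one_mul] using h1

end error

end

end BorderlineAdS

end

/-- The frames `(N̂, V̂, Ê_X)` are well defined for `ρ, f̂` small, and there the deformation tensor obeys
the lower bound. The thresholds depend only on the segment; the error terms `e₁ = 𝒪₀(f̂^{n-1} ρ³)` and
`e₂ = 𝒪₀(f̂^n)` are functions on spacetime, independent of the frame and of the covector `θ`. -/
theorem theorem4p6 (d : ℕ) (ρs : ℝ) (g : BorderlineAdS.TensorM d) (gb : BorderlineAdS.TensorI d)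
    (Ξ : Set (BorderlineAdS.Coord d))
    (hg : BorderlineAdS.IsBorderlineSegment ρs g gb Ξ) :
    ∃ ρ₀ : ℝ, 0 < ρ₀ ∧ ∃ f₀ : ℝ, 0 < f₀ ∧
      (∀ φ ∈ Ξ, ∀ z ∈ BorderlineAdS.nearBoundary ρs φ ρ₀ f₀,
        (∀ v, BorderlineAdS.IsHorizontal v → v ≠ 0 →
          0 < BorderlineAdS.innerAt (BorderlineAdS.compM g φ) z v v) ∧
        0 < BorderlineAdS.innerAt (BorderlineAdS.compM g φ) z
            (BorderlineAdS.grad (BorderlineAdS.compM g φ) (BorderlineAdS.fhatC φ) z)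
            (BorderlineAdS.grad (BorderlineAdS.compM g φ) (BorderlineAdS.fhatC φ) z) ∧
        ∀ E, BorderlineAdS.IsHorizontalFrame g φ z E →
          BorderlineAdS.innerAt (BorderlineAdS.compM g φ) z
            (BorderlineAdS.Vcheck g φ z E) (BorderlineAdS.Vcheck g φ z E) < 0) ∧
      ∀ (K : ℝ) (ζ : ℝ × ℝ × BorderlineAdS.Sph d → ℝ),
        BorderlineAdS.BorderlinePseudoconvex ρs gb Ξ K ζ →
        ∃ e₁ e₂ : ℝ × ℝ × BorderlineAdS.Sph d → ℝ,
          (∀ φ ∈ Ξ,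
            BorderlineAdS.IsBigO0 (BorderlineAdS.nearBoundary ρs φ ρ₀ f₀)
              (fun z => e₁ (BorderlineAdS.pointM φ z))
              (fun z => BorderlineAdS.fhatC φ z ^ (BorderlineAdS.bdim d - 1) * z 0 ^ 3) ∧
            BorderlineAdS.IsBigO0 (BorderlineAdS.nearBoundary ρs φ ρ₀ f₀)
              (fun z => e₂ (BorderlineAdS.pointM φ z))
              (fun z => BorderlineAdS.fhatC φ z ^ BorderlineAdS.bdim d)) ∧
          ∀ φ ∈ Ξ, ∀ z ∈ BorderlineAdS.nearBoundary ρs φ ρ₀ f₀,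
            ∀ E, BorderlineAdS.IsHorizontalFrame g φ z E →
            ∀ θ : Fin (d + 2) → ℝ,
              (K * BorderlineAdS.fhatC φ z ^ (BorderlineAdS.bdim d - 2) * z 0 ^ 3
                  + e₁ (BorderlineAdS.pointM φ z))
                * (BorderlineAdS.pair θ (BorderlineAdS.Vhat g φ z E) ^ 2
                    + ∑ X, BorderlineAdS.pair θ (E X) ^ 2)
              - (((BorderlineAdS.bdim d - 1 : ℤ) : ℝ)
                    * BorderlineAdS.fhatC φ z ^ (BorderlineAdS.bdim d - 2)
                  + e₂ (BorderlineAdS.pointM φ z))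
                * BorderlineAdS.pair θ (BorderlineAdS.Nhat g φ z) ^ 2
              ≤ BorderlineAdS.deformUp g ζ φ z θ := by
  obtain ⟨b, hb⟩ := hg.exists_coeffBounds
  -- The bound `1 ≤ b` is recorded only at points of coordinate domains; if these were all empty,
  -- any constant would serve.
  obtain ⟨b', hb', hbound⟩ : ∃ b' : ℝ, 1 ≤ b' ∧ ∀ φ ∈ Ξ, ∀ z ∈ BorderlineAdS.coordDomain ρs φ,
      BorderlineAdS.CoeffBounds b' g gb φ z := by
    by_cases h : ∃ φ ∈ Ξ, (BorderlineAdS.coordDomain ρs φ).Nonempty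
    · obtain ⟨φ, hφ, z, hz⟩ := h
      exact ⟨b, (hb φ hφ z hz).one_le, hb⟩
    · exact ⟨1, le_rfl, fun φ hφ z hz => (h ⟨φ, hφ, z, hz⟩).elim⟩
  set B := BorderlineAdS.pointConst d b' with hBdef
  have hB : 1 ≤ B := by linarith [BorderlineAdS.le_pointConst (d := d) hb']
  have hρ₀ : 1 / (8 * B) ≤ 1 / 4 := by
    rw [div_le_div_iff₀ (by positivity) (by norm_num)]
    linarith
  have hsmall : ∀ φ : BorderlineAdS.Coord d,
      ∀ z ∈ BorderlineAdS.nearBoundary ρs φ (1 / (8 * B)) (1 / 8), 4 * B * z 0 < 1 := fun φ z hz => by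
    have h1 := hz.2.1
    rw [lt_div_iff₀ (by linarith)] at h1
    linarith
  -- The first threshold gives `4 B ρ < 1/2`, the second is the bound on `f` in `FoliationPoint`.
  -- Both are fixed before `K` and `ζ` appear.
  refine ⟨1 / (8 * B), by positivity, 1 / 8, by norm_num, fun φ hφ z hz => ?_,
    fun K ζ p => ?_⟩
  · have h := hg.nearPoint hφ hz.1 (hbound φ hφ z hz.1) (hsmall φ z hz).le
    have k := BorderlineAdS.foliationPoint hz.1 h.ρ_le hz.2.2.le
    have hG := BorderlineAdS.compM_eq_pointMetric (g := g) (φ := φ) h.ρ_pos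
    refine ⟨fun v hv hv0 => ?_, ?_, fun E hE => ?_⟩
    · rw [BorderlineAdS.innerAt_eq_bil, hG]
      exact h.horizontal_pos hv.2 hv0
    · rw [BorderlineAdS.innerAt_eq_bil, hG]
      have h1 := h.grad_sq_bounds k (h.isGrad k.s_pos)
      have h2 := k.f_pos
      exact lt_of_lt_of_le (by positivity) h1
    · rw [BorderlineAdS.innerAt_eq_bil, hG, BorderlineAdS.Vcheck_eq h.ρ_pos]
      exact h.checkV_timelike k (hE.isFrame h.ρ_pos)
  · obtain ⟨Z, hZ⟩ := (Filter.eventually_all_finite hg.finite |>.2 fun φ hφ =>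
      BorderlineAdS.bdd_of_isBigO (p.bdd φ hφ) fun z _ => zero_le_one).exists
    -- `ζ` enters only through its supremum bound `Z`. Both errors are thus constant multiples of
    -- monomials in `f̂` and `ρ`, independent of chart and frame, and their derivative bounds reduce
    -- to those of `f̂` and `ρ`.
    refine ⟨fun q => -(53 * K + BorderlineAdS.deformConst d b' Z) *
        (BorderlineAdS.fhat q ^ d * q.1 ^ 3),
      fun q => (BorderlineAdS.deformConst d b' Z + 10 * d) *
        BorderlineAdS.fhat q ^ (d + 1), fun φ hφ => ⟨?_, ?_⟩,
      fun φ hφ z hz E hE θ => ?_⟩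
    · simp only [BorderlineAdS.bdim, add_sub_cancel_right, zpow_natCast]
      exact BorderlineAdS.isBigO0_fhatC hρ₀ _ d 3
    · have h1 := BorderlineAdS.isBigO0_fhatC (ρs := ρs) (φ := φ) hρ₀
        (BorderlineAdS.deformConst d b' Z + 10 * d) (d + 1) 0
      have h2 : ∀ x : ℝ, x ^ BorderlineAdS.bdim d = x ^ (d + 1) := fun x => by
        rw [← zpow_natCast]; rfl
      simp only [h2]
      simp only [pow_zero, mul_one] at h1
      exact h1
    · exact hg.deformUp_ge hφ (hbound φ hφ) hz.1 (hsmall φ z hz) hz.2.2.le p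
        (by simpa using hZ φ hφ z hz.1) hE θ
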